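/- **Setting.** Let $d$ be a positive integer, let $R:\mathbb C^2\to\operatorname{End}(\mathbb C^d\otimes\mathbb C^d)$, $k,\alpha\in\mathbb C$, $\hat\varphi\in\operatorname{End}(\mathbb C^d)$, and put $\Theta(a)=e^{a\hat\varphi}$. Let $P$ be the permutation matrix on $\mathbb C^d\otimes\mathbb C^d$. Assume that there is an open neighbourhood $U$ of $0$ in $\mathbb C$ such that $R$ is holomorphic on $U\times U$ and, for all spectral parameters in $U$: $R_{12}(\lambda,\mu)R_{13}(\lambda,\nu)R_{23}(\mu,\nu)=R_{23}(\mu,\nu)R_{13}(\lambda,\nu)R_{12}(\lambda,\mu)$; $R(\lambda,\lambda)=P$; $R_{12}(\lambda,\mu)R_{21}(\mu,\lambda)=1$; $R(\lambda,\mu)^{t}=R(\lambda,\mu)$; and $[R(\lambda,\mu),\Theta(a)\otimes\Theta(a)]=0$ for all $a\in\mathbb C$. On a periodic chain of $L$ sites let $$H=k\sum_{j=1}^L\partial_\lambda (PR)_{j-1,j}(\lambda,0)\big|_{\lambda=0}-\alpha\hat\Phi,\qquad \hat\Phi=\sum_{j=1}^L\hat\varphi_j .$$ For $T>0$, $t\in\mathbb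 R$, an integer $m\ge0$ and $x,y\in\operatorname{End}(\mathbb C^d)$ define $$\langle x_1y_{m+1}(t)\rangle_T=\lim_{L\to\infty}\frac{\operatorname{tr}\{e^{-H/T}x_1e^{itH}y_{m+1}e^{-itH}\}}{\operatorname{tr}\{e^{-H/T}\}} .$$ With $t_\perp(\lambda)=\operatorname{tr}_a\{R_{aL}(\lambda,0)\cdots R_{a1}(\lambda,0)\}$ and $\overline t_\perp(\lambda)=\operatorname{tr}_a\{R_{1a}(0,\lambda)\cdots R_{La}(0,\lambda)\}$ put, for even $N$, $\rho_{N,L}(\beta)=\bigl(t_\perp(-k\beta/N)\,\overline t_\perp(k\beta/N)\bigr)^{N/2}$ and $$A_{N,L}=\frac{\operatorname{tr}\{\rho_{N,L}(\tfrac1T+it)\,e^{(1/T+it)\alpha\hat\Phi}x_1e^{-it\alpha\hat\Phi}\rho_{N,L}(-it)\,y_{m+1}\}}{\operatorname{tr}\{e^{\alpha\hat\Phi/T}\rho_{N,L}(\tfrac1T+it)\rho_{N,L}(-it)\}} .$$ Let $\kappa=\alpha/T$ and $t_R=ikt$. For even $N$ and $\varepsilon\in\mathbb C$ let $\nu_{2j-1}=-\nu_{2j}$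 be equal to $-t_R/N$ for $1\le j\le N/2$, to $\varepsilon$ for $j=N/2+1$, and to $(t_R+k/T)/N$ for $N/2+2\le j\le N+1$. Define the staggered monodromy matrix on $2N+2$ vertical spaces, $$T_a(\lambda|\kappa)=\Theta_a(\kappa)R^{t_1}_{\overline{2N+2},a}(\nu_{2N+2},\lambda)R_{a,\overline{2N+1}}(\lambda,\nu_{2N+1})\cdots R^{t_1}_{\overline 2,a}(\nu_2,\lambda)R_{a,\overline 1}(\lambda,\nu_1),$$ where $t_1$ is transposition in the first space on which $R$ acts, the quantum transfer matrix $t(\lambda|\kappa)=\operatorname{tr}_aT_a(\lambda|\kappa)$, and $X(\lambda|\kappa)=\operatorname{tr}_a\{x_aT_a(\lambda|\kappa)\}$, $Y(\lambda|\kappa)=\operatorname{tr}_a\{y_aT_a(\lambda|\kappa)\}$. These operators depend on $N$ and $\varepsilon$. **Assumptions.** 1. $[\hat\varphi,x]=s(x)\,x$ for some $s(x)\in\mathbb C$. 2. $\operatorname{tr}\{e^{-H/T}\}\ne0$ for all large $L$. 3. The limits $L\to\infty$ and $N\to\infty$ of $A_{N,L}$ can be interchanged: if the inner limits exist, then $\lim_L\lim_NA_{N,L}$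 and $\lim_N\lim_LA_{N,L}$ exist and are equal. 4. For all large even $N$, the matrix $t(0|\kappa)$ at $\varepsilon=0$ has an algebraically simple eigenvalue whose modulus exceeds that of every other eigenvalue. 5. For all large even $N$ and all sufficiently small $\varepsilon\neq0$, the matrices $t(\varepsilon|\kappa)$ and $t(\pm t_R/N|\kappa)$ are invertible. 6. For all large even $N$ and all sufficiently small $\varepsilon\ne0$, there is a basis of joint eigenvectors, $t(\lambda|\kappa)|\Psi_n\rangle=\Lambda_n(\lambda|\kappa)|\Psi_n\rangle$ for all $\lambda\in U$, with $|\Lambda_n(0|\kappa)|<|\Lambda_0(0|\kappa)|$ for $n\ne0$. Fix such a basis for every such $N,\varepsilon$, and fix dual (left) eigenvectors $\langle\Psi_n|$, that is, $\langle\Psi_j|\Psi_n\rangle=0$ if and only if $j\ne n$. **Theorem.** The limit defining $\langle x_1y_{m+1}(t)\rangle_T$ exists, the limits below exist (the one in $\varepsilon$ for all large even $N$), and $$\langle x_1y_{m+1}(t)\rangle_T=\lim_{N\to\infty}\lim_{\varepsilon\to0}e^{it\alpha s(x)}\sum_n\frac{\langle\Psi_0|X(\varepsilon|\kappa)|\Psi_n\rangle\langle\Psi_n|Y(\varepsilon|\kappa)|\Psi_0\rangle}{\Lambda_n(\varepsilon|\kappa)\langle\Psi_0|\Psi_0\rangle\Lambda_0(\varepsilon|\kappa)\langle\Psi_n|\Psi_n\rangle}\left(\frac{\Lambda_n(0|\kappa)}{\Lambda_0(0|\kappa)}\right)^m\left(\frac{\Lambda_n(\frac{t_R}N|\kappa)\Lambda_0(-\frac{t_R}N|\kappa)}{\Lambda_0(\frac{t_R}N|\kappa)\Lambda_n(-\frac{t_R}N|\kappa)}\right)^{N/2},$$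 where $N$ runs through the even integers and $\varepsilon$ through the non-zero complex numbers. -/

import Mathlib

open Filter Topology
open scoped Matrix Kronecker

noncomputable section

namespace QTM

/-! ### Operators on tensor products of copies of `ℂ^d`

`Op d S` is `End ((ℂ^d)^{⊗ S})`, written as matrices in the product basis; a basis vector is a
configuration `σ : S → Fin d`. -/

abbrev Op (d : ℕ) (S : Type) : Type := Matrix (S → Fin d) (S → Fin d) ℂ

/-- `End (ℂ^d ⊗ ℂ^d)`; the row (or column) index `(a, b)` stands for `e_a ⊗ e_b`. -/
abbrev TwoOp (d : ℕ) : Type := Matrix (Fin d × Fin d) (Fin d × Fin d) ℂ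

/-- The operator `x_j`: the single-site operator `x` acting on the site `j`. -/
def siteOp {d : ℕ} {S : Type} [Fintype S] [DecidableEq S] (j : S)
    (x : Matrix (Fin d) (Fin d) ℂ) : Op d S :=
  Matrix.of fun σ τ => if ∀ k, k ≠ j → σ k = τ k then x (σ j) (τ j) else 0

/-- The operator `A_{ij}`: the two-site operator `A` acting with its first tensor factor on the
site `i` and with its second one on the site `j` (for `i ≠ j`). -/
def pairOp {d : ℕ} {S : Type} [Fintype S] [DecidableEq S] (i j : S)
    (A : TwoOp d) : Op d S :=
  Matrix.of fun σ τ =>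
    if ∀ k, k ≠ i → k ≠ j → σ k = τ k then A (σ i, σ j) (τ i, τ j) else 0

/-- The permutation matrix `P (x ⊗ y) = y ⊗ x`. -/
def permOp (d : ℕ) : TwoOp d :=
  Matrix.of fun p q => if p.1 = q.2 ∧ p.2 = q.1 then 1 else 0

/-! ### Fundamental integrable lattice models -/

/-- The data of a lattice model: the `R`-matrix, the constant in front of the logarithmic derivative
of the transfer matrix, the local operator `φ̂` and the strength `α` of the external field. -/
structure LatticeModel (d : ℕ) where
  R : ℂ → ℂ → TwoOp d
  ks : ℂ
  phi : Matrix (Fin d) (Fin d) ℂ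
  alpha : ℂ

/-- The twist `Θ(a) = exp (a φ̂)`. -/
def LatticeModel.twist {d : ℕ} (Mo : LatticeModel d) (a : ℂ) : Matrix (Fin d) (Fin d) ℂ :=
  NormedSpace.exp (a • Mo.phi)

/-- The model is fundamental with spectral parameters in the neighbourhood `U` of `0`: `R` is
holomorphic on `U × U` and there solves the Yang-Baxter equation, is regular, unitary, symmetric,
and commutes with `Θ(a) ⊗ Θ(a)`. -/
structure LatticeModel.IsFundamental {d : ℕ} (Mo : LatticeModel d) (U : Set ℂ) : Prop where
  isOpen : IsOpen U
  zero_mem : (0 : ℂ) ∈ U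
  holomorphic : ∀ p q, DifferentiableOn ℂ (fun z : ℂ × ℂ => Mo.R z.1 z.2 p q) (U ×ˢ U)
  yangBaxter : ∀ u ∈ U, ∀ v ∈ U, ∀ w ∈ U,
    pairOp (S := Fin 3) 0 1 (Mo.R u v) * pairOp 0 2 (Mo.R u w) * pairOp 1 2 (Mo.R v w) =
      pairOp 1 2 (Mo.R v w) * pairOp 0 2 (Mo.R u w) * pairOp 0 1 (Mo.R u v)
  regular : ∀ u ∈ U, Mo.R u u = permOp d
  unitary : ∀ u ∈ U, ∀ v ∈ U, Mo.R u v * (permOp d * Mo.R v u * permOp d) = 1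
  symmetric : ∀ u ∈ U, ∀ v ∈ U, (Mo.R u v)ᵀ = Mo.R u v
  twist_commute : ∀ u ∈ U, ∀ v ∈ U, ∀ a : ℂ,
    Commute (Mo.R u v) (Mo.twist a ⊗ₖ Mo.twist a)

/-! ### Monodromy matrices

An operator on `ℂ^d ⊗ (ℂ^d)^{⊗ S}` (auxiliary space `a` and sites `S`) is written as a `d × d`
matrix whose entries are operators on `(ℂ^d)^{⊗ S}`. -/

abbrev AuxOp (d : ℕ) (S : Type) : Type := Matrix (Fin d) (Fin d) (Op d S)

/-- `A_{aj}`: first tensor factor of `A` on the auxiliary space, second one on the site `j`. -/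
def auxSite {d : ℕ} {S : Type} [Fintype S] [DecidableEq S] (A : TwoOp d) (j : S) : AuxOp d S :=
  Matrix.of fun a b => siteOp j (Matrix.of fun p q => A (a, p) (b, q))

/-- `A_{ja}`: first tensor factor of `A` on the site `j`, second one on the auxiliary space. -/
def siteAux {d : ℕ} {S : Type} [Fintype S] [DecidableEq S] (A : TwoOp d) (j : S) : AuxOp d S :=
  Matrix.of fun a b => siteOp j (Matrix.of fun p q => A (p, a) (q, b))

/-- `A^{t_1}`: transposition with respect to the first tensor factor. -/
def transposeFst {d : ℕ} (A : TwoOp d) : TwoOp d :=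
  Matrix.of fun p q => A (q.1, p.2) (p.1, q.2)

/-- `x_a`: the operator `x` acting on the auxiliary space only. -/
def auxOnly {d : ℕ} (S : Type) [Fintype S] [DecidableEq S]
    (x : Matrix (Fin d) (Fin d) ℂ) : AuxOp d S :=
  Matrix.of fun a b => x a b • (1 : Op d S)

/-! ### Row-to-row transfer matrices, Hamiltonian and correlation functions

The `L` sites `1, …, L` of the chain are numbered by `0, …, L - 1` here. -/

namespace LatticeModel

variable {d : ℕ} (Mo : LatticeModel d)

/-- `t_⊥(u) = tr_a {R_{aL}(u,0) ⋯ R_{a1}(u,0)}`. -/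
def rowTransfer (L : ℕ) (u : ℂ) : Op d (Fin L) :=
  Matrix.trace ((List.ofFn fun j : Fin L => auxSite (Mo.R u 0) j).reverse.prod)

/-- The transfer matrix `tr_a {R_{1a}(0,u) ⋯ R_{La}(0,u)}` of the inverse monodromy matrix. -/
def rowTransferBar (L : ℕ) (u : ℂ) : Op d (Fin L) :=
  Matrix.trace ((List.ofFn fun j : Fin L => siteAux (Mo.R 0 u) j).prod)

/-- The Trotter approximant
`ρ_{N,L}(β) = (t_⊥(- ks β / N) t̄_⊥(ks β / N))^{N/2}` with the even Trotter number `N = 2 n`. -/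
def trotterRho (n L : ℕ) (β : ℂ) : Op d (Fin L) :=
  (Mo.rowTransfer L (-(Mo.ks * β) / (2 * n : ℕ)) *
    Mo.rowTransferBar L (Mo.ks * β / (2 * n : ℕ))) ^ n

/-- The Hamiltonian density `∂_u (P R)(u, 0)` at `u = 0`. -/
def hamDensity : TwoOp d :=
  Matrix.of fun p q => deriv (fun u : ℂ => (permOp d * Mo.R u 0) p q) 0

/-- `H₀ = ks ∑_j (∂_u (P R)_{j-1,j})(0,0)`, with periodic boundary conditions (subtraction in
`Fin L` is modulo `L`). -/
def ham0 (L : ℕ) [NeZero L] : Op d (Fin L) :=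
  Mo.ks • ∑ j : Fin L, pairOp (j - 1) j Mo.hamDensity

/-- `Φ̂ = ∑_j φ̂_j`. -/
def fieldOp (L : ℕ) : Op d (Fin L) := ∑ j : Fin L, siteOp j Mo.phi

/-- The Hamiltonian `H = H₀ - α Φ̂`. -/
def ham (L : ℕ) [NeZero L] : Op d (Fin L) := Mo.ham0 L - Mo.alpha • Mo.fieldOp L

/-- The partition function `tr exp (- H / T)` of the chain of length `L`. -/
def partitionFunction (L : ℕ) [NeZero L] (T : ℝ) : ℂ :=
  Matrix.trace (NormedSpace.exp (-(1 / T : ℂ) • Mo.ham L))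

/-- The thermal average of `x_i y_j(t)` on the chain of length `L`,
`tr {exp (-H/T) x_i exp (i t H) y_j exp (- i t H)} / tr {exp (-H/T)}`. -/
def finiteCorrelator (L : ℕ) [NeZero L] (T t : ℝ) (x y : Matrix (Fin d) (Fin d) ℂ)
    (i j : Fin L) : ℂ :=
  Matrix.trace (NormedSpace.exp (-(1 / T : ℂ) • Mo.ham L) * siteOp i x *
      NormedSpace.exp ((Complex.I * t) • Mo.ham L) * siteOp j y *
      NormedSpace.exp (-(Complex.I * t) • Mo.ham L)) /
    Mo.partitionFunction L T

/-- The site at distance `m` from the first site, on the chain of length `l + m + 1`. -/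
def farSite (l m : ℕ) : Fin (l + m + 1) := ⟨m, by omega⟩

/-- `G` is the dynamical two-point function `⟨x_1 y_{m+1}(t)⟩_T`, that is, the limit of the thermal
averages as the length `L = l + m + 1` of the chain tends to infinity. -/
def IsDynamicalCorrelator (T t : ℝ) (x y : Matrix (Fin d) (Fin d) ℂ) (m : ℕ) (G : ℂ) : Prop :=
  Tendsto (fun l : ℕ => Mo.finiteCorrelator (l + m + 1) T t x y 0 (farSite l m)) atTop (𝓝 G)

/-- The approximant of Trotter number `N = 2 n` to the thermal average of `x_i y_j(t)`, in which
the exponentials of `H₀` are replaced by `ρ_{N,L}`. -/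
def trotterCorrelator (n L : ℕ) (T t : ℝ) (x y : Matrix (Fin d) (Fin d) ℂ)
    (i j : Fin L) : ℂ :=
  Matrix.trace (Mo.trotterRho n L (1 / T + Complex.I * t) *
      NormedSpace.exp (((1 / T + Complex.I * t) * Mo.alpha) • Mo.fieldOp L) * siteOp i x *
      NormedSpace.exp (-(Complex.I * t * Mo.alpha) • Mo.fieldOp L) *
      Mo.trotterRho n L (-(Complex.I * t)) * siteOp j y) /
    Matrix.trace (NormedSpace.exp ((Mo.alpha / T) • Mo.fieldOp L) *
      Mo.trotterRho n L (1 / T + Complex.I * t) * Mo.trotterRho n L (-(Complex.I * t)))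

end LatticeModel

/-- The two limits of a double sequence can be interchanged: if both inner limits exist (for all
large values of the other index), then both iterated limits exist and coincide. -/
def LimitsInterchange (A : ℕ → ℕ → ℂ) : Prop :=
  ∀ a b : ℕ → ℂ,
    (∀ᶠ l in atTop, Tendsto (fun n => A n l) atTop (𝓝 (a l))) →
    (∀ᶠ n in atTop, Tendsto (fun l => A n l) atTop (𝓝 (b n))) →
    ∃ g : ℂ, Tendsto a atTop (𝓝 g) ∧ Tendsto b atTop (𝓝 g)

/-! ### The inhomogeneous quantum transfer matrix

The vertical spaces `1̄, …, \overline{2 N + 2}` are numbered by `0, …, 2 N + 1` here, so that the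
odd spaces have even numbers. -/

namespace LatticeModel

variable {d : ℕ} (Mo : LatticeModel d)

/-- The factor of the staggered monodromy matrix at a vertical space: `R_{aj}(u, ν_j)` on odd
spaces, `R_{ja}^{t_1}(ν_j, u)` on even ones. -/
def staggeredFactor {M : ℕ} (ν : Fin M → ℂ) (u : ℂ) (j : Fin M) : AuxOp d (Fin M) :=
  if (j : ℕ) % 2 = 0 then auxSite (Mo.R u (ν j)) j
  else siteAux (transposeFst (Mo.R (ν j) u)) j

/-- The staggered, twisted, inhomogeneous monodromy matrix
`T_a(u|κ) = Θ_a(κ) R_{Ma}^{t_1}(ν_M, u) R_{a,M-1}(u, ν_{M-1}) ⋯ R_{2a}^{t_1}(ν_2, u) R_{a1}(u, ν_1)`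
on `M` vertical spaces. -/
def monodromy {M : ℕ} (κ : ℂ) (ν : Fin M → ℂ) (u : ℂ) : AuxOp d (Fin M) :=
  auxOnly (Fin M) (Mo.twist κ) * (List.ofFn (Mo.staggeredFactor ν u)).reverse.prod

/-- The inhomogeneous quantum transfer matrix `t(u|κ) = tr_a T_a(u|κ)`. -/
def qtm {M : ℕ} (κ : ℂ) (ν : Fin M → ℂ) (u : ℂ) : Op d (Fin M) :=
  Matrix.trace (Mo.monodromy κ ν u)

/-- `X(u|κ) = tr_a {x_a T_a(u|κ)}`. -/
def monodromyEntry {M : ℕ} (κ : ℂ) (ν : Fin M → ℂ) (x : Matrix (Fin d) (Fin d) ℂ) (u : ℂ) :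
    Op d (Fin M) :=
  Matrix.trace (auxOnly (Fin M) x * Mo.monodromy κ ν u)

/-- `t_R = i ks t`. -/
def tR (t : ℝ) : ℂ := Complex.I * Mo.ks * t

/-- The inhomogeneities for the Trotter number `N = 2 n` and the regularization parameter `ε`:
`ν_{2k-1} = - ν_{2k}` equals `- t_R / N` for `k = 1, …, N/2`, `ε` for `k = N/2 + 1` and
`(t_R + ks / T) / N` for `k = N/2 + 2, …, N + 1`. The number of the pair is `k - 1 = i / 2`. -/
def inhomogeneity (T t : ℝ) (n : ℕ) (ε : ℂ) (i : Fin (2 * (2 * n) + 2)) : ℂ :=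
  let v : ℂ :=
    if (i : ℕ) / 2 < n then -(Mo.tR t / (2 * n : ℕ))
    else if (i : ℕ) / 2 = n then ε
    else (Mo.tR t + Mo.ks / T) / (2 * n : ℕ)
  if (i : ℕ) % 2 = 0 then v else -v

/-- The quantum transfer matrix `t(u|κ)`, `κ = α / T`, at Trotter number `N = 2 n`. -/
def dynQtm (T t : ℝ) (n : ℕ) (ε : ℂ) (u : ℂ) : Op d (Fin (2 * (2 * n) + 2)) :=
  Mo.qtm (Mo.alpha / T) (Mo.inhomogeneity T t n ε) u

/-- The operator `X(u|κ)`, `κ = α / T`, at Trotter number `N = 2 n`. -/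
def dynEntry (T t : ℝ) (n : ℕ) (ε : ℂ) (x : Matrix (Fin d) (Fin d) ℂ) (u : ℂ) :
    Op d (Fin (2 * (2 * n) + 2)) :=
  Mo.monodromyEntry (Mo.alpha / T) (Mo.inhomogeneity T t n ε) x u

end LatticeModel

/-- The matrix `A` has a single dominant eigenvalue: an algebraically simple eigenvalue whose
modulus exceeds the modulus of every other eigenvalue. -/
def HasDominantEigenvalue {ι : Type} [Fintype ι] [DecidableEq ι] (A : Matrix ι ι ℂ) : Prop :=
  ∃ Λ : ℂ, A.charpoly.rootMultiplicity Λ = 1 ∧ ∀ μ ∈ A.charpoly.roots, μ ≠ Λ → ‖μ‖ < ‖Λ‖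

/-- Data for a complete set of states on `M` vertical spaces: a basis of kets `|Ψ_n⟩`, as many bras
`⟨Ψ_n|`, the functions `Λ_n`, and the label of the state `Ψ_0`. -/
structure StateData (d M : ℕ) where
  ket : Module.Basis (Fin (d ^ M)) ℂ ((Fin M → Fin d) → ℂ)
  bra : Fin (d ^ M) → ((Fin M → Fin d) → ℂ)
  ev : Fin (d ^ M) → ℂ → ℂ
  dom : Fin (d ^ M)

/-- The kets form a complete set of joint eigenvectors of the operators `t(u)`, `u ∈ U`, with
eigenvalues `Λ_n(u)`; the bras form a dual family, `⟨Ψ_j|Ψ_k⟩ = 0` if and only if `j ≠ k`, so that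
they are the left eigenvectors with the same eigenvalues; and `Ψ_0` belongs to the dominant
eigenvalue of `t(0)`. -/
structure StateData.IsEigenbasis {d M : ℕ} (E : StateData d M) (U : Set ℂ)
    (t : ℂ → Op d (Fin M)) : Prop where
  eigen : ∀ n, ∀ u ∈ U, t u *ᵥ E.ket n = E.ev n u • E.ket n
  dual : ∀ j k, E.bra j ⬝ᵥ E.ket k = 0 ↔ j ≠ k
  dominant : ∀ n, n ≠ E.dom → ‖E.ev n 0‖ < ‖E.ev E.dom 0‖

/-- The matrix element `⟨Ψ_j|A|Ψ_k⟩`. -/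
def StateData.elem {d M : ℕ} (E : StateData d M) (j : Fin (d ^ M)) (A : Op d (Fin M))
    (k : Fin (d ^ M)) : ℂ :=
  E.bra j ⬝ᵥ (A *ᵥ E.ket k)

/-- The form-factor series at Trotter number `N = 2 n` and regularization parameter `ε`. -/
def LatticeModel.formFactorSeries {d : ℕ} (Mo : LatticeModel d) (T t : ℝ)
    (x y : Matrix (Fin d) (Fin d) ℂ) (s : ℂ) (m n : ℕ) (ε : ℂ)
    (E : StateData d (2 * (2 * n) + 2)) : ℂ :=
  Complex.exp (Complex.I * t * Mo.alpha * s) *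
    ∑ k, E.elem E.dom (Mo.dynEntry T t n ε x ε) k * E.elem k (Mo.dynEntry T t n ε y ε) E.dom /
        (E.ev k ε * E.elem E.dom 1 E.dom * E.ev E.dom ε * E.elem k 1 k) *
      (E.ev k 0 / E.ev E.dom 0) ^ m *
      (E.ev k (Mo.tR t / (2 * n : ℕ)) * E.ev E.dom (-(Mo.tR t / (2 * n : ℕ))) /
        (E.ev E.dom (Mo.tR t / (2 * n : ℕ)) * E.ev k (-(Mo.tR t / (2 * n : ℕ))))) ^ n

end QTM

end

set_option linter.unusedSectionVars false

noncomputable section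

namespace QTM

/-! ### The algebra of local operators -/

section LocalOperators

variable {d : ℕ} {S : Type} [Fintype S] [DecidableEq S]

/-! The thermal average is written as the partition function of a two-dimensional lattice with two
insertions. The lattice is then summed column by column instead of row by row.

Rows. Regularity makes the transfer matrices at 0 mutually inverse shifts. Differentiating
regularity and unitarity gives t_⊥(-kβ/N) t̄_⊥(kβ/N) = 1 - (2β/N) H₀ + o(1/N), where H₀ is H without
the field term, so ρ_{N,L}(β) → exp(-βH₀) (`tendsto_trotterRho`). The field commutes with H₀ and
with the transfer matrices, and x has charge s(x). Hence A_{N,L} tends to the thermal average as N →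
∞ (`tendsto_trotterCorrelator`), and the field contributes only the twist and the factor exp(itα
s(x)).

Columns. The sum over all edge variables of a torus does not depend on the reading direction
(`trace_rowSum_eq_trace_colSum`). The two extra rows at ε = 0 are t_⊥(0) t̄_⊥(0) = 1. They put a
permutation matrix on the middle vertical space, which carries x from a horizontal line to that
space. So A_{N,L} becomes exp(itα s(x)) tr{x_mid t(0)^m Y(0) t(0)^{L-m-1}} / tr{t(0)^L}
(`trotterCorrelator_eq`). As L → ∞ only the projection onto the dominant eigenvector survives.

Inverse problem. To replace x_mid by X(ε), one writes X(ε) t(ε)⁻¹ = V x_mid V⁻¹, where V is a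
product of R-matrices linking the middle space to all spaces below it. By the Yang-Baxter equation,
t(-t_R/N) strips from V the factor at a space where R is a permutation, and t(t_R/N)⁻¹ strips the
next one, where the partially transposed R is a multiple of a rank-one projection. With D =
t(t_R/N)⁻¹ t(-t_R/N) this yields D^{N/2} X(ε) t(ε)⁻¹ = x_mid D^{N/2} (`siteOp_mul_pow_eq`). Matrix
elements between joint eigenvectors and a resolution of the identity give the series
(`formFactorSeries_eq`).

Limits. At ε = 0 the matrix t(0|κ) is singular for d ≥ 2 and need not be diagonalizable, so the
series is formed at ε ≠ 0. Eigenvectors need not converge, but the dominant projection does: it is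
the adjugate of Λ - A divided by the derivative of the characteristic polynomial at Λ, and both are
continuous (`exists_tendsto_rankOne`). The assumed interchange of N → ∞ and L → ∞ then joins the two
evaluations. -/

/-- The product operator `⊗_j x_j`. -/
def productOp (x : S → Matrix (Fin d) (Fin d) ℂ) : Op d S :=
  Matrix.of fun σ τ => ∏ j, x j (σ j) (τ j)

theorem productOp_mul (x y : S → Matrix (Fin d) (Fin d) ℂ) :
    productOp (x * y) = productOp x * productOp y := by
  ext σ τ
  simp only [productOp, Matrix.of_apply, Matrix.mul_apply, Pi.mul_apply, ← Finset.prod_mul_distrib,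
    Fintype.prod_sum]

theorem productOp_one : productOp (1 : S → Matrix (Fin d) (Fin d) ℂ) = 1 := by
  ext σ τ
  simp only [productOp, Matrix.of_apply, Pi.one_apply, Matrix.one_apply, Finset.prod_ite_zero,
    Finset.prod_const_one, Finset.mem_univ, true_imp_iff, funext_iff]

/-- `productOp` as a homomorphism of monoids. -/
def productHom (d : ℕ) (S : Type) [Fintype S] [DecidableEq S] :
    (S → Matrix (Fin d) (Fin d) ℂ) →* Op d S where
  toFun := productOp
  map_one' := productOp_one
  map_mul' := productOp_mul

/-- With single-site operators as values of the homomorphism `productHom`, their products and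
commutation relations reduce to those of `Pi.mulSingle`. -/
theorem siteOp_eq_productOp (j : S) (x : Matrix (Fin d) (Fin d) ℂ) :
    siteOp j x = productOp (Pi.mulSingle j x) := by
  ext σ τ
  simp only [siteOp, productOp, Matrix.of_apply]
  rw [← Finset.mul_prod_erase _ _ (Finset.mem_univ j), Pi.mulSingle_eq_same]
  have : ∏ k ∈ Finset.univ.erase j, (Pi.mulSingle j x : S → Matrix (Fin d) (Fin d) ℂ) k (σ k) (τ k)
      = if ∀ k, k ≠ j → σ k = τ k then 1 else 0 := by
    rw [Finset.prod_congr rfl (g := fun k => if σ k = τ k then (1 : ℂ) else 0)]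
    · simp [Finset.prod_ite_zero]
    · intro k hk
      rw [Pi.mulSingle_eq_of_ne (Finset.ne_of_mem_erase hk), Matrix.one_apply]
  rw [this, mul_ite, mul_one, mul_zero]

theorem siteOp_mul (j : S) (x y : Matrix (Fin d) (Fin d) ℂ) :
    siteOp j (x * y) = siteOp j x * siteOp j y := by
  simp only [siteOp_eq_productOp, ← productOp_mul, Pi.mulSingle_mul]

theorem siteOp_one (j : S) : siteOp j (1 : Matrix (Fin d) (Fin d) ℂ) = 1 := by
  rw [siteOp_eq_productOp, Pi.mulSingle_one, productOp_one]

theorem siteOp_add (j : S) (x y : Matrix (Fin d) (Fin d) ℂ) :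
    siteOp j (x + y) = siteOp j x + siteOp j y := by
  ext σ τ; simp only [siteOp, Matrix.of_apply, Matrix.add_apply]; split_ifs <;> simp

theorem siteOp_smul (j : S) (c : ℂ) (x : Matrix (Fin d) (Fin d) ℂ) :
    siteOp j (c • x) = c • siteOp j x := by
  ext σ τ; simp only [siteOp, Matrix.of_apply, Matrix.smul_apply]; split_ifs <;> simp

theorem siteOp_commute {i j : S} (h : i ≠ j) (x y : Matrix (Fin d) (Fin d) ℂ) :
    Commute (siteOp i x) (siteOp j y) := by
  have := congrArg (productHom d S)
    (Pi.mulSingle_commute (f := fun _ : S => Matrix (Fin d) (Fin d) ℂ) h x y).eq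
  rw [map_mul, map_mul] at this
  rw [siteOp_eq_productOp, siteOp_eq_productOp]
  exact this

/-- `siteOp j` as a homomorphism of algebras. -/
def siteHom (d : ℕ) (j : S) : Matrix (Fin d) (Fin d) ℂ →ₐ[ℂ] Op d S :=
  AlgHom.ofLinearMap
    { toFun := siteOp j, map_add' := siteOp_add j, map_smul' := siteOp_smul j }
    (siteOp_one j) (siteOp_mul j)

theorem siteOp_sum {ι : Type*} (s : Finset ι) (j : S) (x : ι → Matrix (Fin d) (Fin d) ℂ) :
    siteOp j (∑ i ∈ s, x i) = ∑ i ∈ s, siteOp j (x i) :=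
  map_sum (siteHom d j) x s

theorem list_prod_mulSingle {M : Type*} [Monoid M] (x : S → M) (l : List S) (hl : l.Nodup) :
    (l.map fun j => (Pi.mulSingle j (x j) : S → M)).prod = fun k => if k ∈ l then x k else 1 := by
  induction l with
  | nil => ext k; simp
  | cons a l ih =>
    rw [List.nodup_cons] at hl
    ext k
    rw [List.map_cons, List.prod_cons, ih hl.2, Pi.mul_apply]
    by_cases h : k = a
    · subst h; simp [hl.1]
    · simp [h]

/-- This turns one term of a path sum into a product of local weights, whatever the order of the
sites. -/
theorem list_prod_siteOp (x : S → Matrix (Fin d) (Fin d) ℂ) (l : List S) (hl : l.Nodup)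
    (hm : ∀ j, j ∈ l) : (l.map fun j => siteOp j (x j)).prod = productOp x := by
  have h := congrArg (productHom d S) (list_prod_mulSingle x l hl)
  rw [map_list_prod, List.map_map] at h
  simp only [hm, if_true] at h
  refine Eq.trans (congrArg List.prod (List.map_congr_left fun j _ => ?_)) h
  exact siteOp_eq_productOp j (x j)

theorem pairOp_kronecker {i j : S} (h : i ≠ j) (A B : Matrix (Fin d) (Fin d) ℂ) :
    pairOp i j (A ⊗ₖ B) = siteOp i A * siteOp j B := by
  simp only [siteOp_eq_productOp, ← productOp_mul]
  ext σ τ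
  simp only [pairOp, productOp, Matrix.of_apply, Matrix.kroneckerMap_apply, Pi.mul_apply]
  rw [← Finset.mul_prod_erase _ _ (Finset.mem_univ i),
    ← Finset.mul_prod_erase _ _ (Finset.mem_erase.2 ⟨h.symm, Finset.mem_univ j⟩)]
  have : ∏ k ∈ (Finset.univ.erase i).erase j,
      ((Pi.mulSingle i A : S → Matrix (Fin d) (Fin d) ℂ) k *
        (Pi.mulSingle j B : S → Matrix (Fin d) (Fin d) ℂ) k) (σ k) (τ k)
      = if ∀ k, k ≠ i → k ≠ j → σ k = τ k then 1 else 0 := by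
    rw [Finset.prod_congr rfl (g := fun k => if σ k = τ k then (1 : ℂ) else 0)]
    · simp only [Finset.prod_ite_zero, Finset.prod_const_one]
      congr 1
      simp only [Finset.mem_erase, Finset.mem_univ, and_true, eq_iff_iff]
      exact forall_congr' fun k => by tauto
    · intro k hk
      simp only [Finset.mem_erase, Finset.mem_univ, and_true] at hk
      rw [Pi.mulSingle_eq_of_ne hk.2, Pi.mulSingle_eq_of_ne hk.1, mul_one, Matrix.one_apply]
  rw [this]
  simp [Pi.mulSingle_eq_of_ne h, Pi.mulSingle_eq_of_ne h.symm]

/-- `pairOp i j` as a linear map. -/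
def pairLin (d : ℕ) (i j : S) : TwoOp d →ₗ[ℂ] Op d S where
  toFun := pairOp i j
  map_add' A B := by
    ext σ τ; simp only [pairOp, Matrix.of_apply, Matrix.add_apply]; split_ifs <;> simp
  map_smul' c A := by
    ext σ τ; simp only [pairOp, Matrix.of_apply, Matrix.smul_apply, RingHom.id_apply]
    split_ifs <;> simp

theorem pairLin_apply (i j : S) (A : TwoOp d) : pairLin d i j A = pairOp i j A := rfl

theorem single_prod_eq_kronecker (p q : Fin d × Fin d) (c : ℂ) :
    (Matrix.single p q c : TwoOp d) =
      c • (Matrix.single p.1 q.1 (1 : ℂ) ⊗ₖ Matrix.single p.2 q.2 (1 : ℂ)) := by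
  ext a b
  simp only [Matrix.smul_apply, Matrix.kroneckerMap_apply, Matrix.single_apply, Prod.ext_iff]
  split_ifs <;> simp_all

/-- An equality of linear maps on two-site operators can be checked on product operators. -/
theorem twoOp_linearMap_ext {V : Type*} [AddCommGroup V] [Module ℂ V] {f g : TwoOp d →ₗ[ℂ] V}
    (h : ∀ A B : Matrix (Fin d) (Fin d) ℂ, f (A ⊗ₖ B) = g (A ⊗ₖ B)) : f = g := by
  ext A
  rw [Matrix.matrix_eq_sum_single A]
  simp only [map_sum]
  refine Finset.sum_congr rfl fun p _ => Finset.sum_congr rfl fun q _ => ?_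
  rw [single_prod_eq_kronecker, map_smul, map_smul, h]

/-- Both sides are bilinear in `A` and `B`, so Kronecker products suffice; there the claim is
commutation at distinct sites. -/
theorem pairOp_mul {i j : S} (h : i ≠ j) (A B : TwoOp d) :
    pairOp i j (A * B) = pairOp i j A * pairOp i j B := by
  have key : (LinearMap.mul ℂ (TwoOp d)).compr₂ (pairLin d i j) =
      (LinearMap.mul ℂ (Op d S)).compl₁₂ (pairLin d i j) (pairLin d i j) := by
    refine twoOp_linearMap_ext fun A B => twoOp_linearMap_ext fun A' B' => ?_
    simp only [LinearMap.compr₂_apply, LinearMap.compl₁₂_apply, LinearMap.mul_apply',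
      pairLin_apply, ← Matrix.mul_kronecker_mul, pairOp_kronecker h, siteOp_mul]
    rw [mul_assoc, mul_assoc, ← mul_assoc (siteOp i A'), (siteOp_commute h A' B).eq, mul_assoc]
  exact congrArg (fun f => f A B) key

/-- Two-site operators are sums of products of single-site operators. -/
theorem pairOp_eq_sum {i j : S} (h : i ≠ j) (A : TwoOp d) :
    pairOp i j A = ∑ p, ∑ q, A p q •
      (siteOp i (Matrix.single p.1 q.1 1) * siteOp j (Matrix.single p.2 q.2 1)) := by
  conv_lhs => rw [Matrix.matrix_eq_sum_single A]
  rw [← pairLin_apply]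
  simp only [map_sum]
  refine Finset.sum_congr rfl fun p _ => Finset.sum_congr rfl fun q _ => ?_
  rw [single_prod_eq_kronecker, map_smul, pairLin_apply, pairOp_kronecker h]

theorem pairOp_commute_siteOp {i j k : S} (hij : i ≠ j) (hi : k ≠ i) (hj : k ≠ j) (A : TwoOp d)
    (x : Matrix (Fin d) (Fin d) ℂ) : Commute (pairOp i j A) (siteOp k x) := by
  rw [pairOp_eq_sum hij]
  refine Commute.sum_left _ _ _ fun p _ => Commute.sum_left _ _ _ fun q _ => Commute.smul_left ?_ _
  exact (siteOp_commute hi.symm _ _).mul_left (siteOp_commute hj.symm _ _)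

end LocalOperators

/-! ### Traces of products along closed paths -/

section Paths

variable {ι : Type*} [Fintype ι] [DecidableEq ι]

/-- A matrix element of a product of matrices is a sum over paths. -/
theorem list_ofFn_prod_apply {R : Type*} [Semiring R] (L : ℕ) (A : Fin L → Matrix ι ι R) (a b : ι) :
    (List.ofFn A).prod a b = ∑ s : Fin (L + 1) → ι, if s 0 = a ∧ s (Fin.last L) = b then
      (List.ofFn fun j : Fin L => A j (s j.castSucc) (s j.succ)).prod else 0 := by
  induction L generalizing a with
  | zero =>
    rw [List.ofFn_zero, List.prod_nil, Matrix.one_apply,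
      ← (Equiv.funUnique (Fin 1) ι).symm.sum_comp]
    by_cases h : a = b
    · subst h; simp [Equiv.funUnique]
    · simp only [Equiv.funUnique_symm_apply, uniqueElim_const, List.ofFn_zero, List.prod_nil, h,
        if_false]
      symm
      refine Finset.sum_eq_zero fun x _ => if_neg ?_
      rintro ⟨rfl, rfl⟩; exact h rfl
  | succ L ih =>
    rw [List.ofFn_succ, List.prod_cons, Matrix.mul_apply,
      ← (Fin.consEquiv fun _ : Fin (L + 2) => ι).sum_comp, Fintype.sum_prod_type]
    simp only [ih, Finset.mul_sum]
    refine Eq.trans ?_ (Finset.sum_eq_single a ?_ ?_).symm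
    · rw [Finset.sum_comm]
      refine Finset.sum_congr rfl fun s _ => ?_
      rw [Finset.sum_eq_single (s 0)]
      · simp [Fin.consEquiv, List.ofFn_succ, ← Fin.succ_last, mul_ite, Fin.cons_zero, Fin.cons_succ]
      · intro c _ hc
        rw [if_neg (fun h => hc h.1.symm), mul_zero]
      · simp
    · intro c _ hc
      refine Finset.sum_eq_zero fun s _ => if_neg ?_
      simpa [Fin.consEquiv] using fun h => absurd h hc
    · simp

/-- The trace identifies the last vertex of a path with its first one. A closed path is therefore a
function on `Fin L`, with cyclic successor `j + 1`. -/
theorem trace_list_ofFn_prod {R : Type*} [Semiring R] (L : ℕ) [NeZero L]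
    (A : Fin L → Matrix ι ι R) :
    (List.ofFn A).prod.trace =
      ∑ s : Fin L → ι, (List.ofFn fun j : Fin L => A j (s j) (s (j + 1))).prod := by
  obtain ⟨L, rfl⟩ := Nat.exists_eq_succ_of_ne_zero (NeZero.ne L)
  simp only [Matrix.trace, Matrix.diag_apply, list_ofFn_prod_apply]
  rw [Finset.sum_comm, ← (Fin.snocEquiv fun _ : Fin (L + 2) => ι).sum_comp, Fintype.sum_prod_type,
    Finset.sum_comm]
  refine Finset.sum_congr rfl fun s _ => ?_
  rw [Finset.sum_eq_single (s 0)]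
  · rw [Finset.sum_eq_single (s 0)]
    · have h0 : (Fin.snocEquiv fun _ : Fin (L + 2) => ι) (s 0, s) 0 = s 0 := by
        simp only [Fin.snocEquiv, Equiv.coe_fn_mk]
        exact Fin.snoc_castSucc (α := fun _ => ι) _ _ 0
      have h1 : (Fin.snocEquiv fun _ : Fin (L + 2) => ι) (s 0, s) (Fin.last _) = s 0 := by
        simp [Fin.snocEquiv]
      rw [if_pos ⟨h0, h1⟩]
      congr 2
      ext1 j
      congr 1
      · simp [Fin.snocEquiv]
      · refine Fin.lastCases ?_ (fun j => ?_) j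
        · simp [Fin.snocEquiv, Fin.succ_last]
        · rw [Fin.succ_castSucc]
          simp only [Fin.snocEquiv, Equiv.coe_fn_mk, Fin.coeSucc_eq_succ]
          exact Fin.snoc_castSucc (α := fun _ => ι) _ _ _
    · intro c _ hc
      refine if_neg fun h => hc (h.1.symm.trans ?_)
      simp only [Fin.snocEquiv, Equiv.coe_fn_mk]
      exact Fin.snoc_castSucc (α := fun _ => ι) _ _ 0
    · simp
  · intro c _ hc
    refine Finset.sum_eq_zero fun e _ => if_neg fun h => hc ?_
    have h0 : (Fin.snocEquiv fun _ : Fin (L + 2) => ι) (c, s) 0 = s 0 := by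
      simp only [Fin.snocEquiv, Equiv.coe_fn_mk]
      exact Fin.snoc_castSucc (α := fun _ => ι) _ _ 0
    have h1 : (Fin.snocEquiv fun _ : Fin (L + 2) => ι) (c, s) (Fin.last _) = c := by
      simp [Fin.snocEquiv]
    rw [← h1, h.2, ← h.1, h0]
  · simp

theorem reverse_ofFn_eq {α : Type*} (L : ℕ) (A : Fin L → α) :
    (List.ofFn A).reverse = List.ofFn fun j => A j.rev := by
  rw [List.ofFn_eq_map, List.ofFn_eq_map, ← List.map_reverse, List.finRange_reverse, List.map_map]
  rfl

theorem trace_reverse_list_ofFn_prod {R : Type*} [Semiring R] (L : ℕ) [NeZero L]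
    (A : Fin L → Matrix ι ι R) :
    (List.ofFn A).reverse.prod.trace =
      ∑ s : Fin L → ι, (List.ofFn fun j : Fin L => A j (s (j + 1)) (s j)).reverse.prod := by
  obtain ⟨L, rfl⟩ := Nat.exists_eq_succ_of_ne_zero (NeZero.ne L)
  rw [reverse_ofFn_eq, trace_list_ofFn_prod]
  -- Reversing the edges of a closed path reverses its vertices only up to a shift by one, since the
  -- start of an edge becomes its end.
  let e : Fin (L + 1) ≃ Fin (L + 1) := Fin.revPerm.trans (Equiv.addRight 1)
  rw [← (e.symm.arrowCongr (Equiv.refl ι)).sum_comp]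
  refine Finset.sum_congr rfl fun s _ => ?_
  rw [reverse_ofFn_eq]
  congr 2
  ext1 j
  have h : (j + 1).rev + 1 = j.rev := by rw [← Fin.last_sub, ← Fin.last_sub]; abel
  simp [e, h]

end Paths

/-! ### Local exchange relations -/

section LocalRelations

variable {d : ℕ}

/-- The relation `A₁₂ B₁₃ C₂₃ = C₂₃ B₁₃ A₁₂` in components. -/
def YangBaxterRel (A B C : TwoOp d) : Prop :=
  ∀ a p q c p₂ q₂ : Fin d,
    ∑ b, ∑ p₁, ∑ q₁, A (a, p) (b, p₁) * B (b, q) (c, q₁) * C (p₁, q₁) (p₂, q₂) =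
      ∑ b, ∑ p₁, ∑ q₁, C (p, q) (p₁, q₁) * B (a, q₁) (b, q₂) * A (b, p₁) (c, p₂)

/-- Configurations of three sites. -/
def finThreeEquiv (α : Type*) : α × α × α ≃ (Fin 3 → α) where
  toFun x := ![x.1, x.2.1, x.2.2]
  invFun f := (f 0, f 1, f 2)
  left_inv x := rfl
  right_inv f := by ext i; fin_cases i <;> rfl

theorem finThreeEquiv_apply {α : Type*} (a b c : α) : finThreeEquiv α (a, b, c) = ![a, b, c] := rfl

theorem sum_rotate {α : Type*} [Fintype α] {β : Type*} [AddCommMonoid β] (f : α → α → α → β) :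
    ∑ x, ∑ y, ∑ z, f x y z = ∑ z, ∑ x, ∑ y, f x y z := by
  rw [Finset.sum_comm (f := fun z x => ∑ y, f x y z)]
  exact Finset.sum_congr rfl fun x _ => Finset.sum_comm

theorem yangBaxterRel_of_pairOp {A B C : TwoOp d}
    (h : pairOp (S := Fin 3) 0 1 A * pairOp 0 2 B * pairOp 1 2 C =
      pairOp 1 2 C * pairOp 0 2 B * pairOp 0 1 A) : YangBaxterRel A B C := by
  intro a p q c p₂ q₂
  have h' := congrFun (congrFun h ![a, p, q]) ![c, p₂, q₂]
  simp only [Matrix.mul_apply, pairOp, Matrix.of_apply, ← (finThreeEquiv (Fin d)).sum_comp,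
    Fintype.sum_prod_type] at h'
  simp [finThreeEquiv_apply, Fin.forall_fin_succ, Finset.sum_mul] at h'
  rw [sum_rotate] at h'
  exact h'

/-- Transposition of the third space, followed by an interchange of the spaces. -/
theorem YangBaxterRel.dual {A B C : TwoOp d} (h : YangBaxterRel A B C) :
    YangBaxterRel C (Matrix.of fun p q => A (q.2, p.1) (p.2, q.1))
      (Matrix.of fun p q => B (q.2, p.1) (p.2, q.1)) := by
  intro a p q c p₂ q₂
  simp only [Matrix.of_apply]
  -- The first space of `h` becomes the third one with its row and column indices exchanged; the
  -- second and third spaces become the first and second.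
  have h' := h q₂ a p q c p₂
  rw [sum_rotate, sum_rotate (fun b p₁ q₁ => B (q₁, p) (q, p₁) * _ * _)]
  refine Eq.trans ?_ (h'.symm.trans ?_) <;>
    exact Finset.sum_congr rfl fun _ _ => Finset.sum_congr rfl fun _ _ =>
      Finset.sum_congr rfl fun _ _ => by ring

end LocalRelations

/-! ### Operators on an auxiliary space and the sites; three-space identities. -/

section Aux

variable {d : ℕ} {S : Type} [Fintype S] [DecidableEq S]

/-- Operators that act trivially on the auxiliary space. -/
abbrev auxScalar (d : ℕ) {S : Type} [Fintype S] [DecidableEq S] : Op d S →+* AuxOp d S :=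
  Matrix.scalar (Fin d)

theorem trace_auxScalar_mul (A : Op d S) (B : AuxOp d S) :
    Matrix.trace (auxScalar d A * B) = A * Matrix.trace B := by
  simp [Matrix.trace, Finset.mul_sum, Matrix.scalar_apply, Matrix.diagonal_mul]

theorem trace_mul_auxScalar (A : Op d S) (B : AuxOp d S) :
    Matrix.trace (B * auxScalar d A) = Matrix.trace B * A := by
  simp [Matrix.trace, Finset.sum_mul, Matrix.scalar_apply, Matrix.mul_diagonal]

theorem commute_auxScalar {A : Op d S} {B : AuxOp d S} (h : ∀ a b, Commute A (B a b)) :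
    Commute (auxScalar d A) B := by
  rw [commute_iff_eq]
  ext1 a b
  rw [Matrix.scalar_apply, Matrix.diagonal_mul, Matrix.mul_diagonal, (h a b).eq]

theorem commute_auxScalar_auxSite {A : Op d S} {k : S} (h : ∀ x, Commute A (siteOp k x))
    (B : TwoOp d) : Commute (auxScalar d A) (auxSite B k) :=
  commute_auxScalar fun _ _ => h _

theorem commute_auxScalar_auxOnly (A : Op d S) (x : Matrix (Fin d) (Fin d) ℂ) :
    Commute (auxScalar d A) (auxOnly S x) := by
  refine commute_auxScalar fun a b => ?_
  rw [auxOnly, Matrix.of_apply]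
  exact Commute.smul_right (Commute.one_right A) (x a b)

theorem commute_trace {A : Op d S} {B : AuxOp d S} (h : Commute (auxScalar d A) B) :
    Commute A (Matrix.trace B) := by
  have := congrArg Matrix.trace h.eq
  rwa [trace_auxScalar_mul, trace_mul_auxScalar] at this

/-- Cyclicity fails for general matrices over the noncommutative ring `Op d S`; it holds here
because the entries of `auxOnly` are scalars. -/
theorem trace_auxOnly_mul_comm (x : Matrix (Fin d) (Fin d) ℂ) (B : AuxOp d S) :
    Matrix.trace (auxOnly S x * B) = Matrix.trace (B * auxOnly S x) := by
  simp only [Matrix.trace, Matrix.diag_apply, Matrix.mul_apply, auxOnly, Matrix.of_apply]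
  rw [Finset.sum_comm]
  simp

theorem auxOnly_mul (x y : Matrix (Fin d) (Fin d) ℂ) :
    auxOnly S (x * y) = auxOnly S x * auxOnly S y := by
  ext1 a b
  simp [auxOnly, Matrix.mul_apply, Finset.sum_smul, smul_smul, mul_comm]

theorem auxOnly_one : auxOnly S (1 : Matrix (Fin d) (Fin d) ℂ) = 1 := by
  ext1 a b
  by_cases h : a = b <;> simp [auxOnly, Matrix.one_apply, h]

/-- The block `A_{ab}` of a two-site operator. -/
def block (A : TwoOp d) (a b : Fin d) : Matrix (Fin d) (Fin d) ℂ :=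
  Matrix.of fun p q => A (a, p) (b, q)

theorem auxSite_apply (A : TwoOp d) (k : S) (a b : Fin d) :
    auxSite A k a b = siteOp k (block A a b) := rfl

/-- With the auxiliary indices fixed, a product over two sites is a single two-site operator, so
identities on three spaces can be checked in `TwoOp d`. -/
theorem auxSite_mul_auxSite_apply {j k : S} (h : j ≠ k) (A B : TwoOp d) (a c : Fin d) :
    (auxSite A j * auxSite B k) a c = pairOp j k (∑ b, block A a b ⊗ₖ block B b c) := by
  simp only [Matrix.mul_apply, auxSite_apply, ← pairLin_apply, map_sum]
  simp only [pairLin_apply, pairOp_kronecker h]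

theorem siteOp_eq_pairOp_right {j k : S} (h : j ≠ k) (x : Matrix (Fin d) (Fin d) ℂ) :
    siteOp k x = pairOp j k (1 ⊗ₖ x) := by
  rw [pairOp_kronecker h, siteOp_one, one_mul]

theorem siteOp_eq_pairOp_left {j k : S} (h : j ≠ k) (x : Matrix (Fin d) (Fin d) ℂ) :
    siteOp j x = pairOp j k (x ⊗ₖ 1) := by
  rw [pairOp_kronecker h, siteOp_one, mul_one]

theorem auxSite_mul_auxSite_apply' {j k : S} (h : j ≠ k) (A B : TwoOp d) (a c : Fin d) :
    (auxSite B k * auxSite A j) a c = pairOp j k (∑ b, block A b c ⊗ₖ block B a b) := by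
  simp only [Matrix.mul_apply, auxSite_apply, ← pairLin_apply, map_sum]
  simp only [pairLin_apply, pairOp_kronecker h]
  exact Finset.sum_congr rfl fun b _ => siteOp_commute h.symm _ _

/-- The local exchange relation. -/
theorem auxSite_exchange {j k : S} (h : j ≠ k) {A B C : TwoOp d} (hY : YangBaxterRel A B C) :
    auxSite A j * auxSite B k * auxScalar d (pairOp j k C) =
      auxScalar d (pairOp j k C) * (auxSite B k * auxSite A j) := by
  ext1 a c
  rw [Matrix.scalar_apply, Matrix.mul_diagonal, Matrix.diagonal_mul, auxSite_mul_auxSite_apply h,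
    auxSite_mul_auxSite_apply' h, ← pairOp_mul h, ← pairOp_mul h]
  congr 1
  ext ⟨p, q⟩ ⟨p₂, q₂⟩
  have := hY a p q c p₂ q₂
  simp only [Matrix.mul_apply, Matrix.sum_apply, Fintype.sum_prod_type, Matrix.kroneckerMap_apply,
    block, Matrix.of_apply, Finset.sum_mul, Finset.mul_sum]
  rw [sum_rotate, sum_rotate (fun x x_1 x_2 => C (p, q) (x, x_1) * _), this]
  exact Finset.sum_congr rfl fun _ _ => Finset.sum_congr rfl fun _ _ =>
    Finset.sum_congr rfl fun _ _ => by ring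

theorem block_permOp (a b : Fin d) : block (permOp d) a b = Matrix.single b a 1 := by
  ext p q
  simp [block, permOp, Matrix.single_apply, and_comm, eq_comm]

/-- The permutation operator moves an operator from the auxiliary space to the site. -/
theorem auxSite_permOp_mul_auxSite {j k : S} (h : j ≠ k) (C : TwoOp d) :
    auxSite (permOp d) j * auxSite C k = auxScalar d (pairOp j k C) * auxSite (permOp d) j := by
  ext1 a c
  rw [Matrix.scalar_apply, Matrix.diagonal_mul, auxSite_mul_auxSite_apply h, auxSite_apply,
    siteOp_eq_pairOp_left h, ← pairOp_mul h]
  congr 1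
  ext ⟨p, q⟩ ⟨p₂, q₂⟩
  simp only [Matrix.mul_apply, Matrix.sum_apply, Fintype.sum_prod_type, Matrix.kroneckerMap_apply,
    Matrix.one_apply, block, Matrix.of_apply, permOp]
  by_cases h2 : a = p₂
  · subst h2; simp
  · simp [h2]

theorem auxSite_permOp_mul_auxOnly (j : S) (x : Matrix (Fin d) (Fin d) ℂ) :
    auxSite (permOp d) j * auxOnly S x = auxScalar d (siteOp j x) * auxSite (permOp d) j := by
  ext1 a c
  rw [Matrix.scalar_apply, Matrix.diagonal_mul, Matrix.mul_apply, auxSite_apply, ← siteOp_mul]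
  simp only [auxSite_apply, auxOnly, Matrix.of_apply, mul_smul_comm, mul_one, ← siteOp_smul,
    ← siteOp_sum]
  congr 1
  ext p q
  by_cases h : a = q <;>
    simp [block_permOp, Matrix.sum_apply, Matrix.mul_apply, Matrix.single_apply, h]

/-- Unitarity, in the form in which it removes a factor from the monodromy matrix. -/
theorem auxSite_mul_auxSite_permOp_mul {j i : S} (h : j ≠ i) {A C : TwoOp d}
    (hU : A * (permOp d * C * permOp d) = 1) :
    auxSite A j * auxSite (permOp d) i * auxScalar d (pairOp j i C) = auxSite (permOp d) i := by
  ext1 a c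
  rw [Matrix.scalar_apply, Matrix.mul_diagonal, auxSite_mul_auxSite_apply h, auxSite_apply,
    siteOp_eq_pairOp_right h, ← pairOp_mul h]
  congr 1
  ext ⟨p, q⟩ ⟨p₂, q₂⟩
  have h1 := congrFun (congrFun hU (a, p)) (q₂, p₂)
  simp only [Matrix.mul_apply, Matrix.sum_apply, Fintype.sum_prod_type, Matrix.kroneckerMap_apply,
    Matrix.one_apply, block, Matrix.of_apply, permOp, ite_and, Prod.mk.injEq] at h1 ⊢
  simp at h1 ⊢
  rw [Finset.sum_comm, h1]
  split_ifs <;> rfl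

/-- A rank-one factor moves an operator from the auxiliary space to the site, transposing it. -/
theorem auxSite_mul_auxSite_singlet {j i : S} (h : j ≠ i) (A : TwoOp d) :
    auxSite A j * auxSite (Matrix.of fun p q => permOp d (q.2, p.1) (p.2, q.1)) i =
      auxScalar d (pairOp j i (Matrix.of fun p q => A (q.2, p.1) (p.2, q.1))) *
        auxSite (Matrix.of fun p q => permOp d (q.2, p.1) (p.2, q.1)) i := by
  ext1 a c
  rw [Matrix.scalar_apply, Matrix.diagonal_mul, auxSite_mul_auxSite_apply h, auxSite_apply,
    siteOp_eq_pairOp_right h, ← pairOp_mul h]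
  congr 1
  ext ⟨p, q⟩ ⟨p₂, q₂⟩
  simp only [Matrix.mul_apply, Matrix.sum_apply, Fintype.sum_prod_type, Matrix.kroneckerMap_apply,
    Matrix.one_apply, block, Matrix.of_apply, permOp]
  by_cases h2 : q₂ = c
  · subst h2; simp
  · simp [h2]

end Aux

/-! ### Exchange relations for monodromy matrices -/

section Exchange

variable {d : ℕ} {S : Type} [Fintype S] [DecidableEq S]

/-- The ordered product of the factors `(B_k)_{ak}` over a list of sites. -/
def colProd (B : S → TwoOp d) (l : List S) : AuxOp d S := (l.map fun k => auxSite (B k) k).prod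

/-- The ordered product of the two-site operators `(C_k)_{jk}` over a list of sites. -/
def legProd (C : S → TwoOp d) (j : S) (l : List S) : Op d S :=
  (l.map fun k => pairOp j k (C k)).prod

theorem colProd_nil (B : S → TwoOp d) : colProd B [] = 1 := rfl

theorem colProd_cons (B : S → TwoOp d) (k : S) (l : List S) :
    colProd B (k :: l) = auxSite (B k) k * colProd B l := by simp [colProd]

theorem colProd_append (B : S → TwoOp d) (l l' : List S) :
    colProd B (l ++ l') = colProd B l * colProd B l' := by simp [colProd]

theorem legProd_nil (C : S → TwoOp d) (j : S) : legProd C j [] = 1 := rfl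

theorem legProd_cons (C : S → TwoOp d) (j k : S) (l : List S) :
    legProd C j (k :: l) = pairOp j k (C k) * legProd C j l := by simp [legProd]

theorem legProd_append (C : S → TwoOp d) (j : S) (l l' : List S) :
    legProd C j (l ++ l') = legProd C j l * legProd C j l' := by simp [legProd]

theorem commute_auxScalar_colProd {A : Op d S} (B : S → TwoOp d) {l : List S}
    (h : ∀ k ∈ l, ∀ x, Commute A (siteOp k x)) : Commute (auxScalar d A) (colProd B l) := by
  refine Commute.list_prod_right _ _ fun M hM => ?_
  obtain ⟨k, hk, rfl⟩ := List.mem_map.1 hM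
  exact commute_auxScalar_auxSite (h k hk) _

theorem commute_legProd_siteOp (C : S → TwoOp d) {j k : S} {l : List S} (hj : j ∉ l) (hk : k ∉ l)
    (hjk : k ≠ j) (x : Matrix (Fin d) (Fin d) ℂ) : Commute (legProd C j l) (siteOp k x) := by
  refine Commute.list_prod_left _ _ fun M hM => ?_
  obtain ⟨k', hk', rfl⟩ := List.mem_map.1 hM
  exact pairOp_commute_siteOp (ne_of_mem_of_not_mem hk' hj).symm hjk
    (ne_of_mem_of_not_mem hk' hk).symm _ _

/-- `A` is pulled through the product one factor at a time. The operators left behind on `j` and `k`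
commute with all factors at other sites, so they can be collected. -/
theorem colProd_exchange {A : TwoOp d} {B C : S → TwoOp d} {j : S} {l : List S} (hl : l.Nodup)
    (hj : j ∉ l) (hY : ∀ k ∈ l, YangBaxterRel A (B k) (C k)) :
    auxSite A j * colProd B l * auxScalar d (legProd C j l) =
      auxScalar d (legProd C j l) * (colProd B l * auxSite A j) := by
  induction l with
  | nil => simp [colProd_nil, legProd_nil]
  | cons k l ih =>
    rw [List.nodup_cons] at hl
    rw [List.mem_cons, not_or] at hj
    have ih := ih hl.2 hj.2 fun k' hk' => hY k' (List.mem_cons_of_mem _ hk')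
    have h1 := auxSite_exchange hj.1 (hY k List.mem_cons_self)
    have h2 : Commute (auxScalar d (pairOp j k (C k))) (colProd B l) :=
      commute_auxScalar_colProd B fun k' hk' x => pairOp_commute_siteOp hj.1
        (fun h => hj.2 (h ▸ hk')) (fun h => hl.1 (h ▸ hk')) _ _
    have h3 : Commute (auxScalar d (legProd C j l)) (auxSite (B k) k) :=
      commute_auxScalar_auxSite (fun x => commute_legProd_siteOp C hj.2 hl.1 (Ne.symm hj.1) x) _
    rw [colProd_cons, legProd_cons, map_mul]
    set W := auxScalar d (pairOp j k (C k))
    set V := auxScalar d (legProd C j l)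
    set F := auxSite (B k) k
    set T := colProd B l
    set X := auxSite A j
    calc X * (F * T) * (W * V) = X * F * (T * W) * V := by simp only [mul_assoc]
      _ = X * F * W * (T * V) := by rw [← h2.eq]; simp only [mul_assoc]
      _ = W * F * (X * T * V) := by rw [h1]; simp only [mul_assoc]
      _ = W * (F * V) * (T * X) := by rw [ih]; simp only [mul_assoc]
      _ = W * V * (F * T * X) := by rw [← h3.eq]; simp only [mul_assoc]

variable {B C : S → TwoOp d} {i j : S} {r t b : List S}

/-- The operator on the sites that is obtained from an ordered product and a twist. -/
def twistTrace (z : Matrix (Fin d) (Fin d) ℂ) (B : S → TwoOp d) (l : List S) : Op d S :=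
  Matrix.trace (auxOnly S z * colProd B l)

theorem twistTrace_commute_siteOp (z : Matrix (Fin d) (Fin d) ℂ) {l : List S} {j : S} (hj : j ∉ l)
    (x : Matrix (Fin d) (Fin d) ℂ) : Commute (twistTrace z B l) (siteOp j x) := by
  refine (commute_trace ?_).symm
  exact (commute_auxScalar_auxOnly _ _).mul_right (commute_auxScalar_colProd B fun k hk y =>
    siteOp_commute (ne_of_mem_of_not_mem hk hj).symm _ _)

theorem nodup_split {α : Type*} {i j : α} {r t b : List α}
    (hnd : (r ++ j :: (t ++ i :: b)).Nodup) :
    (∀ k ∈ r, k ≠ j ∧ k ∉ t ∧ k ≠ i) ∧ (∀ k ∈ b, k ≠ j ∧ k ∉ t ∧ k ≠ i) ∧ t.Nodup ∧ j ∉ t ∧ i ∉ t ∧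
      j ≠ i := by
  simp only [List.nodup_append, List.nodup_cons, List.mem_append, List.mem_cons, not_or] at hnd
  obtain ⟨-, ⟨⟨h1, h2, h3⟩, h4, ⟨h5, -⟩, h6⟩, h7⟩ := hnd
  refine ⟨fun k hk => ⟨h7 k hk j (Or.inl rfl), fun h => h7 k hk k (Or.inr (Or.inl h)) rfl,
    h7 k hk i (Or.inr (Or.inr (Or.inl rfl)))⟩, fun k hk => ⟨ne_of_mem_of_not_mem hk h3,
    fun h => h6 k h k (Or.inr hk) rfl, ne_of_mem_of_not_mem hk h5⟩, h4, h1,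
    fun h => h6 i h i (Or.inl rfl) rfl, h2⟩

theorem commute_legProd_auxOnly_mul_colProd (z : Matrix (Fin d) (Fin d) ℂ) (hjt : j ∉ t)
    (hr : ∀ k ∈ r, k ≠ j ∧ k ∉ t) :
    Commute (auxScalar d (legProd C j t)) (auxOnly S z * colProd B r) :=
  (commute_auxScalar_auxOnly _ _).mul_right (commute_auxScalar_colProd B fun k hk x =>
    commute_legProd_siteOp C hjt (hr k hk).2 (hr k hk).1 x)

theorem commute_legProd_colProd (hjt : j ∉ t) (hr : ∀ k ∈ r, k ≠ j ∧ k ∉ t) :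
    Commute (auxScalar d (legProd C j t)) (colProd B r) :=
  commute_auxScalar_colProd B fun k hk x =>
    commute_legProd_siteOp C hjt (hr k hk).2 (hr k hk).1 x

/-- The word computation behind the removal of a site: `Z` is the twist, `R`, `T`, `Q` are the
products before, between and after the sites j and i, `X` and `P` the factors at j and i, `V` the
legs from j over `T`, and `W` the leg from j to i. By `h5`, unitarity absorbs `X` into `P`. -/
theorem exchange_regular {G : Type*} [Monoid G] {Z R X T P Q V W : G}
    (h1 : V * (Z * R) = Z * R * V) (h2 : V * (P * Q) = P * Q * V) (h3 : W * Q = Q * W)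
    (h4 : X * T * V = V * (T * X)) (h5 : X * P * W = P) :
    Z * (R * (X * (T * (P * Q)))) * (V * W) = V * (Z * (R * (T * (P * Q)))) := by
  calc Z * (R * (X * (T * (P * Q)))) * (V * W) = Z * R * X * T * ((P * Q) * V) * W := by
        simp only [mul_assoc]
    _ = Z * R * (X * T * V) * P * (Q * W) := by rw [← h2]; simp only [mul_assoc]
    _ = (Z * R * V) * T * (X * P * W) * Q := by rw [h4, ← h3]; simp only [mul_assoc]
    _ = V * (Z * (R * (T * (P * Q)))) := by rw [← h1, h5]; simp only [mul_assoc]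

/-- Same letters as in `exchange_regular`. By `h5` the factor `X` now turns into the leg `W`, which
must travel to the left end of the word. -/
theorem exchange_singlet {G : Type*} [Monoid G] {Z R X T P Q V W : G}
    (h1 : V * (Z * R) = Z * R * V) (h2 : V * (P * Q) = P * Q * V) (h3 : W * T = T * W)
    (h3' : W * (Z * R) = Z * R * W) (h4 : X * T * V = V * (T * X)) (h5 : X * P = W * P) :
    Z * (R * (X * (T * (P * Q)))) * V = V * W * (Z * (R * (T * (P * Q)))) := by
  calc Z * (R * (X * (T * (P * Q)))) * V = Z * R * X * T * ((P * Q) * V) := by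
        simp only [mul_assoc]
    _ = Z * R * (X * T * V) * P * Q := by rw [← h2]; simp only [mul_assoc]
    _ = (Z * R * V) * T * (X * P) * Q := by rw [h4]; simp only [mul_assoc]
    _ = V * (Z * R) * (T * W) * P * Q := by rw [← h1, h5]; simp only [mul_assoc]
    _ = V * (Z * R * W) * T * P * Q := by rw [← h3]; simp only [mul_assoc]
    _ = V * W * (Z * (R * (T * (P * Q)))) := by rw [← h3']; simp only [mul_assoc]

/-- At a regular point, the transfer matrix removes a site from the ordered product. -/
theorem twistTrace_mul_legProd_of_regular (z : Matrix (Fin d) (Fin d) ℂ)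
    (hnd : (r ++ j :: (t ++ i :: b)).Nodup) (hY : ∀ k ∈ t, YangBaxterRel (B j) (B k) (C k))
    (hi : B i = permOp d) (hU : B j * (permOp d * C i * permOp d) = 1) :
    twistTrace z B (r ++ j :: (t ++ i :: b)) * legProd C j (t ++ [i]) =
      legProd C j t * twistTrace z B (r ++ (t ++ i :: b)) := by
  obtain ⟨hr, hb, ht, hjt, hit, hji⟩ := nodup_split hnd
  have h1 := commute_legProd_auxOnly_mul_colProd (B := B) (C := C) z hjt fun k hk =>
    ⟨(hr k hk).1, (hr k hk).2.1⟩
  have h2 : Commute (auxScalar d (legProd C j t)) (colProd B (i :: b)) := by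
    refine commute_legProd_colProd hjt fun k hk => ?_
    rcases List.mem_cons.1 hk with rfl | hk
    exacts [⟨hji.symm, hit⟩, ⟨(hb k hk).1, (hb k hk).2.1⟩]
  have h3 : Commute (auxScalar d (legProd C j [i])) (colProd B b) :=
    commute_legProd_colProd (by simpa using hji) fun k hk =>
      ⟨(hb k hk).1, by simpa using (hb k hk).2.2⟩
  have h4 := colProd_exchange ht hjt hY
  have h5 := auxSite_mul_auxSite_permOp_mul hji hU
  -- The legs act on sites only, so they may be taken inside the auxiliary trace, where the word
  -- identity applies.
  rw [twistTrace, twistTrace, ← trace_mul_auxScalar, ← trace_auxScalar_mul]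
  refine congrArg Matrix.trace ?_
  rw [legProd_append, map_mul]
  simp only [colProd_append, colProd_cons, legProd_cons, legProd_nil, mul_one, hi] at h2 h3 ⊢
  exact exchange_regular h1.eq h2.eq h3.eq h4 h5

/-- At a singular point, the transfer matrix inserts a site into the ordered product. -/
theorem twistTrace_mul_legProd_of_singlet (z : Matrix (Fin d) (Fin d) ℂ)
    (hnd : (r ++ j :: (t ++ i :: b)).Nodup) (hY : ∀ k ∈ t, YangBaxterRel (B j) (B k) (C k))
    (hi : B i = Matrix.of fun p q => permOp d (q.2, p.1) (p.2, q.1))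
    (hC : C i = Matrix.of fun p q => B j (q.2, p.1) (p.2, q.1)) :
    twistTrace z B (r ++ j :: (t ++ i :: b)) * legProd C j t =
      legProd C j (t ++ [i]) * twistTrace z B (r ++ (t ++ i :: b)) := by
  obtain ⟨hr, hb, ht, hjt, hit, hji⟩ := nodup_split hnd
  have h1 := commute_legProd_auxOnly_mul_colProd (B := B) (C := C) z hjt fun k hk =>
    ⟨(hr k hk).1, (hr k hk).2.1⟩
  have h2 : Commute (auxScalar d (legProd C j t)) (colProd B (i :: b)) := by
    refine commute_legProd_colProd hjt fun k hk => ?_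
    rcases List.mem_cons.1 hk with rfl | hk
    exacts [⟨hji.symm, hit⟩, ⟨(hb k hk).1, (hb k hk).2.1⟩]
  have h3 : Commute (auxScalar d (legProd C j [i])) (colProd B t) :=
    commute_legProd_colProd (by simpa using hji) fun k hk =>
      ⟨ne_of_mem_of_not_mem hk hjt, by simpa using ne_of_mem_of_not_mem hk hit⟩
  have h3' := commute_legProd_auxOnly_mul_colProd (B := B) (C := C) (t := [i]) z
    (by simpa using hji) fun k hk => ⟨(hr k hk).1, by simpa using (hr k hk).2.2⟩
  have h4 := colProd_exchange ht hjt hY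
  have h5 := auxSite_mul_auxSite_singlet hji (B j)
  rw [twistTrace, twistTrace, ← trace_mul_auxScalar, ← trace_auxScalar_mul]
  refine congrArg Matrix.trace ?_
  rw [legProd_append, map_mul]
  simp only [colProd_append, colProd_cons, legProd_cons, legProd_nil, mul_one] at h2 h3 h3' ⊢
  rw [← hi, ← hC] at h5
  exact exchange_singlet h1.eq h2.eq h3.eq h3'.eq h4 h5

/-- The permutation replaces the auxiliary space by the site `j` in everything to its right, which
leaves an operator on the sites alone. -/
theorem auxSite_permOp_mul_colProd (hj : j ∉ t) :
    auxSite (permOp d) j * colProd B t =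
      auxScalar d (legProd B j t) * auxSite (permOp d) j := by
  induction t with
  | nil => simp [colProd_nil, legProd_nil]
  | cons k t ih =>
    rw [List.mem_cons, not_or] at hj
    rw [colProd_cons, legProd_cons, ← mul_assoc, auxSite_permOp_mul_auxSite hj.1, mul_assoc,
      ih hj.2, map_mul, mul_assoc]

/-- At the inhomogeneity of the site `j`, the transfer matrix is an ordered product, and insertion
of an operator in the auxiliary space amounts to insertion of this operator at `j`. -/
theorem twistTrace_of_regular (x z : Matrix (Fin d) (Fin d) ℂ) (hnd : (r ++ j :: t).Nodup)
    (hj : B j = permOp d) :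
    twistTrace (x * z) B (r ++ j :: t) =
      legProd B j t * siteOp j x * twistTrace z B (r ++ [j]) := by
  simp only [List.nodup_append, List.nodup_cons, List.mem_cons] at hnd
  obtain ⟨-, ⟨hjt, -⟩, hr⟩ := hnd
  have h1 := commute_legProd_auxOnly_mul_colProd (B := B) (C := B) (x * z) hjt fun k hk =>
    ⟨hr k hk j (Or.inl rfl), fun h => hr k hk k (Or.inr h) rfl⟩
  have h2 : Commute (auxScalar d (siteOp j x)) (auxOnly S z * colProd B r) :=
    (commute_auxScalar_auxOnly _ _).mul_right (commute_auxScalar_colProd B fun k hk y =>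
      siteOp_commute (hr k hk j (Or.inl rfl)).symm _ _)
  have h3 := auxSite_permOp_mul_colProd (B := B) hjt
  have h4 := auxSite_permOp_mul_auxOnly j x
  -- The factors over `t` leave the trace as legs of `j`. Then `x` goes round the trace and meets
  -- the permutation from the right, which turns it into an operator at `j` (`h6`).
  have h5 : auxOnly S (x * z) * (colProd B r * (auxSite (permOp d) j * colProd B t)) =
      auxScalar d (legProd B j t) * (auxOnly S x * (auxOnly S z * colProd B r *
        auxSite (permOp d) j)) := by
    rw [h3, ← mul_assoc, ← mul_assoc, ← h1.eq, auxOnly_mul]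
    simp only [mul_assoc]
  have h6 : auxOnly S z * colProd B r * auxSite (permOp d) j * auxOnly S x =
      auxScalar d (siteOp j x) * (auxOnly S z * (colProd B r * auxSite (permOp d) j)) := by
    rw [mul_assoc, h4, ← mul_assoc, ← h2.eq]
    simp only [mul_assoc]
  rw [twistTrace, colProd_append, colProd_cons, hj, h5, trace_auxScalar_mul,
    trace_auxOnly_mul_comm, h6, trace_auxScalar_mul, twistTrace, colProd_append, colProd_cons,
    colProd_nil, hj, mul_one, mul_assoc]

end Exchange

/-! ### The inverse problem -/

section Inverse

/-- Since `t = U Z V⁻¹`, the operator `x` only has to pass `Z`. No invertibility of `t` or `Z` is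
involved. -/
theorem conj_exchange {G : Type*} [Monoid G] {t x Z : G} (U V : Gˣ) (h : t * V = U * Z)
    (hZ : Commute Z x) : t * (V * x * ↑V⁻¹) = U * x * ↑U⁻¹ * t := by
  have h1 : t = U * Z * ↑V⁻¹ := by rw [← h]; simp
  rw [h1]
  simp only [mul_assoc, Units.inv_mul_cancel_left]
  rw [← mul_assoc Z, ← mul_assoc x, hZ.eq]

variable {d : ℕ} {S : Type} [Fintype S] [DecidableEq S]

theorem isUnit_of_mul_left {A B : Op d S} (h : IsUnit (A * B)) : IsUnit A := by
  rw [Matrix.isUnit_iff_isUnit_det, Matrix.det_mul] at h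
  rw [Matrix.isUnit_iff_isUnit_det]
  exact isUnit_of_mul_isUnit_left h

/-- The list of the sites in a list of pairs of sites. -/
def pairSites {α : Type*} (ps : List (α × α)) : List α := ps.flatMap fun p => [p.1, p.2]

theorem pairSites_append {α : Type*} (ps qs : List (α × α)) :
    pairSites (ps ++ qs) = pairSites ps ++ pairSites qs := by simp [pairSites]

variable {B₀ B₁ B₂ : S → TwoOp d} {j : S} {r : List S} {ps : List (S × S)}

/-- The inverse problem in abstract form. `B₀`, `B₁`, `B₂` are the weights at three spectral
parameters. At that of `B₀`, the entry operator divided by the transfer matrix is `siteOp j x`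
conjugated by the legs from `j` to all sites of `ps`. Each factor `t₂⁻¹ t₁` moved through shortens
these legs by one pair, so that after `ps.length` factors the conjugation is gone. -/
theorem siteOp_mul_pow_eq (x z : Matrix (Fin d) (Fin d) ℂ)
    (hnd : (r ++ j :: pairSites ps).Nodup)
    (hY₁ : ∀ k ∈ pairSites ps, YangBaxterRel (B₁ j) (B₁ k) (B₀ k))
    (hY₂ : ∀ k ∈ pairSites ps, YangBaxterRel (B₂ j) (B₂ k) (B₀ k))
    (hj : B₀ j = permOp d)
    (hreg : ∀ p ∈ ps, B₁ p.2 = permOp d ∧ B₁ j * (permOp d * B₀ p.2 * permOp d) = 1)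
    (hsing : ∀ p ∈ ps, B₂ p.1 = Matrix.of (fun p q => permOp d (q.2, p.1) (p.2, q.1)) ∧
      B₀ p.1 = Matrix.of fun p q => B₂ j (q.2, p.1) (p.2, q.1))
    (h₀ : IsUnit (twistTrace z B₀ (r ++ j :: pairSites ps)))
    (h₂ : IsUnit (twistTrace z B₂ (r ++ j :: pairSites ps))) :
    ((twistTrace z B₂ (r ++ j :: pairSites ps))⁻¹ * twistTrace z B₁ (r ++ j :: pairSites ps)) ^
        ps.length * (twistTrace (x * z) B₀ (r ++ j :: pairSites ps) *
          (twistTrace z B₀ (r ++ j :: pairSites ps))⁻¹) =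
      siteOp j x * ((twistTrace z B₂ (r ++ j :: pairSites ps))⁻¹ *
        twistTrace z B₁ (r ++ j :: pairSites ps)) ^ ps.length := by
  set t₀ := twistTrace z B₀ (r ++ j :: pairSites ps) with ht₀
  set t₁ := twistTrace z B₁ (r ++ j :: pairSites ps) with ht₁
  set t₂ := twistTrace z B₂ (r ++ j :: pairSites ps) with ht₂
  have e₀ := twistTrace_of_regular 1 z hnd hj
  have e₁ := twistTrace_of_regular x z hnd hj
  rw [one_mul, siteOp_one, mul_one, ← ht₀] at e₀
  -- `t₀` equals the full leg product times another operator. Square matrices with an invertible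
  -- product are invertible, so every initial part of the leg product is a unit.
  have hU : ∀ l l', pairSites ps = l ++ l' → IsUnit (legProd B₀ j l) := by
    intro l l' h
    rw [e₀] at h₀
    have := isUnit_of_mul_left h₀
    rw [h, legProd_append] at this
    exact isUnit_of_mul_left this
  -- Induction on the number of pairs still linked to `j`, stripped from the far end.
  have key : ∀ qs qs', ps = qs ++ qs' → ∀ u : (Op d S)ˣ, (u : Op d S) = legProd B₀ j (pairSites qs) →
      (t₂⁻¹ * t₁) ^ qs.length * (u * siteOp j x * ↑u⁻¹) =
        siteOp j x * (t₂⁻¹ * t₁) ^ qs.length := by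
    intro qs
    induction qs using List.reverseRecOn with
    | nil =>
      intro qs' _ u hu
      have : u = 1 := Units.ext (by rw [hu]; rfl)
      simp [this]
    | append_singleton qs p ih =>
      obtain ⟨o, e⟩ := p
      intro qs' hps u hu
      have hmem : (o, e) ∈ ps := by simp [hps]
      have hsplit : pairSites ps = pairSites qs ++ o :: e :: pairSites qs' := by
        simp [hps, pairSites]
      obtain ⟨u₁, hu₁⟩ := hU (pairSites qs) _ hsplit
      obtain ⟨u₂, hu₂⟩ := hU (pairSites qs ++ [o]) (e :: pairSites qs') (by simp [hsplit])
      have hu' : (u : Op d S) = legProd B₀ j ((pairSites qs ++ [o]) ++ [e]) := by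
        rw [hu, pairSites_append]; simp [pairSites]
      have hnd₁ : (r ++ j :: (pairSites qs ++ o :: (e :: pairSites qs'))).Nodup := by
        rw [← hsplit]; exact hnd
      have hnd₂ : (r ++ j :: ((pairSites qs ++ [o]) ++ e :: pairSites qs')).Nodup := by
        simpa [hsplit] using hnd
      have hjn : j ∉ r ∧ j ∉ pairSites ps := by
        simp only [List.nodup_append, List.nodup_cons, List.mem_cons] at hnd
        exact ⟨fun h => hnd.2.2 j h j (Or.inl rfl) rfl, hnd.2.1.1⟩
      have hjn' : j ∉ r ++ pairSites ps := by
        rw [List.mem_append, not_or]; exact hjn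
      -- `t₂` lengthens the legs by the site `o`, so its inverse removes that leg; `t₁` removes the
      -- leg to `e`. In the list `o` precedes `e`, hence `t₁` acts first.
      have s₁ := twistTrace_mul_legProd_of_singlet (B := B₂) (C := B₀) z hnd₁
        (fun k hk => hY₂ k (by simp [hsplit, hk])) (hsing _ hmem).1 (hsing _ hmem).2
      have s₂ := twistTrace_mul_legProd_of_regular (B := B₁) (C := B₀) z hnd₂
        (fun k hk => hY₁ k (by
          rw [List.mem_append, List.mem_singleton] at hk
          rcases hk with hk | hk <;> simp [hsplit, hk]))
        (hreg _ hmem).1 (hreg _ hmem).2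
      rw [← hsplit, ← ht₂, ← hu₁, ← hu₂] at s₁
      rw [List.append_assoc, List.singleton_append, ← hsplit, ← ht₁, ← hu₂, ← hu'] at s₂
      have c₁ := conj_exchange u₂ u₁ s₁ (twistTrace_commute_siteOp z hjn' x)
      have c₂ := conj_exchange u₂ u s₂ (twistTrace_commute_siteOp z hjn' x)
      have c : t₂⁻¹ * t₁ * (u * siteOp j x * ↑u⁻¹) = u₁ * siteOp j x * ↑u₁⁻¹ * (t₂⁻¹ * t₁) := by
        rw [mul_assoc, c₂]
        have hd := (Matrix.isUnit_iff_isUnit_det _).1 h₂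
        calc t₂⁻¹ * (u₂ * siteOp j x * ↑u₂⁻¹ * t₁)
            = t₂⁻¹ * (u₂ * siteOp j x * ↑u₂⁻¹ * t₂) * (t₂⁻¹ * t₁) := by
              simp only [mul_assoc]; rw [Matrix.mul_nonsing_inv_cancel_left _ _ hd]
          _ = _ := by rw [← c₁, Matrix.nonsing_inv_mul_cancel_left _ _ hd]
      rw [List.length_append, List.length_singleton, pow_succ, mul_assoc, c, ← mul_assoc,
        ih ((o, e) :: qs') (by simp [hps]) u₁ hu₁, mul_assoc]
  obtain ⟨u, hu⟩ := hU (pairSites ps) [] (by simp)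
  have hk := key ps [] (by simp) u hu
  have : twistTrace (x * z) B₀ (r ++ j :: pairSites ps) * t₀⁻¹ = u * siteOp j x * ↑u⁻¹ := by
    have hd := (Matrix.isUnit_iff_isUnit_det _).1 h₀
    have e₂ : (u * siteOp j x * ↑u⁻¹) * t₀ = twistTrace (x * z) B₀ (r ++ j :: pairSites ps) := by
      rw [e₁, e₀, ← hu]; simp [mul_assoc]
    rw [← e₂, Matrix.mul_nonsing_inv_cancel_right _ _ hd]
  rw [this, hk]

end Inverse

/-! ### The quantum transfer matrix as an ordered product -/

section ColOp

variable {d : ℕ} (Mo : LatticeModel d)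

/-- The two-site operator of the staggered monodromy matrix, with first factor on the auxiliary
space. -/
def LatticeModel.colOp {M : ℕ} (ν : Fin M → ℂ) (u : ℂ) (k : Fin M) : TwoOp d :=
  if (k : ℕ) % 2 = 0 then Mo.R u (ν k)
  else Matrix.of fun p q => Mo.R (ν k) u (q.2, p.1) (p.2, q.1)

theorem staggeredFactor_eq {M : ℕ} (ν : Fin M → ℂ) (u : ℂ) (k : Fin M) :
    Mo.staggeredFactor ν u k = auxSite (Mo.colOp ν u k) k := by
  unfold LatticeModel.staggeredFactor LatticeModel.colOp
  split_ifs
  · rfl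
  · rfl

theorem list_prod_staggeredFactor {M : ℕ} (ν : Fin M → ℂ) (u : ℂ) :
    (List.ofFn (Mo.staggeredFactor ν u)).reverse.prod =
      colProd (Mo.colOp ν u) (List.finRange M).reverse := by
  rw [colProd, List.ofFn_eq_map, ← List.map_reverse, funext (staggeredFactor_eq Mo ν u)]

theorem qtm_eq_twistTrace {M : ℕ} (κ : ℂ) (ν : Fin M → ℂ) (u : ℂ) :
    Mo.qtm κ ν u = twistTrace (Mo.twist κ) (Mo.colOp ν u) (List.finRange M).reverse := by
  rw [LatticeModel.qtm, LatticeModel.monodromy, list_prod_staggeredFactor, twistTrace]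

theorem monodromyEntry_eq_twistTrace {M : ℕ} (κ : ℂ) (ν : Fin M → ℂ)
    (x : Matrix (Fin d) (Fin d) ℂ) (u : ℂ) :
    Mo.monodromyEntry κ ν x u =
      twistTrace (x * Mo.twist κ) (Mo.colOp ν u) (List.finRange M).reverse := by
  rw [LatticeModel.monodromyEntry, LatticeModel.monodromy, list_prod_staggeredFactor, twistTrace,
    auxOnly_mul, mul_assoc]

variable {Mo} {U : Set ℂ}

theorem yangBaxterRel_colOp (hMo : Mo.IsFundamental U) {M : ℕ} {ν : Fin M → ℂ} {u v : ℂ}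
    (hu : u ∈ U) (hv : v ∈ U) {k : Fin M} (hk : ν k ∈ U) :
    YangBaxterRel (Mo.R u v) (Mo.colOp ν u k) (Mo.colOp ν v k) := by
  unfold LatticeModel.colOp
  split_ifs
  · exact yangBaxterRel_of_pairOp (hMo.yangBaxter u hu v hv _ hk)
  -- On even spaces the weight has the inhomogeneity as its first argument and is transposed; the
  -- relation is the partial transpose of the Yang-Baxter equation with that space in front.
  · exact (yangBaxterRel_of_pairOp (hMo.yangBaxter _ hk u hu v hv)).dual

/-- The site at which the regularized vertical spaces begin. -/
def midSite (n : ℕ) : Fin (2 * (2 * n) + 2) := ⟨2 * n, by omega⟩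

theorem reverse_range_two_mul (n : ℕ) : (List.range (2 * n)).reverse =
    (List.range n).reverse.flatMap fun p => [2 * p + 1, 2 * p] := by
  induction n with
  | zero => rfl
  | succ n ih =>
    rw [Nat.mul_succ, List.range_succ, List.range_succ, List.range_succ]
    simp [ih]

/-- The vertical spaces in front of the regularized ones, in pairs. -/
def lowPairs (n : ℕ) : List (Fin (2 * (2 * n) + 2) × Fin (2 * (2 * n) + 2)) :=
  (List.finRange n).reverse.map fun p : Fin n =>
    (⟨2 * p + 1, by have := p.isLt; omega⟩, ⟨2 * p, by have := p.isLt; omega⟩)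

/-- The vertical spaces behind the regularized ones, in pairs. -/
def highPairs (n : ℕ) : List (Fin (2 * (2 * n) + 2) × Fin (2 * (2 * n) + 2)) :=
  (List.finRange n).reverse.map fun p : Fin n =>
    (⟨2 * (n + 1 + p) + 1, by have := p.isLt; omega⟩,
      ⟨2 * (n + 1 + p), by have := p.isLt; omega⟩)

/-- The sites with the numbers `2 n + 1, …, 4 n + 1`, in descending order. -/
def highSites (n : ℕ) : List (Fin (2 * (2 * n) + 2)) :=
  pairSites (highPairs n) ++ [⟨2 * n + 1, by omega⟩]

theorem reverse_finRange_eq (n : ℕ) : (List.finRange (2 * (2 * n) + 2)).reverse =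
    highSites n ++ midSite n :: pairSites (lowPairs n) := by
  refine (List.map_injective_iff.2 Fin.val_injective) ?_
  have h1 : List.map Fin.val (List.finRange (2 * (2 * n) + 2)) =
      List.range (2 * (n + 1 + n)) := by
    rw [show 2 * (n + 1 + n) = 2 * (2 * n) + 2 by omega]; simp
  rw [List.map_reverse, h1, reverse_range_two_mul, List.range_add, List.range_succ]
  simp only [← List.map_coe_finRange_eq_range, ← List.map_reverse, highSites, pairSites, lowPairs,
    highPairs, List.flatMap_map, List.map_flatMap, List.map_cons, List.map_nil, List.map_append,
    List.reverse_append, List.flatMap_append, List.reverse_cons, List.nil_append,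
    List.flatMap_cons, List.append_assoc, List.cons_append,
    midSite]

end ColOp

/-! ### The inverse problem for the staggered inhomogeneities. -/

section InverseProblem

variable {d : ℕ} {Mo : LatticeModel d} {U : Set ℂ}

/-- The solution of the inverse problem for the regularized quantum transfer matrix. -/
theorem siteOp_midSite_mul_pow (hMo : Mo.IsFundamental U) (T t : ℝ) (n : ℕ) {ε : ℂ}
    (hν : ∀ k, Mo.inhomogeneity T t n ε k ∈ U) (hε : ε ∈ U) (hτ : Mo.tR t / (2 * n : ℕ) ∈ U)
    (hτ' : -(Mo.tR t / (2 * n : ℕ)) ∈ U) (x : Matrix (Fin d) (Fin d) ℂ)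
    (h₀ : IsUnit (Mo.dynQtm T t n ε ε))
    (h₂ : IsUnit (Mo.dynQtm T t n ε (Mo.tR t / (2 * n : ℕ)))) :
    ((Mo.dynQtm T t n ε (Mo.tR t / (2 * n : ℕ)))⁻¹ *
        Mo.dynQtm T t n ε (-(Mo.tR t / (2 * n : ℕ)))) ^ n *
        (Mo.dynEntry T t n ε x ε * (Mo.dynQtm T t n ε ε)⁻¹) =
      siteOp (midSite n) x * ((Mo.dynQtm T t n ε (Mo.tR t / (2 * n : ℕ)))⁻¹ *
        Mo.dynQtm T t n ε (-(Mo.tR t / (2 * n : ℕ)))) ^ n := by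
  have hr := reverse_finRange_eq n
  generalize highSites n = r at hr
  simp only [LatticeModel.dynQtm, LatticeModel.dynEntry, qtm_eq_twistTrace,
    monodromyEntry_eq_twistTrace, hr] at h₀ h₂ ⊢
  have hlen : (lowPairs n).length = n := by simp [lowPairs]
  have hmid : Mo.inhomogeneity T t n ε (midSite n) = ε := by
    simp [LatticeModel.inhomogeneity, midSite]
  have hmidOp : ∀ u, Mo.colOp (Mo.inhomogeneity T t n ε) u (midSite n) = Mo.R u ε := by
    intro u
    rw [LatticeModel.colOp, hmid, if_pos (by simp [midSite])]
  have hnd : (r ++ midSite n :: pairSites (lowPairs n)).Nodup := by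
    rw [← hr, List.nodup_reverse]; exact List.nodup_finRange _
  -- The spectral parameters are `ε`, where the middle weight is a permutation; `-t_R/N`, where the
  -- weight at the lower space of each low pair is one; and `t_R/N`, where the weight at the upper
  -- space is a partially transposed permutation.
  have := siteOp_mul_pow_eq (B₀ := Mo.colOp (Mo.inhomogeneity T t n ε) ε)
    (B₁ := Mo.colOp (Mo.inhomogeneity T t n ε) (-(Mo.tR t / (2 * n : ℕ))))
    (B₂ := Mo.colOp (Mo.inhomogeneity T t n ε) (Mo.tR t / (2 * n : ℕ))) x
    (Mo.twist (Mo.alpha / T)) hnd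
    (fun k _ => by rw [hmidOp]; exact yangBaxterRel_colOp hMo hτ' hε (hν k))
    (fun k _ => by rw [hmidOp]; exact yangBaxterRel_colOp hMo hτ hε (hν k))
    (by rw [hmidOp]; exact hMo.regular ε hε) ?_ ?_ h₀ h₂
  · rw [hlen] at this
    exact this
  · intro p hp
    obtain ⟨q, -, rfl⟩ := List.mem_map.1 hp
    have hv : Mo.inhomogeneity T t n ε ⟨2 * q, by have := q.isLt; omega⟩ = -(Mo.tR t / (2 * n : ℕ)) := by
      simp [LatticeModel.inhomogeneity]
    have hop : ∀ u, Mo.colOp (Mo.inhomogeneity T t n ε) u ⟨2 * q, by have := q.isLt; omega⟩ =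
        Mo.R u (-(Mo.tR t / (2 * n : ℕ))) := by
      intro u
      rw [LatticeModel.colOp, hv, if_pos (by simp)]
    rw [hop, hop, hmidOp]
    exact ⟨hMo.regular _ hτ', hMo.unitary _ hτ' _ hε⟩
  · intro p hp
    obtain ⟨q, -, rfl⟩ := List.mem_map.1 hp
    have hv : Mo.inhomogeneity T t n ε ⟨2 * q + 1, by have := q.isLt; omega⟩ = Mo.tR t / (2 * n : ℕ) := by
      have h1 : (2 * (q : ℕ) + 1) / 2 < n := by have := q.isLt; omega
      have h2 : (2 * (q : ℕ) + 1) % 2 ≠ 0 := by omega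
      simp only [LatticeModel.inhomogeneity, h1, h2, if_true, if_false, neg_neg]
    have hop : ∀ u, Mo.colOp (Mo.inhomogeneity T t n ε) u ⟨2 * q + 1, by have := q.isLt; omega⟩ =
        Matrix.of fun p q => Mo.R (Mo.tR t / (2 * n : ℕ)) u (q.2, p.1) (p.2, q.1) := by
      intro u
      rw [LatticeModel.colOp, hv, if_neg (by simp)]
    rw [hop, hop, hmidOp, hMo.regular _ hτ]
    exact ⟨rfl, rfl⟩

end InverseProblem

/-! ### Row-to-row and column-to-column evaluation of lattice sums -/

section Rotation

variable {d : ℕ}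

/-- The operator on a horizontal row of sites that is obtained from local weights, the first tensor
factor of which belongs to the row. -/
def rowSum {L : ℕ} [NeZero L] (w : Fin L → TwoOp d) : Op d (Fin L) :=
  Matrix.of fun σ τ => ∑ a : Fin L → Fin d, ∏ j, w j (σ j, a j) (τ j, a (j + 1))

/-- The operator on a vertical column of sites that is obtained from local weights, the second
tensor factor of which belongs to the column. -/
def colSum {M : ℕ} [NeZero M] (w : Fin M → TwoOp d) : Op d (Fin M) :=
  Matrix.of fun α β => ∑ s : Fin M → Fin d, ∏ k, w k (s (k + 1), α k) (s k, β k)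

/-- Both sides sum the same product of weights over all horizontal and vertical edge variables of an
`L × M` torus; only the order of summation differs. -/
theorem trace_rowSum_eq_trace_colSum {L M : ℕ} [NeZero L] [NeZero M] (w : Fin L → Fin M → TwoOp d) :
    Matrix.trace (List.ofFn fun k : Fin M => rowSum fun j => w j k).reverse.prod =
      Matrix.trace (List.ofFn fun j : Fin L => colSum (w j)).prod := by
  rw [trace_reverse_list_ofFn_prod, trace_list_ofFn_prod]
  simp only [List.prod_reverse, List.prod_ofFn, rowSum, colSum, Matrix.of_apply, Fintype.prod_sum]
  rw [Finset.sum_comm, ← (Equiv.piComm fun (_ : Fin L) (_ : Fin M) => Fin d).sum_comp]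
  refine Finset.sum_congr rfl fun A _ => ?_
  rw [← (Equiv.piComm fun (_ : Fin L) (_ : Fin M) => Fin d).sum_comp]
  refine Finset.sum_congr rfl fun S _ => ?_
  rw [Finset.prod_comm]
  rfl

theorem reverse_ofFn_prod_siteOp {M : ℕ} (x : Fin M → Matrix (Fin d) (Fin d) ℂ) :
    (List.ofFn fun k => siteOp k (x k)).reverse.prod = productOp x := by
  rw [List.ofFn_eq_map, ← List.map_reverse]
  exact list_prod_siteOp x _ (List.nodup_reverse.2 (List.nodup_finRange M)) (by simp)

theorem ofFn_prod_siteOp {M : ℕ} (x : Fin M → Matrix (Fin d) (Fin d) ℂ) :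
    (List.ofFn fun k => siteOp k (x k)).prod = productOp x := by
  rw [List.ofFn_eq_map]
  exact list_prod_siteOp x _ (List.nodup_finRange M) (by simp)

theorem trace_reverse_auxSite_prod {M : ℕ} [NeZero M] (w : Fin M → TwoOp d) :
    Matrix.trace (List.ofFn fun k => auxSite (w k) k).reverse.prod = colSum w := by
  rw [trace_reverse_list_ofFn_prod]
  simp only [auxSite_apply, reverse_ofFn_prod_siteOp]
  ext α β
  simp [Matrix.sum_apply, productOp, colSum, block]

/-- `t_⊥` multiplies the sites in descending order. Read along ascending sites, its auxiliary line
is traversed backwards, hence the transposition in that space. -/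
theorem rowTransfer_eq_rowSum (Mo : LatticeModel d) {L : ℕ} [NeZero L] (u : ℂ) :
    Mo.rowTransfer L u =
      rowSum fun _ => Matrix.of fun p q => Mo.R u 0 (q.2, p.1) (p.2, q.1) := by
  rw [LatticeModel.rowTransfer, trace_reverse_auxSite_prod]
  rfl

theorem rowTransferBar_eq_rowSum (Mo : LatticeModel d) {L : ℕ} [NeZero L] (u : ℂ) :
    Mo.rowTransferBar L u = rowSum fun _ => Mo.R 0 u := by
  rw [LatticeModel.rowTransferBar, trace_list_ofFn_prod]
  simp only [siteAux, Matrix.of_apply, ofFn_prod_siteOp]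
  ext σ τ
  simp [Matrix.sum_apply, productOp, rowSum]

/-- This is the reason for the staggering: at spectral parameter 0 the vertical spaces, read as
rows, are the two row-to-row transfer matrices at the inhomogeneities. -/
theorem rowSum_colOp (Mo : LatticeModel d) {L M : ℕ} [NeZero L] (ν : Fin M → ℂ) (k : Fin M) :
    (rowSum fun _ : Fin L => Mo.colOp ν 0 k) =
      if (k : ℕ) % 2 = 0 then Mo.rowTransferBar L (ν k) else Mo.rowTransfer L (ν k) := by
  unfold LatticeModel.colOp
  split_ifs
  · rw [rowTransferBar_eq_rowSum]
  · rw [rowTransfer_eq_rowSum]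

theorem productOp_mul_rowSum {L : ℕ} [NeZero L] (z : Fin L → Matrix (Fin d) (Fin d) ℂ)
    (w : Fin L → TwoOp d) : productOp z * rowSum w = rowSum fun j => (z j ⊗ₖ 1) * w j := by
  ext σ τ
  simp only [productOp, rowSum, Matrix.mul_apply, Matrix.of_apply, Fintype.sum_prod_type,
    Matrix.kroneckerMap_apply, Matrix.one_apply, mul_ite, mul_one, mul_zero, ite_mul, zero_mul,
    Finset.sum_ite_eq, Finset.mem_univ, if_true, Finset.mul_sum, ← Finset.prod_mul_distrib]
  rw [Finset.sum_comm]
  simp only [Fintype.prod_sum]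

theorem rowSum_mul_productOp {L : ℕ} [NeZero L] (z : Fin L → Matrix (Fin d) (Fin d) ℂ)
    (w : Fin L → TwoOp d) : rowSum w * productOp z = rowSum fun j => w j * (z j ⊗ₖ 1) := by
  ext σ τ
  simp only [productOp, rowSum, Matrix.mul_apply, Matrix.of_apply, Fintype.sum_prod_type,
    Matrix.kroneckerMap_apply, Matrix.one_apply, mul_ite, mul_one, mul_zero,
    Finset.sum_ite_eq', Finset.mem_univ, if_true, Finset.sum_mul, ← Finset.prod_mul_distrib]
  rw [Finset.sum_comm]
  simp only [Fintype.prod_sum]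

theorem auxOnly_mul_auxSite {S : Type} [Fintype S] [DecidableEq S]
    (z : Matrix (Fin d) (Fin d) ℂ) (w : TwoOp d) (k : S) :
    auxOnly S z * auxSite w k = auxSite ((z ⊗ₖ 1) * w) k := by
  ext1 a b
  simp only [Matrix.mul_apply, auxSite_apply, auxOnly, Matrix.of_apply, smul_mul_assoc, one_mul,
    ← siteOp_smul, ← siteOp_sum]
  congr 1
  ext p q
  simp [block, Matrix.sum_apply, Matrix.mul_apply, Fintype.sum_prod_type, Matrix.one_apply]

theorem auxSite_mul_auxOnly {S : Type} [Fintype S] [DecidableEq S]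
    (z : Matrix (Fin d) (Fin d) ℂ) (w : TwoOp d) (k : S) :
    auxSite w k * auxOnly S z = auxSite (w * (z ⊗ₖ 1)) k := by
  ext1 a b
  simp only [Matrix.mul_apply, auxSite_apply, auxOnly, Matrix.of_apply, mul_smul_comm, mul_one,
    ← siteOp_smul, ← siteOp_sum]
  congr 1
  ext p q
  simp [block, Matrix.sum_apply, Matrix.mul_apply, Fintype.sum_prod_type, Matrix.one_apply,
    mul_comm]

/-- Stated for an arbitrary monoid because it is applied both to row operators and to the factors of
one column. -/
theorem list_prod_dressed {G α : Type*} [Monoid G] [DecidableEq α] (f : α → G) (A B : G) {a b : α}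
    {l l' : List α} (h : (a :: l ++ b :: l').Nodup) :
    ((a :: l ++ b :: l').map fun k =>
        (if k = a then A else 1) * f k * (if k = b then B else 1)).prod =
      A * (((a :: l).map f).prod * f b) * B * (l'.map f).prod := by
  simp only [List.cons_append, List.nodup_cons, List.nodup_append, List.mem_append,
    List.mem_cons, not_or] at h
  obtain ⟨⟨h1, h2, h3⟩, h4, ⟨h5, h6⟩, h7⟩ := h
  have e1 : (l.map fun k => (if k = a then A else 1) * f k * (if k = b then B else 1)) =
      l.map f := by
    refine List.map_congr_left fun k hk => ?_
    rw [if_neg (ne_of_mem_of_not_mem hk h1), if_neg (h7 k hk b (Or.inl rfl)), one_mul, mul_one]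
  have e2 : (l'.map fun k => (if k = a then A else 1) * f k * (if k = b then B else 1)) =
      l'.map f := by
    refine List.map_congr_left fun k hk => ?_
    rw [if_neg (ne_of_mem_of_not_mem hk h3), if_neg (ne_of_mem_of_not_mem hk h5), one_mul, mul_one]
  simp only [List.map_append, List.map_cons, List.prod_append, List.prod_cons, e1, e2]
  simp only [if_true, if_neg h2, if_neg (Ne.symm h2), mul_one, one_mul, mul_assoc]

/-- The lattice sum of operators inserted behind the last and behind the middle row. -/
theorem trace_dressed_rows {L M : ℕ} [NeZero L] [NeZero M] (C : Fin M → TwoOp d)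
    (zL zR : Fin L → Matrix (Fin d) (Fin d) ℂ) {a b : Fin M} {l l' : List (Fin M)}
    (hl : (List.finRange M).reverse = a :: l ++ b :: l') :
    Matrix.trace (productOp zL *
        (((a :: l).map fun k => rowSum fun _ : Fin L => C k).prod * rowSum fun _ => C b) *
        productOp zR * (l'.map fun k => rowSum fun _ => C k).prod) =
      Matrix.trace (List.ofFn fun j : Fin L => Matrix.trace (auxOnly (Fin M) (zL j) *
        (colProd C (a :: l) * auxSite (C b) b) * auxOnly (Fin M) (zR j) * colProd C l')).prod := by
  have hnd : (a :: l ++ b :: l').Nodup := by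
    rw [← hl, List.nodup_reverse]; exact List.nodup_finRange M
  have key := trace_rowSum_eq_trace_colSum (L := L) (M := M) fun j k =>
    ((if k = a then zL j else 1) ⊗ₖ 1) * C k * ((if k = b then zR j else 1) ⊗ₖ 1)
  have e1 : (List.ofFn fun k : Fin M => rowSum fun j : Fin L =>
      ((if k = a then zL j else 1) ⊗ₖ 1) * C k * ((if k = b then zR j else 1) ⊗ₖ 1)).reverse.prod =
      productOp zL * (((a :: l).map fun k => rowSum fun _ : Fin L => C k).prod *
        rowSum fun _ => C b) * productOp zR * (l'.map fun k => rowSum fun _ => C k).prod := by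
    rw [← list_prod_dressed (fun k => rowSum fun _ : Fin L => C k) _ _ hnd, ← hl,
      List.ofFn_eq_map, ← List.map_reverse]
    refine congrArg List.prod (List.map_congr_left fun k _ => ?_)
    rw [← rowSum_mul_productOp, ← productOp_mul_rowSum]
    congr 1
    · congr 1
      split_ifs
      · rfl
      · exact productOp_one
    · split_ifs
      · rfl
      · exact productOp_one
  have e2 : ∀ j : Fin L, (colSum fun k => ((if k = a then zL j else 1) ⊗ₖ 1) * C k *
      ((if k = b then zR j else 1) ⊗ₖ 1)) = Matrix.trace (auxOnly (Fin M) (zL j) *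
        (colProd C (a :: l) * auxSite (C b) b) * auxOnly (Fin M) (zR j) * colProd C l') := by
    intro j
    rw [← trace_reverse_auxSite_prod, colProd, colProd,
      ← list_prod_dressed (fun k => auxSite (C k) k) _ _ hnd, ← hl, List.ofFn_eq_map,
      ← List.map_reverse]
    refine congrArg Matrix.trace (congrArg List.prod (List.map_congr_left fun k _ => ?_))
    rw [← auxSite_mul_auxOnly, ← auxOnly_mul_auxSite]
    congr 1
    · congr 1
      split_ifs
      · rfl
      · exact auxOnly_one
    · split_ifs
      · rfl
      · exact auxOnly_one
  rw [e1] at key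
  rw [key]
  simp only [e2]

end Rotation

/-! ### Exponentials of matrices -/

section Exponential

theorem norm_mul_pow_le_of_le {A : Type*} [NormedRing A] {a b : A} {K : ℝ} (hb : ‖b‖ ≤ K)
    (hK : 0 ≤ K) (n : ℕ) : ‖a * b ^ n‖ ≤ ‖a‖ * K ^ n := by
  induction n with
  | zero => simp
  | succ n ih =>
    rw [pow_succ, ← mul_assoc, pow_succ, ← mul_assoc]
    exact (norm_mul_le _ _).trans (mul_le_mul ih hb (norm_nonneg _) (by positivity))

theorem norm_pow_sub_pow_le {A : Type*} [NormedRing A] {a b : A} {K : ℝ} (ha : ‖a‖ ≤ K)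
    (hb : ‖b‖ ≤ K) (hK : 1 ≤ K) (n : ℕ) : ‖a ^ n - b ^ n‖ ≤ n * K ^ n * ‖a - b‖ := by
  induction n with
  | zero => simp
  | succ n ih =>
    have h0 : (0 : ℝ) ≤ K := by linarith
    have e : a ^ (n + 1) - b ^ (n + 1) = a * (a ^ n - b ^ n) + (a - b) * b ^ n := by
      rw [pow_succ', pow_succ']; noncomm_ring
    have h1 : ‖a * (a ^ n - b ^ n)‖ ≤ K * (n * K ^ n * ‖a - b‖) :=
      (norm_mul_le _ _).trans (mul_le_mul ha ih (norm_nonneg _) h0)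
    have h2 : ‖(a - b) * b ^ n‖ ≤ ‖a - b‖ * K ^ n := norm_mul_pow_le_of_le hb h0 n
    have h3 : K ^ n ≤ K ^ (n + 1) := pow_le_pow_right₀ hK (Nat.le_succ n)
    rw [e]
    calc _ ≤ _ := norm_add_le _ _
      _ ≤ K * (n * K ^ n * ‖a - b‖) + ‖a - b‖ * K ^ n := add_le_add h1 h2
      _ ≤ K * (n * K ^ n * ‖a - b‖) + ‖a - b‖ * K ^ (n + 1) := by gcongr
      _ = _ := by push_cast; ring

/-- If `n (A_n - 1)` converges to `X`, then `A_n ^ n` converges to `exp X`. -/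
theorem tendsto_pow_exp_of_tendsto {A : Type*} [NormedRing A] [NormOneClass A] [NormedAlgebra ℂ A]
    [CompleteSpace A] {a : ℕ → A} {X : A}
    (h : Tendsto (fun n : ℕ => (n : ℂ) • (a n - 1)) atTop (𝓝 X)) :
    Tendsto (fun n : ℕ => a n ^ n) atTop (𝓝 (NormedSpace.exp X)) := by
  let : NormedAlgebra ℚ A := NormedAlgebra.restrictScalars ℚ ℂ A
  -- The comparison sequence `exp (X / n)` has `n`-th power exactly `exp X` and the same first-order
  -- behaviour, so only the difference of `n`-th powers has to be estimated.
  set b : ℕ → A := fun n => NormedSpace.exp ((n : ℂ)⁻¹ • X) with hb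
  have hinv : Tendsto (fun n : ℕ => (n : ℂ)⁻¹) atTop (𝓝[≠] 0) := by
    refine tendsto_nhdsWithin_iff.2 ⟨tendsto_inv_atTop_nhds_zero_nat, ?_⟩
    filter_upwards [eventually_gt_atTop 0] with n hn
    simpa using hn.ne'
  have hb1 : Tendsto (fun n : ℕ => (n : ℂ) • (b n - 1)) atTop (𝓝 X) := by
    have hd := (hasDerivAt_exp_smul_const (𝕂 := ℂ) X (0 : ℂ)).tendsto_slope_zero
    have := hd.comp hinv
    simpa [Function.comp_def, hb] using this
  have hdiff : Tendsto (fun n : ℕ => (n : ℝ) * ‖a n - b n‖) atTop (𝓝 0) := by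
    have := (h.sub hb1).norm
    simp only [sub_self, norm_zero, ← smul_sub, sub_sub_sub_cancel_right, norm_smul] at this
    simpa using this
  -- `n ‖c n - 1‖` is eventually below `‖X‖ + 1`; thus all powers up to the `n`-th stay below `exp
  -- (‖X‖ + 1)`, uniformly in `n`.
  have hbound : ∀ c : ℕ → A, Tendsto (fun n : ℕ => (n : ℂ) • (c n - 1)) atTop (𝓝 X) →
      ∀ᶠ n : ℕ in atTop, ‖c n‖ ≤ 1 + (‖X‖ + 1) / n := by
    intro c hc
    filter_upwards [hc.norm.eventually_le_const (lt_add_one _), eventually_gt_atTop 0] with n hn h0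
    have h0' : (0 : ℝ) < n := by exact_mod_cast h0
    rw [norm_smul, Complex.norm_natCast] at hn
    have h1 : ‖c n - 1‖ ≤ (‖X‖ + 1) / n := by rw [le_div_iff₀ h0']; linarith
    calc ‖c n‖ = ‖1 + (c n - 1)‖ := by rw [add_sub_cancel]
      _ ≤ ‖(1 : A)‖ + ‖c n - 1‖ := norm_add_le _ _
      _ ≤ _ := by rw [norm_one]; linarith
  have hlim : Tendsto (fun n : ℕ => a n ^ n - b n ^ n) atTop (𝓝 0) := by
    refine squeeze_zero_norm' (a := fun n : ℕ => Real.exp (‖X‖ + 1) * (n * ‖a n - b n‖)) ?_ ?_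
    · filter_upwards [hbound a h, hbound b hb1, eventually_gt_atTop 0] with n h1 h2 h0
      have h0' : (0 : ℝ) < n := by exact_mod_cast h0
      have hK : (1 : ℝ) ≤ 1 + (‖X‖ + 1) / n := by
        have : 0 ≤ (‖X‖ + 1) / n := by positivity
        linarith
      have h3 : (1 + (‖X‖ + 1) / n) ^ n ≤ Real.exp (‖X‖ + 1) := by
        have h4 : 1 + (‖X‖ + 1) / n ≤ Real.exp ((‖X‖ + 1) / n) := by
          rw [add_comm]; exact Real.add_one_le_exp _
        calc _ ≤ Real.exp ((‖X‖ + 1) / n) ^ n := by gcongr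
          _ = _ := by rw [← Real.exp_nat_mul, mul_div_cancel₀ _ h0'.ne']
      refine (norm_pow_sub_pow_le h1 h2 hK n).trans ?_
      calc _ ≤ n * Real.exp (‖X‖ + 1) * ‖a n - b n‖ := by gcongr
        _ = _ := by ring
    · simpa using hdiff.const_mul (Real.exp (‖X‖ + 1))
  have hbn : ∀ᶠ n : ℕ in atTop, a n ^ n - b n ^ n + NormedSpace.exp X = a n ^ n := by
    filter_upwards [eventually_gt_atTop 0] with n h0
    have : b n ^ n = NormedSpace.exp X := by
      rw [hb, ← NormedSpace.exp_nsmul, ← Nat.cast_smul_eq_nsmul ℂ, smul_smul,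
        mul_inv_cancel₀ (by exact_mod_cast h0.ne'), one_smul]
    rw [this, sub_add_cancel]
  have := (hlim.add_const (NormedSpace.exp X)).congr' hbn
  rwa [zero_add] at this

variable {ι : Type*} [Fintype ι] [DecidableEq ι]

attribute [local instance] Matrix.linftyOpNormedRing Matrix.linftyOpNormedAlgebra
  Matrix.linfty_opNormOneClass

theorem matrix_tendsto_pow_exp [Nonempty ι] {a : ℕ → Matrix ι ι ℂ} {X : Matrix ι ι ℂ}
    (h : Tendsto (fun n : ℕ => (n : ℂ) • (a n - 1)) atTop (𝓝 X)) :
    Tendsto (fun n : ℕ => a n ^ n) atTop (𝓝 (NormedSpace.exp X)) :=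
  tendsto_pow_exp_of_tendsto h

theorem matrix_semiconjBy_exp {x a b : Matrix ι ι ℂ} (h : SemiconjBy x a b) :
    SemiconjBy x (NormedSpace.exp a) (NormedSpace.exp b) :=
  SemiconjBy.exp_right h

/-- Differentiation of the commutation relation at `c = 0`. -/
theorem matrix_commute_of_commute_exp {A B : Matrix ι ι ℂ}
    (h : ∀ c : ℂ, Commute (NormedSpace.exp (c • A)) B) : Commute A B := by
  have h1 := (hasDerivAt_exp_smul_const (𝕂 := ℂ) A (0 : ℂ)).mul_const B
  have h2 := (hasDerivAt_exp_smul_const (𝕂 := ℂ) A (0 : ℂ)).const_mul B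
  have h3 := (h1.congr_of_eventuallyEq (Eventually.of_forall fun c => (h c).eq.symm)).unique h2
  have h4 : NormedSpace.exp ((0 : ℂ) • A) = 1 := by rw [zero_smul, NormedSpace.exp_zero]
  have h5 := (congrArg (· * A * B) h4).symm.trans (h3.trans (congrArg (fun C => B * (C * A)) h4))
  rw [one_mul] at h5
  exact h5

theorem matrix_map_exp {κ : Type*} [Fintype κ] [DecidableEq κ]
    (f : Matrix ι ι ℂ →ₐ[ℂ] Matrix κ κ ℂ) (x : Matrix ι ι ℂ) :
    f (NormedSpace.exp x) = NormedSpace.exp (f x) :=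
  NormedSpace.map_exp f (LinearMap.continuous_of_finiteDimensional f.toLinearMap) x

theorem matrix_exp_smul_one (c : ℂ) :
    NormedSpace.exp (c • (1 : Matrix ι ι ℂ)) = Complex.exp c • 1 := by
  have := NormedSpace.algebraMap_exp_comm (𝕂 := ℂ) (𝔸 := Matrix ι ι ℂ) c
  rw [Algebra.algebraMap_eq_smul_one, Algebra.algebraMap_eq_smul_one] at this
  rw [Complex.exp_eq_exp_ℂ]
  exact this.symm

end Exponential

/-! ### The logarithmic derivative of the transfer matrix -/

section RowSums

variable {d L : ℕ} [NeZero L]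

/-- The shift operator of the periodic chain. -/
def shiftOp (d L : ℕ) [NeZero L] : Op d (Fin L) :=
  Matrix.of fun σ τ => if σ = fun i => τ (i - 1) then 1 else 0

/-- The inverse of the shift operator of the periodic chain. -/
def shiftOpInv (d L : ℕ) [NeZero L] : Op d (Fin L) :=
  Matrix.of fun σ τ => if τ = fun i => σ (i - 1) then 1 else 0

theorem mul_shiftOp_apply (A : Op d (Fin L)) (σ τ : Fin L → Fin d) :
    (A * shiftOp d L) σ τ = A σ fun i => τ (i - 1) := by
  simp [Matrix.mul_apply, shiftOp]

theorem shiftOpInv_mul_apply (A : Op d (Fin L)) (σ τ : Fin L → Fin d) :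
    (shiftOpInv d L * A) σ τ = A (fun i => σ (i - 1)) τ := by
  simp [Matrix.mul_apply, shiftOpInv]

theorem shiftOp_mul_shiftOpInv : shiftOp d L * shiftOpInv d L = 1 := by
  have h : shiftOpInv d L * shiftOp d L = 1 := by
    ext σ τ
    rw [shiftOpInv_mul_apply, shiftOp, Matrix.of_apply, Matrix.one_apply]
    congr 1
    rw [eq_iff_iff]
    refine ⟨fun h => funext fun i => ?_, fun h => by rw [h]⟩
    simpa using congrFun h (i + 1)
  exact mul_eq_one_comm.1 h

/-- Weights with constraints that determine the horizontal variables. -/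
theorem sum_constrained {α : Type*} [Fintype α] [DecidableEq α] (j : Fin L) (f : α → α → ℂ)
    (g g' : Fin L → α) (hL : 2 ≤ L) :
    (∑ a : Fin L → α, if ∀ i, i ≠ j → a i = g i ∧ a (i + 1) = g' i then f (a j) (a (j + 1)) else 0) =
      if ∀ k, k ≠ j → k ≠ j + 1 → g k = g' (k - 1) then f (g' (j - 1)) (g (j + 1)) else 0 := by
  have hj : j + 1 ≠ j := by
    obtain ⟨L, rfl⟩ := Nat.exists_eq_add_of_le' hL
    simp
  have hj' : j - 1 ≠ j := by
    intro h
    apply hj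
    conv_lhs => rw [← h]
    simp
  -- Away from `j` the constraints say `a i = g i`. The value `a j` is fixed by the constraint at `j
  -- - 1`, which is available because `j - 1 ≠ j` for `2 ≤ L`.
  rw [Finset.sum_eq_single (Function.update g j (g' (j - 1)))]
  · rw [Function.update_self, Function.update_of_ne hj]
    congr 1
    rw [eq_iff_iff]
    constructor
    · intro h k hk hk'
      have := (h (k - 1) (fun e => hk' (by rw [← e]; simp))).2
      rwa [sub_add_cancel, Function.update_of_ne hk] at this
    · intro h i hi
      refine ⟨Function.update_of_ne hi _ _, ?_⟩
      by_cases hi' : i + 1 = j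
      · rw [hi', Function.update_self, ← hi', add_sub_cancel_right]
      · rw [Function.update_of_ne hi', h _ hi' (by simpa using hi), add_sub_cancel_right]
  · intro a _ ha
    refine if_neg fun h => ha ?_
    ext1 i
    by_cases hi : i = j
    · subst hi
      have := (h (i - 1) hj').2
      rw [sub_add_cancel] at this
      rw [this, Function.update_self]
    · rw [Function.update_of_ne hi, (h i hi).1]
  · simp

theorem rowSum_update_apply (w : TwoOp d) (j : Fin L) (X : TwoOp d) (σ τ : Fin L → Fin d) :
    rowSum (Function.update (fun _ => w) j X) σ τ = ∑ a : Fin L → Fin d,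
      (∏ i ∈ Finset.univ.erase j, w (σ i, a i) (τ i, a (i + 1))) *
        X (σ j, a j) (τ j, a (j + 1)) := by
  rw [rowSum, Matrix.of_apply]
  refine Finset.sum_congr rfl fun a _ => ?_
  rw [← Finset.mul_prod_erase _ _ (Finset.mem_univ j), Function.update_self, mul_comm]
  congr 1
  refine Finset.prod_congr rfl fun i hi => ?_
  rw [Function.update_of_ne (Finset.ne_of_mem_erase hi)]

/-- Permutation weights hand each spin on to its neighbour, so the row is a shift. One exceptional
weight adds an operator on two neighbouring sites. With `hasDerivAt_rowSum` this produces the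
Hamiltonian density. -/
theorem rowSum_update_perm (hL : 2 ≤ L) (j : Fin L) (X : TwoOp d) :
    rowSum (Function.update (fun _ => permOp d) j X) =
      shiftOpInv d L * pairOp j (j + 1) (Matrix.of fun p q => X (p.2, p.1) q) := by
  ext σ τ
  rw [rowSum_update_apply, shiftOpInv_mul_apply, pairOp, Matrix.of_apply]
  have := sum_constrained j (fun a b => X (σ j, a) (τ j, b)) τ σ hL
  simp only [permOp, Matrix.of_apply, Finset.prod_ite_zero, Finset.prod_const_one, ite_mul, one_mul,
    zero_mul, Finset.mem_erase, Finset.mem_univ, and_true]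
  simp only [add_sub_cancel_right]
  convert this using 2
  · congr 1
    rw [eq_iff_iff]
    exact forall_congr' fun i => forall_congr' fun _ => by
      constructor <;> rintro ⟨h1, h2⟩ <;> exact ⟨by simp_all, by simp_all⟩
  · exact forall_congr' fun i => forall_congr' fun _ => forall_congr' fun _ => eq_comm

theorem rowSum_update_perm' (hL : 2 ≤ L) (j : Fin L) (X : TwoOp d) :
    rowSum (Function.update (fun _ => Matrix.of fun p q => permOp d (q.2, p.1) (p.2, q.1)) j X) =
      pairOp j (j + 1) (Matrix.of fun p q => X (p.1, q.1) (q.2, p.2)) * shiftOp d L := by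
  ext σ τ
  rw [rowSum_update_apply, mul_shiftOp_apply, pairOp, Matrix.of_apply]
  have := sum_constrained j (fun a b => X (σ j, a) (τ j, b)) σ τ hL
  simp only [permOp, Matrix.of_apply, Finset.prod_ite_zero, Finset.prod_const_one, ite_mul, one_mul,
    zero_mul, Finset.mem_erase, Finset.mem_univ, and_true]
  simp only [add_sub_cancel_right]
  convert this using 2
  congr 1
  rw [eq_iff_iff]
  exact forall_congr' fun i => forall_congr' fun _ => by
    constructor <;> rintro ⟨h1, h2⟩ <;> exact ⟨by simp_all, by simp_all⟩

theorem rowSum_perm : (rowSum fun _ : Fin L => permOp d) = shiftOpInv d L := by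
  ext σ τ
  simp only [rowSum, shiftOpInv, permOp, Matrix.of_apply, Finset.prod_ite_zero,
    Finset.prod_const_one, Finset.mem_univ, true_imp_iff]
  rw [Finset.sum_eq_single τ]
  · congr 1
    rw [eq_iff_iff]
    refine ⟨fun h => funext fun i => ?_, fun h i => ⟨by rw [h]; simp, rfl⟩⟩
    have := (h (i - 1)).1
    rw [sub_add_cancel] at this
    exact this.symm
  · intro a _ ha
    refine if_neg fun h => ha (funext fun i => (h i).2)
  · simp

theorem rowSum_perm' :
    (rowSum fun _ : Fin L => Matrix.of fun p q => permOp d (q.2, p.1) (p.2, q.1)) =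
      shiftOp d L := by
  ext σ τ
  simp only [rowSum, shiftOp, permOp, Matrix.of_apply, Finset.prod_ite_zero,
    Finset.prod_const_one, Finset.mem_univ, true_imp_iff]
  rw [Finset.sum_eq_single σ]
  · congr 1
    rw [eq_iff_iff]
    refine ⟨fun h => funext fun i => ?_, fun h i => ⟨by rw [h]; simp, rfl⟩⟩
    have := (h (i - 1)).1
    rw [sub_add_cancel] at this
    exact this
  · intro a _ ha
    refine if_neg fun h => ha (funext fun i => (h i).2.symm)
  · simp

theorem hasDerivAt_rowSum {w : ℂ → TwoOp d} {w' : TwoOp d} {x : ℂ}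
    (hw : ∀ p q, HasDerivAt (fun u => w u p q) (w' p q) x) (σ τ : Fin L → Fin d) :
    HasDerivAt (fun u => rowSum (fun _ : Fin L => w u) σ τ)
      ((∑ j, rowSum (Function.update (fun _ => w x) j w')) σ τ) x := by
  simp only [Matrix.sum_apply, rowSum_update_apply]
  rw [Finset.sum_comm]
  simp only [rowSum, Matrix.of_apply]
  refine HasDerivAt.fun_sum fun a _ => ?_
  exact HasDerivAt.fun_finsetProd fun i _ => hw _ _

end RowSums

/-! ### Derivatives of the transfer matrices at the shift point and the Trotter limit. -/

section Trotter

variable {d : ℕ} {Mo : LatticeModel d} {U : Set ℂ}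

theorem IsFundamental_mem_nhds (hMo : Mo.IsFundamental U) : U ∈ 𝓝 (0 : ℂ) :=
  hMo.isOpen.mem_nhds hMo.zero_mem

theorem differentiableAt_R (hMo : Mo.IsFundamental U) {z : ℂ × ℂ} (h1 : z.1 ∈ U) (h2 : z.2 ∈ U)
    (p q : Fin d × Fin d) : DifferentiableAt ℂ (fun z : ℂ × ℂ => Mo.R z.1 z.2 p q) z :=
  (hMo.holomorphic p q).differentiableAt ((hMo.isOpen.prod hMo.isOpen).mem_nhds ⟨h1, h2⟩)

theorem permOp_mul_apply (A : TwoOp d) (p q : Fin d × Fin d) :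
    (permOp d * A) p q = A (p.2, p.1) q := by
  simp [Matrix.mul_apply, permOp, Fintype.sum_prod_type, ite_and]

theorem mul_permOp_apply (A : TwoOp d) (p q : Fin d × Fin d) :
    (A * permOp d) p q = A p (q.2, q.1) := by
  simp [Matrix.mul_apply, permOp, Fintype.sum_prod_type, ite_and]

theorem hasDerivAt_R_fst (hMo : Mo.IsFundamental U) (p q : Fin d × Fin d) :
    HasDerivAt (fun u => Mo.R u 0 p q) (Mo.hamDensity (p.2, p.1) q) 0 := by
  have h := (differentiableAt_R hMo (z := (0, 0)) hMo.zero_mem hMo.zero_mem p q).comp (0 : ℂ)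
    (f := fun u : ℂ => (u, (0 : ℂ))) (by fun_prop)
  simp only [LatticeModel.hamDensity, Matrix.of_apply, permOp_mul_apply]
  exact h.hasDerivAt

/-- The derivative in the second argument follows from that in the first by differentiating
unitarity at 0, where `R` is the permutation. -/
theorem hasDerivAt_R_snd (hMo : Mo.IsFundamental U) (p q : Fin d × Fin d) :
    HasDerivAt (fun u => Mo.R 0 u p q) (-Mo.hamDensity (p.2, p.1) q) 0 := by
  have hd : ∀ p q, HasDerivAt (fun u => Mo.R 0 u p q) (deriv (fun u => Mo.R 0 u p q) 0) 0 := by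
    intro p q
    have h := (differentiableAt_R hMo (z := (0, 0)) hMo.zero_mem hMo.zero_mem p q).comp (0 : ℂ)
      (f := fun u : ℂ => ((0 : ℂ), u)) (by fun_prop)
    exact h.hasDerivAt
  have hu : ∀ᶠ v in 𝓝 (0 : ℂ), ∑ r : Fin d × Fin d, Mo.R 0 v p r * Mo.R v 0 (r.2, r.1) q =
      (1 : TwoOp d) p (q.2, q.1) := by
    filter_upwards [IsFundamental_mem_nhds hMo] with v hv
    have := congrFun (congrFun (hMo.unitary 0 hMo.zero_mem v hv) p) (q.2, q.1)
    rw [Matrix.mul_apply] at this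
    rw [← this]
    refine Finset.sum_congr rfl fun r _ => ?_
    rw [mul_permOp_apply, permOp_mul_apply]
  have h1 : HasDerivAt (fun v => ∑ r : Fin d × Fin d, Mo.R 0 v p r * Mo.R v 0 (r.2, r.1) q)
      (∑ r : Fin d × Fin d, (deriv (fun u => Mo.R 0 u p r) 0 * Mo.R 0 0 (r.2, r.1) q +
        Mo.R 0 0 p r * Mo.hamDensity r q)) 0 :=
    HasDerivAt.fun_sum fun r _ => (hd p r).mul (hasDerivAt_R_fst hMo (r.2, r.1) q)
  have h2 := h1.unique ((hasDerivAt_const (0 : ℂ) _).congr_of_eventuallyEq hu)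
  rw [hMo.regular 0 hMo.zero_mem, Finset.sum_add_distrib] at h2
  have h3 : ∑ r : Fin d × Fin d, deriv (fun u => Mo.R 0 u p r) 0 * permOp d (r.2, r.1) q =
      deriv (fun u => Mo.R 0 u p q) 0 := by
    rw [Finset.sum_eq_single q]
    · simp [permOp]
    · rintro r - hr
      have : ¬ (r.2 = q.2 ∧ r.1 = q.1) := fun h => hr (Prod.ext h.2 h.1)
      simp [permOp, this]
    · simp
  have h4 : ∑ r : Fin d × Fin d, permOp d p r * Mo.hamDensity r q = Mo.hamDensity (p.2, p.1) q := by
    rw [← Matrix.mul_apply, permOp_mul_apply]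
  rw [h3, h4] at h2
  rw [← eq_neg_of_add_eq_zero_left h2]
  exact hd p q

theorem rowTransfer_zero (hMo : Mo.IsFundamental U) {L : ℕ} [NeZero L] :
    Mo.rowTransfer L 0 = shiftOp d L := by
  rw [rowTransfer_eq_rowSum, hMo.regular 0 hMo.zero_mem, rowSum_perm']

theorem rowTransferBar_zero (hMo : Mo.IsFundamental U) {L : ℕ} [NeZero L] :
    Mo.rowTransferBar L 0 = shiftOpInv d L := by
  rw [rowTransferBar_eq_rowSum, hMo.regular 0 hMo.zero_mem, rowSum_perm]

theorem rowTransfer_zero_mul_rowTransferBar_zero (hMo : Mo.IsFundamental U) {L : ℕ} [NeZero L] :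
    Mo.rowTransfer L 0 * Mo.rowTransferBar L 0 = 1 := by
  rw [rowTransfer_zero hMo, rowTransferBar_zero hMo, shiftOp_mul_shiftOpInv]

/-- The sum of the densities of the Hamiltonian. -/
def densitySum (Mo : LatticeModel d) (L : ℕ) [NeZero L] : Op d (Fin L) :=
  ∑ j : Fin L, pairOp (j - 1) j Mo.hamDensity

theorem densitySum_eq (L : ℕ) [NeZero L] :
    densitySum Mo L = ∑ j : Fin L, pairOp j (j + 1) Mo.hamDensity := by
  rw [densitySum, ← Equiv.sum_comp (Equiv.addRight (1 : Fin L))]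
  simp

theorem hasDerivAt_rowTransfer (hMo : Mo.IsFundamental U) {L : ℕ} [NeZero L] (hL : 2 ≤ L)
    (σ τ : Fin L → Fin d) : HasDerivAt (fun u => Mo.rowTransfer L u σ τ)
      ((densitySum Mo L * shiftOp d L) σ τ) 0 := by
  simp only [rowTransfer_eq_rowSum]
  have h := hasDerivAt_rowSum (L := L)
    (w := fun u => Matrix.of fun p q => Mo.R u 0 (q.2, p.1) (p.2, q.1))
    (w' := Matrix.of fun p q => Mo.hamDensity (p.1, q.2) (p.2, q.1))
    (fun p q => hasDerivAt_R_fst hMo (q.2, p.1) (p.2, q.1)) σ τ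
  rw [hMo.regular 0 hMo.zero_mem] at h
  simp only [rowSum_update_perm' hL] at h
  rw [← Finset.sum_mul] at h
  rw [densitySum_eq]
  exact h

theorem hasDerivAt_rowTransferBar (hMo : Mo.IsFundamental U) {L : ℕ} [NeZero L] (hL : 2 ≤ L)
    (σ τ : Fin L → Fin d) : HasDerivAt (fun u => Mo.rowTransferBar L u σ τ)
      ((-(shiftOpInv d L * densitySum Mo L)) σ τ) 0 := by
  simp only [rowTransferBar_eq_rowSum]
  have h := hasDerivAt_rowSum (L := L) (w := fun u => Mo.R 0 u)
    (w' := Matrix.of fun p q => -Mo.hamDensity (p.2, p.1) q)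
    (fun p q => hasDerivAt_R_snd hMo p q) σ τ
  rw [hMo.regular 0 hMo.zero_mem] at h
  simp only [rowSum_update_perm hL] at h
  rw [← Finset.mul_sum] at h
  rw [densitySum_eq, ← mul_neg, ← Finset.sum_neg_distrib]
  convert h using 5 with j
  rw [← pairLin_apply, ← pairLin_apply, ← map_neg]
  rfl

/-- The shifts cancel in the product, and both factors contribute `-c` times the sum of the
densities. -/
theorem hasDerivAt_rowTransfer_mul (hMo : Mo.IsFundamental U) {L : ℕ} [NeZero L] (hL : 2 ≤ L)
    (c : ℂ) (σ τ : Fin L → Fin d) :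
    HasDerivAt (fun u => (Mo.rowTransfer L (-(c * u)) * Mo.rowTransferBar L (c * u)) σ τ)
      ((-(2 * c) • densitySum Mo L) σ τ) 0 := by
  have hc : HasDerivAt (fun u : ℂ => c * u) c 0 := by simpa using (hasDerivAt_id (0 : ℂ)).const_mul c
  have h1 : ∀ ρ, HasDerivAt (fun u => Mo.rowTransfer L (-(c * u)) σ ρ)
      ((densitySum Mo L * shiftOp d L) σ ρ * -c) 0 := fun ρ => by
    refine HasDerivAt.comp (0 : ℂ) (h₂ := fun u => Mo.rowTransfer L u σ ρ) ?_ hc.neg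
    simpa using hasDerivAt_rowTransfer hMo hL σ ρ
  have h2 : ∀ ρ, HasDerivAt (fun u => Mo.rowTransferBar L (c * u) ρ τ)
      ((-(shiftOpInv d L * densitySum Mo L)) ρ τ * c) 0 := fun ρ => by
    refine HasDerivAt.comp (0 : ℂ) (h₂ := fun u => Mo.rowTransferBar L u ρ τ) ?_ hc
    simpa using hasDerivAt_rowTransferBar hMo hL ρ τ
  simp only [Matrix.mul_apply]
  refine (HasDerivAt.fun_sum fun ρ _ => (h1 ρ).mul (h2 ρ)).congr_deriv ?_
  simp only [mul_zero, neg_zero, rowTransfer_zero hMo, rowTransferBar_zero hMo]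
  have e : (-(2 * c) • densitySum Mo L) = (-c • (densitySum Mo L * shiftOp d L)) * shiftOpInv d L +
      shiftOp d L * (c • -(shiftOpInv d L * densitySum Mo L)) := by
    rw [smul_mul_assoc, mul_assoc, shiftOp_mul_shiftOpInv, mul_one, mul_smul_comm, mul_neg,
      ← mul_assoc, shiftOp_mul_shiftOpInv, one_mul]
    module
  rw [e, Matrix.add_apply, Matrix.mul_apply, Matrix.mul_apply, ← Finset.sum_add_distrib]
  refine Finset.sum_congr rfl fun ρ _ => ?_
  simp only [Matrix.smul_apply, smul_eq_mul]
  ring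

theorem tendsto_trotterRho (hMo : Mo.IsFundamental U) [NeZero d] {L : ℕ} [NeZero L] (hL : 2 ≤ L)
    (β : ℂ) : Tendsto (fun n => Mo.trotterRho n L β) atTop
      (𝓝 (NormedSpace.exp (-β • Mo.ham0 L))) := by
  -- The argument `ks β / N` with `N = 2 n` is `c / n` with `c = ks β / 2`; the two equal
  -- contributions to the derivative restore the factor 2.
  have hX : -β • Mo.ham0 L = -(2 * (Mo.ks * β / 2)) • densitySum Mo L := by
    rw [LatticeModel.ham0, ← densitySum, smul_smul]
    congr 1; ring
  rw [hX]
  have : Nonempty (Fin L → Fin d) := ⟨fun _ => 0⟩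
  refine matrix_tendsto_pow_exp ?_
  refine tendsto_pi_nhds.2 fun σ => tendsto_pi_nhds.2 fun τ => ?_
  have hinv : Tendsto (fun n : ℕ => (n : ℂ)⁻¹) atTop (𝓝[≠] 0) := by
    refine tendsto_nhdsWithin_iff.2 ⟨tendsto_inv_atTop_nhds_zero_nat, ?_⟩
    filter_upwards [eventually_gt_atTop 0] with n hn
    simpa using hn.ne'
  have h := ((hasDerivAt_rowTransfer_mul hMo hL (Mo.ks * β / 2) σ τ).tendsto_slope_zero).comp hinv
  refine h.congr fun n => ?_
  simp only [Function.comp_apply, zero_add, inv_inv, mul_zero, neg_zero,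
    rowTransfer_zero_mul_rowTransferBar_zero hMo, Matrix.smul_apply, Matrix.sub_apply]
  have e : Mo.ks * β / 2 * (n : ℂ)⁻¹ = Mo.ks * β / (2 * n : ℕ) := by
    rw [Nat.cast_mul, Nat.cast_two, div_mul_eq_div_div, div_eq_mul_inv _ (n : ℂ)]
  rw [e, neg_div]

end Trotter

/-! ### The external field -/

section Field

variable {d : ℕ} {Mo : LatticeModel d} {U : Set ℂ}

theorem exp_siteOp {S : Type} [Fintype S] [DecidableEq S] (j : S) (x : Matrix (Fin d) (Fin d) ℂ) :
    NormedSpace.exp (siteOp j x) = siteOp j (NormedSpace.exp x) :=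
  (matrix_map_exp (siteHom d j) x).symm

theorem exp_sum_siteOp {S : Type} [Fintype S] [DecidableEq S] (x : Matrix (Fin d) (Fin d) ℂ)
    (s : Finset S) : NormedSpace.exp (∑ j ∈ s, siteOp j x) =
      productOp fun j : S => if j ∈ s then NormedSpace.exp x else 1 := by
  induction s using Finset.induction_on with
  | empty =>
    simp only [Finset.sum_empty, NormedSpace.exp_zero, Finset.notMem_empty, if_false]
    exact productOp_one.symm
  | insert a s ha ih =>
    rw [Finset.sum_insert ha, Matrix.exp_add_of_commute, ih, exp_siteOp, siteOp_eq_productOp,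
      ← productOp_mul]
    · congr 1
      ext1 j
      by_cases h : j = a
      · subst h; simp [ha]
      · simp [h]
    · exact Commute.sum_right _ _ _ fun j hj => siteOp_commute (ne_of_mem_of_not_mem hj ha).symm _ _

theorem exp_fieldOp (L : ℕ) (c : ℂ) :
    NormedSpace.exp (c • Mo.fieldOp L) = productOp fun _ : Fin L => Mo.twist c := by
  rw [LatticeModel.fieldOp, Finset.smul_sum]
  simp only [← siteOp_smul, exp_sum_siteOp, Finset.mem_univ, if_true]
  rfl

theorem twist_mul_twist_neg (c : ℂ) : Mo.twist c * Mo.twist (-c) = 1 := by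
  rw [LatticeModel.twist, LatticeModel.twist, ← Matrix.exp_add_of_commute, neg_smul,
    add_neg_cancel, NormedSpace.exp_zero]
  rw [neg_smul]
  exact (Commute.refl _).neg_right

theorem isUnit_twist (c : ℂ) : IsUnit (Mo.twist c) :=
  IsUnit.of_mul_eq_one _ (twist_mul_twist_neg c)

/-- Conjugation of every weight in the horizontal space cancels between neighbours, and round the
periodic chain by cyclicity of the trace. -/
theorem rowSum_gauge {L : ℕ} [NeZero L] {w w' : TwoOp d} {v : Matrix (Fin d) (Fin d) ℂ}
    (hv : IsUnit v) (h : w' * (1 ⊗ₖ v) = (1 ⊗ₖ v) * w) :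
    (rowSum fun _ : Fin L => w') = rowSum fun _ => w := by
  have key : ∀ (l : List (Fin d × Fin d)),
      (l.map fun x => Matrix.of fun a b => w' (x.1, a) (x.2, b)).prod * v =
        v * (l.map fun x => Matrix.of fun a b => w (x.1, a) (x.2, b)).prod := by
    intro l
    induction l with
    | nil => simp
    | cons x l ih =>
      have hx : (Matrix.of fun a b => w' (x.1, a) (x.2, b)) * v =
          v * Matrix.of fun a b => w (x.1, a) (x.2, b) := by
        ext a b
        have := congrFun (congrFun h (x.1, a)) (x.2, b)
        simpa [Matrix.mul_apply, Fintype.sum_prod_type, Matrix.one_apply] using this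
      rw [List.map_cons, List.prod_cons, List.map_cons, List.prod_cons, mul_assoc, ih, ← mul_assoc,
        hx, mul_assoc]
  have htr : ∀ (W : TwoOp d) (σ τ : Fin L → Fin d), rowSum (fun _ : Fin L => W) σ τ =
      Matrix.trace (((List.finRange L).map fun j => (σ j, τ j)).map fun x =>
        (Matrix.of fun a b => W (x.1, a) (x.2, b) : Matrix (Fin d) (Fin d) ℂ)).prod := by
    intro W σ τ
    rw [List.map_map, ← List.ofFn_eq_map, trace_list_ofFn_prod]
    simp [rowSum, List.prod_ofFn]
  ext σ τ
  obtain ⟨u, rfl⟩ := hv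
  rw [htr, htr]
  have := key ((List.finRange L).map fun j => (σ j, τ j))
  rw [← Units.eq_mul_inv_iff_mul_eq] at this
  rw [this, Matrix.trace_mul_comm, ← mul_assoc, Units.inv_mul, one_mul]

/-- As `R` commutes with `Θ ⊗ Θ`, multiplying it by `Θ ⊗ 1` from the left or from the right gives
weights conjugate by `Θ` in the horizontal space; `rowSum_gauge` identifies the rows. -/
theorem commute_productOp_rowTransferBar (hMo : Mo.IsFundamental U) {L : ℕ} [NeZero L] (c : ℂ)
    {u : ℂ} (hu : u ∈ U) :
    Commute (productOp fun _ : Fin L => Mo.twist c) (Mo.rowTransferBar L u) := by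
  rw [rowTransferBar_eq_rowSum, commute_iff_eq, productOp_mul_rowSum, rowSum_mul_productOp]
  refine (rowSum_gauge (isUnit_twist (Mo := Mo) c) ?_).symm
  rw [mul_assoc, ← mul_assoc (1 ⊗ₖ Mo.twist c), ← Matrix.mul_kronecker_mul,
    ← Matrix.mul_kronecker_mul, one_mul, mul_one]
  exact (hMo.twist_commute 0 hMo.zero_mem u hu c).eq

theorem commute_productOp_rowTransfer (hMo : Mo.IsFundamental U) {L : ℕ} [NeZero L] (c : ℂ)
    {u : ℂ} (hu : u ∈ U) :
    Commute (productOp fun _ : Fin L => Mo.twist c) (Mo.rowTransfer L u) := by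
  rw [rowTransfer_eq_rowSum, commute_iff_eq, productOp_mul_rowSum, rowSum_mul_productOp]
  -- The horizontal space enters `t_⊥` transposed, and so does the gauge matrix.
  have hv : IsUnit (Mo.twist c)ᵀ := by
    rw [Matrix.isUnit_transpose]; exact isUnit_twist c
  refine rowSum_gauge hv ?_
  ext ⟨p, a⟩ ⟨q, b⟩
  have := congrFun (congrFun (hMo.twist_commute u hu 0 hMo.zero_mem c).eq (b, p)) (a, q)
  simp only [Matrix.mul_apply, Fintype.sum_prod_type, Matrix.kroneckerMap_apply, Matrix.one_apply,
    Matrix.of_apply, Matrix.transpose_apply] at this ⊢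
  simp [Finset.sum_mul, Finset.mul_sum] at this ⊢
  refine Eq.trans ?_ (this.symm.trans ?_) <;>
    exact Finset.sum_congr rfl fun i _ => Finset.sum_congr rfl fun j _ => by ring

theorem commute_productOp_trotterRho (hMo : Mo.IsFundamental U) {L : ℕ} [NeZero L] (c : ℂ)
    {n : ℕ} {β : ℂ} (h1 : -(Mo.ks * β) / (2 * n : ℕ) ∈ U) (h2 : Mo.ks * β / (2 * n : ℕ) ∈ U) :
    Commute (productOp fun _ : Fin L => Mo.twist c) (Mo.trotterRho n L β) :=
  ((commute_productOp_rowTransfer hMo c h1).mul_right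
    (commute_productOp_rowTransferBar hMo c h2)).pow_right n

/-- The symmetry is inherited from the transfer matrices: differentiation in the spectral parameter
gives commutation of the twists with the Hamiltonian, and differentiation in the twist parameter
gives the field operator. -/
theorem commute_fieldOp_ham0 (hMo : Mo.IsFundamental U) {L : ℕ} [NeZero L] (hL : 2 ≤ L) :
    Commute (Mo.fieldOp L) (Mo.ham0 L) := by
  refine matrix_commute_of_commute_exp fun c => ?_
  rw [exp_fieldOp, LatticeModel.ham0, ← densitySum]
  refine Commute.smul_right ?_ _
  set G := productOp fun _ : Fin L => Mo.twist c
  have h1 : ∀ᶠ u : ℂ in 𝓝 0, Commute G (Mo.rowTransfer L (-(1 * u)) * Mo.rowTransferBar L (1 * u)) := by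
    have hn : ∀ᶠ u : ℂ in 𝓝 0, -u ∈ U := by
      refine (continuous_neg.tendsto (0 : ℂ)).eventually_mem ?_
      rw [neg_zero]; exact IsFundamental_mem_nhds hMo
    filter_upwards [hn, IsFundamental_mem_nhds hMo] with u hu hu'
    rw [one_mul]
    exact (commute_productOp_rowTransfer hMo c hu).mul_right
      (commute_productOp_rowTransferBar hMo c hu')
  have h2 : G * (-(2 * 1 : ℂ) • densitySum Mo L) = (-(2 * 1 : ℂ) • densitySum Mo L) * G := by
    ext σ τ
    have e1 : HasDerivAt (fun u => (G * (Mo.rowTransfer L (-(1 * u)) * Mo.rowTransferBar L (1 * u))) σ τ)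
        ((G * (-(2 * 1 : ℂ) • densitySum Mo L)) σ τ) 0 := by
      simp only [Matrix.mul_apply (M := G)]
      exact HasDerivAt.fun_sum fun ρ _ =>
        (hasDerivAt_rowTransfer_mul hMo hL 1 ρ τ).const_mul (G σ ρ)
    have e2 : HasDerivAt (fun u => ((Mo.rowTransfer L (-(1 * u)) * Mo.rowTransferBar L (1 * u)) * G) σ τ)
        (((-(2 * 1 : ℂ) • densitySum Mo L) * G) σ τ) 0 := by
      simp only [Matrix.mul_apply (N := G)]
      exact HasDerivAt.fun_sum fun ρ _ =>
        (hasDerivAt_rowTransfer_mul hMo hL 1 σ ρ).mul_const (G ρ τ)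
    refine e1.unique (e2.congr_of_eventuallyEq ?_)
    filter_upwards [h1] with u hu
    rw [hu.eq]
  rw [mul_smul_comm, smul_mul_assoc] at h2
  exact smul_right_injective _ (by norm_num : (-(2 * 1 : ℂ)) ≠ 0) h2

theorem exp_ham_smul (hMo : Mo.IsFundamental U) {L : ℕ} [NeZero L] (hL : 2 ≤ L) (c : ℂ) :
    NormedSpace.exp (c • Mo.ham L) =
      NormedSpace.exp (c • Mo.ham0 L) * NormedSpace.exp (-(c * Mo.alpha) • Mo.fieldOp L) := by
  rw [← Matrix.exp_add_of_commute]
  · congr 1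
    rw [LatticeModel.ham]
    module
  · exact ((commute_fieldOp_ham0 hMo hL).symm.smul_left _).smul_right _

theorem matrix_exp_add_smul {ι : Type*} [Fintype ι] [DecidableEq ι] (A : Matrix ι ι ℂ) (b c : ℂ) :
    NormedSpace.exp ((b + c) • A) = NormedSpace.exp (b • A) * NormedSpace.exp (c • A) := by
  rw [add_smul, Matrix.exp_add_of_commute]
  exact ((Commute.refl A).smul_left _).smul_right _

theorem trace_exp_fieldOp_mul_exp_ham0 (hMo : Mo.IsFundamental U) {L : ℕ} [NeZero L]
    (hL : 2 ≤ L) (T t : ℝ) : Matrix.trace (NormedSpace.exp ((Mo.alpha / T) • Mo.fieldOp L) *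
      NormedSpace.exp (-(1 / T + Complex.I * t) • Mo.ham0 L) *
        NormedSpace.exp (-(-(Complex.I * t)) • Mo.ham0 L)) = Mo.partitionFunction L T := by
  have e1 : -(1 / T + Complex.I * t) + -(-(Complex.I * t)) = -(1 / T : ℂ) := by ring
  have e2 : -(-(1 / T : ℂ) * Mo.alpha) = Mo.alpha / T := by ring
  rw [LatticeModel.partitionFunction, mul_assoc, ← matrix_exp_add_smul, e1, exp_ham_smul hMo hL,
    e2]
  exact congrArg Matrix.trace (((commute_fieldOp_ham0 hMo hL).smul_left _).smul_right _).exp.eq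

/-- The approximants of finite Trotter number converge to the partition function. -/
theorem tendsto_trotter_partitionFunction (hMo : Mo.IsFundamental U) [NeZero d] {L : ℕ} [NeZero L]
    (hL : 2 ≤ L) (T t : ℝ) :
    Tendsto (fun n => Matrix.trace (NormedSpace.exp ((Mo.alpha / T) • Mo.fieldOp L) *
      Mo.trotterRho n L (1 / T + Complex.I * t) * Mo.trotterRho n L (-(Complex.I * t)))) atTop
      (𝓝 (Mo.partitionFunction L T)) := by
  rw [← trace_exp_fieldOp_mul_exp_ham0 hMo hL T t]
  have htr : Continuous fun A : Op d (Fin L) => Matrix.trace A := continuous_id.matrix_trace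
  exact (htr.tendsto _).comp (((tendsto_trotterRho hMo hL _).const_mul _).mul
    (tendsto_trotterRho hMo hL _))

/-- The approximants of finite Trotter number converge to the thermal averages. -/
theorem tendsto_trotterCorrelator (hMo : Mo.IsFundamental U) [NeZero d] {L : ℕ} [NeZero L]
    (hL : 2 ≤ L) (T t : ℝ) (x y : Matrix (Fin d) (Fin d) ℂ) (i j : Fin L)
    (hZ : Mo.partitionFunction L T ≠ 0) :
    Tendsto (fun n => Mo.trotterCorrelator n L T t x y i j) atTop
      (𝓝 (Mo.finiteCorrelator L T t x y i j)) := by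
  have h1 := tendsto_trotterRho hMo hL (1 / T + Complex.I * t)
  have h2 := tendsto_trotterRho hMo hL (-(Complex.I * t))
  have hcomm := commute_fieldOp_ham0 hMo hL
  have htr : Continuous fun A : Op d (Fin L) => Matrix.trace A := continuous_id.matrix_trace
  -- Cyclicity brings `exp (-itH)` next to `exp (-H/T)`; since the field commutes with `H₀`, each
  -- exponential splits into an `H₀` part, which is approximated, and a field part, which is kept.
  have hnum : Mo.finiteCorrelator L T t x y i j =
      Matrix.trace (NormedSpace.exp (-(1 / T + Complex.I * t) • Mo.ham0 L) *
      NormedSpace.exp (((1 / T + Complex.I * t) * Mo.alpha) • Mo.fieldOp L) * siteOp i x *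
      NormedSpace.exp (-(Complex.I * t * Mo.alpha) • Mo.fieldOp L) *
      NormedSpace.exp (-(-(Complex.I * t)) • Mo.ham0 L) * siteOp j y) /
      Mo.partitionFunction L T := by
    have e1 : NormedSpace.exp (-(1 / T + Complex.I * t) • Mo.ham0 L) *
        NormedSpace.exp (((1 / T + Complex.I * t) * Mo.alpha) • Mo.fieldOp L) =
        NormedSpace.exp (-(Complex.I * t) • Mo.ham L) *
          NormedSpace.exp (-(1 / T : ℂ) • Mo.ham L) := by
      rw [← matrix_exp_add_smul, ← neg_add, add_comm (Complex.I * t), exp_ham_smul hMo hL,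
        neg_mul, neg_neg]
    have e2 : NormedSpace.exp (-(Complex.I * t * Mo.alpha) • Mo.fieldOp L) *
        NormedSpace.exp (-(-(Complex.I * t)) • Mo.ham0 L) =
        NormedSpace.exp ((Complex.I * t) • Mo.ham L) := by
      rw [exp_ham_smul hMo hL, neg_neg]
      exact ((hcomm.smul_left _).smul_right _).exp.eq
    rw [LatticeModel.finiteCorrelator, e1, 
      mul_assoc _ (NormedSpace.exp (-(Complex.I * t * Mo.alpha) • Mo.fieldOp L)) _, e2]
    refine congrArg (· / Mo.partitionFunction L T) ?_
    rw [Matrix.trace_mul_comm]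
    simp only [mul_assoc]
  rw [hnum]
  exact ((htr.tendsto _).comp (((((h1.mul_const _).mul_const _).mul_const _).mul h2).mul_const
    _)).div (tendsto_trotter_partitionFunction hMo hL T t) hZ

/-- The action of the field operator on a charged operator. -/
theorem exp_fieldOp_mul_siteOp {L : ℕ} {x : Matrix (Fin d) (Fin d) ℂ} {s : ℂ}
    (hx : Mo.phi * x - x * Mo.phi = s • x) (i : Fin L) (c : ℂ) :
    NormedSpace.exp (c • Mo.fieldOp L) * siteOp i x =
      Complex.exp (c * s) • (siteOp i x * NormedSpace.exp (c • Mo.fieldOp L)) := by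
  have h1 : Mo.fieldOp L * siteOp i x - siteOp i x * Mo.fieldOp L = s • siteOp i x := by
    rw [LatticeModel.fieldOp, Finset.sum_mul, Finset.mul_sum, ← Finset.sum_sub_distrib,
      Finset.sum_eq_single i]
    · rw [← siteOp_mul, ← siteOp_mul, ← siteOp_smul, ← hx, sub_eq_add_neg, sub_eq_add_neg,
        siteOp_add, ← neg_one_smul ℂ, ← neg_one_smul ℂ (x * Mo.phi), siteOp_smul]
    · intro k _ hk
      rw [(siteOp_commute hk Mo.phi x).eq, sub_self]
    · simp
  -- A charged operator shifts the field operator by its charge, and the shift exponentiates to a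
  -- scalar.
  have h2 : SemiconjBy (siteOp i x) (c • Mo.fieldOp L + (c * s) • 1) (c • Mo.fieldOp L) := by
    rw [SemiconjBy, mul_add, mul_smul_comm, mul_smul_comm, mul_one, smul_mul_assoc,
      sub_eq_iff_eq_add.1 h1]
    module
  rw [← (matrix_semiconjBy_exp h2).eq, Matrix.exp_add_of_commute, matrix_exp_smul_one,
    mul_smul_comm, mul_one, mul_smul_comm]
  exact (Commute.one_right _).smul_right _

end Field

/-! ### The vertical lattice representation of the Trotter approximants -/

section Vertical

variable {d : ℕ} {Mo : LatticeModel d} {U : Set ℂ}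

theorem inhomogeneity_of_lt {T t : ℝ} {n : ℕ} {ε : ℂ} {i : Fin (2 * (2 * n) + 2)}
    (h : (i : ℕ) / 2 < n) : Mo.inhomogeneity T t n ε i =
      if (i : ℕ) % 2 = 0 then -(Mo.tR t / (2 * n : ℕ)) else Mo.tR t / (2 * n : ℕ) := by
  simp only [LatticeModel.inhomogeneity, if_pos h, neg_neg]

theorem inhomogeneity_of_eq {T t : ℝ} {n : ℕ} {ε : ℂ} {i : Fin (2 * (2 * n) + 2)}
    (h : (i : ℕ) / 2 = n) : Mo.inhomogeneity T t n ε i = if (i : ℕ) % 2 = 0 then ε else -ε := by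
  simp only [LatticeModel.inhomogeneity, if_neg h.not_lt, if_pos h]

theorem inhomogeneity_of_gt {T t : ℝ} {n : ℕ} {ε : ℂ} {i : Fin (2 * (2 * n) + 2)}
    (h : n < (i : ℕ) / 2) : Mo.inhomogeneity T t n ε i =
      if (i : ℕ) % 2 = 0 then (Mo.tR t + Mo.ks / T) / (2 * n : ℕ)
      else -((Mo.tR t + Mo.ks / T) / (2 * n : ℕ)) := by
  simp only [LatticeModel.inhomogeneity, if_neg h.le.not_gt, if_neg h.ne']

theorem prod_map_pairSites {G α : Type*} [Monoid G] (f : α → G) (c : G) {ps : List (α × α)}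
    (h : ∀ p ∈ ps, f p.1 * f p.2 = c) : ((pairSites ps).map f).prod = c ^ ps.length := by
  induction ps with
  | nil => simp [pairSites]
  | cons p ps ih =>
    have : pairSites (p :: ps) = p.1 :: p.2 :: pairSites ps := by simp [pairSites]
    rw [this, List.map_cons, List.map_cons, List.prod_cons, List.prod_cons, ← mul_assoc,
      h p (by simp), ih fun q hq => h q (by simp [hq]), List.length_cons, pow_succ']

theorem length_lowPairs (n : ℕ) : (lowPairs n).length = n := by simp [lowPairs]

theorem length_highPairs (n : ℕ) : (highPairs n).length = n := by simp [highPairs]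

/-- The rows below the regularized one make up the Trotter approximant of the time evolution. -/
theorem prod_rows_lowPairs (T t : ℝ) (n : ℕ) (ε : ℂ) {L : ℕ} [NeZero L] :
    ((pairSites (lowPairs n)).map fun k => rowSum fun _ : Fin L =>
      Mo.colOp (Mo.inhomogeneity T t n ε) 0 k).prod = Mo.trotterRho n L (-(Complex.I * t)) := by
  rw [prod_map_pairSites _ (Mo.rowTransfer L (-(Mo.ks * -(Complex.I * t)) / (2 * n : ℕ)) *
    Mo.rowTransferBar L (Mo.ks * -(Complex.I * t) / (2 * n : ℕ))), length_lowPairs]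
  · rfl
  · intro p hp
    obtain ⟨q, -, rfl⟩ := List.mem_map.1 hp
    have hq := q.isLt
    rw [rowSum_colOp, rowSum_colOp, if_neg (by simp), if_pos (by simp)]
    have e1 : Mo.inhomogeneity T t n ε ⟨2 * q + 1, by omega⟩ =
        -(Mo.ks * -(Complex.I * t)) / (2 * n : ℕ) := by
      rw [inhomogeneity_of_lt (by simp; omega), if_neg (by simp), LatticeModel.tR]
      ring
    have e2 : Mo.inhomogeneity T t n ε ⟨2 * q, by omega⟩ =
        Mo.ks * -(Complex.I * t) / (2 * n : ℕ) := by
      rw [inhomogeneity_of_lt (by simp), if_pos (by simp), LatticeModel.tR]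
      ring
    rw [e1, e2]

/-- The rows above the regularized one make up the Trotter approximant of the statistical operator
times the inverse time evolution. -/
theorem prod_rows_highPairs (T t : ℝ) (n : ℕ) (ε : ℂ) {L : ℕ} [NeZero L] :
    ((pairSites (highPairs n)).map fun k => rowSum fun _ : Fin L =>
      Mo.colOp (Mo.inhomogeneity T t n ε) 0 k).prod =
        Mo.trotterRho n L (1 / T + Complex.I * t) := by
  rw [prod_map_pairSites _ (Mo.rowTransfer L (-(Mo.ks * (1 / T + Complex.I * t)) / (2 * n : ℕ)) *
    Mo.rowTransferBar L (Mo.ks * (1 / T + Complex.I * t) / (2 * n : ℕ))), length_highPairs]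
  · rfl
  · intro p hp
    obtain ⟨q, -, rfl⟩ := List.mem_map.1 hp
    have hq := q.isLt
    rw [rowSum_colOp, rowSum_colOp, if_neg (by simp), if_pos (by simp)]
    have e1 : Mo.inhomogeneity T t n ε ⟨2 * (n + 1 + q) + 1, by omega⟩ =
        -(Mo.ks * (1 / T + Complex.I * t)) / (2 * n : ℕ) := by
      rw [inhomogeneity_of_gt (by simp; omega), if_neg (by simp), LatticeModel.tR]
      ring
    have e2 : Mo.inhomogeneity T t n ε ⟨2 * (n + 1 + q), by omega⟩ =
        Mo.ks * (1 / T + Complex.I * t) / (2 * n : ℕ) := by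
      rw [inhomogeneity_of_gt (by simp; omega), if_pos (by simp), LatticeModel.tR]
      ring
    rw [e1, e2]

theorem inhomogeneity_midSite (T t : ℝ) (n : ℕ) (ε : ℂ) :
    Mo.inhomogeneity T t n ε (midSite n) = ε := by
  rw [inhomogeneity_of_eq (by simp [midSite]), if_pos (by simp [midSite])]

/-- At `ε = 0` the two extra rows multiply to the identity, so they can be inserted into the lattice
without changing its sum. -/
theorem prod_rows_highSites (hMo : Mo.IsFundamental U) (T t : ℝ) (n : ℕ) {L : ℕ} [NeZero L] :
    ((highSites n).map fun k => rowSum fun _ : Fin L =>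
      Mo.colOp (Mo.inhomogeneity T t n 0) 0 k).prod *
      (rowSum fun _ : Fin L => Mo.colOp (Mo.inhomogeneity T t n 0) 0 (midSite n)) =
        Mo.trotterRho n L (1 / T + Complex.I * t) := by
  have e : Mo.inhomogeneity T t n 0 ⟨2 * n + 1, by omega⟩ = 0 := by
    rw [inhomogeneity_of_eq (by simp; omega), if_neg (by simp), neg_zero]
  rw [highSites, List.map_append, List.prod_append, prod_rows_highPairs, List.map_singleton,
    List.prod_singleton, rowSum_colOp, rowSum_colOp, if_neg (by simp),
    if_pos (by simp [midSite]), e, inhomogeneity_midSite, mul_assoc,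
    rowTransfer_zero_mul_rowTransferBar_zero hMo, mul_one]

theorem highSites_eq_cons (n : ℕ) : ∃ a l, highSites n = a :: l := by
  cases h : highSites n with
  | nil => simp [highSites] at h
  | cons a l => exact ⟨a, l, rfl⟩

/-- The columns of the vertical lattice. -/
theorem trace_dressed_trotterRho (hMo : Mo.IsFundamental U) (T t : ℝ) (n : ℕ) {L : ℕ} [NeZero L]
    (zL zR : Fin L → Matrix (Fin d) (Fin d) ℂ) :
    Matrix.trace (productOp zL * Mo.trotterRho n L (1 / T + Complex.I * t) * productOp zR *
      Mo.trotterRho n L (-(Complex.I * t))) =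
    Matrix.trace (List.ofFn fun j : Fin L => siteOp (midSite n) (zR j) *
      twistTrace (zL j) (Mo.colOp (Mo.inhomogeneity T t n 0) 0)
        (List.finRange (2 * (2 * n) + 2)).reverse).prod := by
  obtain ⟨a, l, hal⟩ := highSites_eq_cons n
  have hl := reverse_finRange_eq n
  rw [hal] at hl
  have key := trace_dressed_rows (Mo.colOp (Mo.inhomogeneity T t n 0) 0) zL zR hl
  rw [← hal, prod_rows_highSites hMo, prod_rows_lowPairs] at key
  rw [key]
  refine congrArg Matrix.trace (congrArg List.prod (congrArg List.ofFn (funext fun j => ?_)))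
  -- An operator inserted in a column behind the middle row sits in the auxiliary space to the right
  -- of this permutation, which moves it to the middle vertical space.
  have hP : Mo.colOp (Mo.inhomogeneity T t n 0) 0 (midSite n) = permOp d := by
    rw [LatticeModel.colOp, if_pos (by simp [midSite]), inhomogeneity_midSite,
      hMo.regular 0 hMo.zero_mem]
  have hnd : (highSites n ++ midSite n :: pairSites (lowPairs n)).Nodup := by
    rw [← reverse_finRange_eq, List.nodup_reverse]; exact List.nodup_finRange _
  have hmid : midSite n ∉ highSites n := by
    simp only [List.nodup_append, List.mem_cons] at hnd
    exact fun h => hnd.2.2 _ h _ (Or.inl rfl) rfl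
  rw [reverse_finRange_eq, twistTrace, colProd_append, colProd_cons, hP,
    ← trace_auxScalar_mul]
  refine congrArg Matrix.trace ?_
  have h1 := auxSite_permOp_mul_auxOnly (d := d) (midSite n) (zR j)
  have h2 : Commute (auxScalar d (siteOp (midSite n) (zR j)))
      (auxOnly _ (zL j) * colProd (Mo.colOp (Mo.inhomogeneity T t n 0) 0) (highSites n)) :=
    (commute_auxScalar_auxOnly _ _).mul_right (commute_auxScalar_colProd _ fun k hk y =>
      siteOp_commute (ne_of_mem_of_not_mem hk hmid).symm _ _)
  calc _ = auxOnly _ (zL j) * colProd (Mo.colOp (Mo.inhomogeneity T t n 0) 0) (highSites n) *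
        (auxSite (permOp d) (midSite n) * auxOnly _ (zR j)) *
          colProd (Mo.colOp (Mo.inhomogeneity T t n 0) 0) (pairSites (lowPairs n)) := by
        simp only [mul_assoc]
    _ = _ := by
        rw [h1, ← mul_assoc (auxOnly _ (zL j) * _), ← h2.eq]
        simp only [mul_assoc]

/-- The two insertions are kept in separate factors because for `m = 0` they fall on the same
column. -/
theorem list_ofFn_prod_eq {G : Type*} [Monoid G] (X Y A : G) (l m : ℕ) :
    (List.ofFn fun j : Fin (l + m + 1) => (if j = 0 then X else 1) *
      (if j = LatticeModel.farSite l m then Y else A)).prod = X * (A ^ m * Y * A ^ l) := by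
  have key : (List.ofFn fun j : Fin (l + m + 1) =>
      (if j = LatticeModel.farSite l m then Y else A)).prod = A ^ m * Y * A ^ l := by
    induction m with
    | zero => simp [List.ofFn_succ, LatticeModel.farSite, Fin.ext_iff]
    | succ m ih =>
      have e : ∀ j : Fin (l + m + 1), (j.succ = LatticeModel.farSite l (m + 1)) ↔
          j = LatticeModel.farSite l m := by
        intro j; simp [LatticeModel.farSite, Fin.ext_iff]
      have := List.ofFn_succ (n := l + m + 1) (f := fun j : Fin (l + m + 1 + 1) =>
        (if j = LatticeModel.farSite l (m + 1) then Y else A))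
      simp only [e] at this
      refine (congrArg List.prod this).trans ?_
      rw [List.prod_cons, ih, if_neg (by simp [LatticeModel.farSite, Fin.ext_iff]), pow_succ']
      simp only [mul_assoc]
  rw [← key, List.ofFn_succ, List.ofFn_succ, List.prod_cons, List.prod_cons, if_pos rfl, mul_assoc]
  simp

theorem twistTrace_colOp_eq_dynEntry (T t : ℝ) (n : ℕ) (z : Matrix (Fin d) (Fin d) ℂ) (ε u : ℂ) :
    twistTrace (z * Mo.twist (Mo.alpha / T)) (Mo.colOp (Mo.inhomogeneity T t n ε) u)
      (List.finRange (2 * (2 * n) + 2)).reverse = Mo.dynEntry T t n ε z u :=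
  (monodromyEntry_eq_twistTrace Mo _ _ z u).symm

theorem twistTrace_colOp_eq_dynQtm (T t : ℝ) (n : ℕ) (ε u : ℂ) :
    twistTrace (Mo.twist (Mo.alpha / T)) (Mo.colOp (Mo.inhomogeneity T t n ε) u)
      (List.finRange (2 * (2 * n) + 2)).reverse = Mo.dynQtm T t n ε u :=
  (qtm_eq_twistTrace Mo _ _ u).symm

/-- The Trotter approximants to the partition function in terms of the quantum transfer matrix. -/
theorem trace_trotterRho_eq (hMo : Mo.IsFundamental U) (T t : ℝ) (n L : ℕ) [NeZero L] :
    Matrix.trace (NormedSpace.exp ((Mo.alpha / T) • Mo.fieldOp L) *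
      Mo.trotterRho n L (1 / T + Complex.I * t) * Mo.trotterRho n L (-(Complex.I * t))) =
      Matrix.trace (Mo.dynQtm T t n 0 0 ^ L) := by
  have := trace_dressed_trotterRho hMo T t n (fun _ : Fin L => Mo.twist (Mo.alpha / T))
    (fun _ => 1)
  rw [show (productOp fun _ : Fin L => (1 : Matrix (Fin d) (Fin d) ℂ)) = 1 from productOp_one,
    mul_one, siteOp_one, one_mul, twistTrace_colOp_eq_dynQtm] at this
  rw [exp_fieldOp, this, List.ofFn_const, List.prod_replicate]

/-- The Trotter approximants to the thermal averages in terms of the quantum transfer matrix. -/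
theorem trotterCorrelator_eq (hMo : Mo.IsFundamental U) (T t : ℝ) {n : ℕ} (l m : ℕ)
    {x y : Matrix (Fin d) (Fin d) ℂ} {s : ℂ} (hx : Mo.phi * x - x * Mo.phi = s • x)
    (h1 : -(Mo.ks * (1 / T + Complex.I * t)) / (2 * n : ℕ) ∈ U)
    (h2 : Mo.ks * (1 / T + Complex.I * t) / (2 * n : ℕ) ∈ U) :
    Mo.trotterCorrelator n (l + m + 1) T t x y 0 (LatticeModel.farSite l m) =
      Complex.exp (Complex.I * t * Mo.alpha * s) *
        Matrix.trace (siteOp (midSite n) x * (Mo.dynQtm T t n 0 0 ^ m * Mo.dynEntry T t n 0 y 0 *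
          Mo.dynQtm T t n 0 0 ^ l)) / Matrix.trace (Mo.dynQtm T t n 0 0 ^ (l + m + 1)) := by
  set L := l + m + 1 with hL
  set G := productOp fun _ : Fin L => Mo.twist (Mo.alpha / T) with hG
  have hcG : G * Mo.trotterRho n L (1 / T + Complex.I * t) =
      Mo.trotterRho n L (1 / T + Complex.I * t) * G :=
    (commute_productOp_trotterRho hMo _ h1 h2).eq
  -- The part `itα` of the field exponent passes `x`, leaves its charge factor and cancels on the
  -- other side; the part `α/T` remains as the twist.
  have hfield : NormedSpace.exp (((1 / T + Complex.I * t) * Mo.alpha) • Mo.fieldOp L) *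
      siteOp 0 x * NormedSpace.exp (-(Complex.I * t * Mo.alpha) • Mo.fieldOp L) =
      Complex.exp (Complex.I * t * Mo.alpha * s) • (G * siteOp 0 x) := by
    have e : (1 / T + Complex.I * t) * Mo.alpha = Mo.alpha / T + Complex.I * t * Mo.alpha := by ring
    have e' : Complex.I * t * Mo.alpha + -(Complex.I * t * Mo.alpha) = 0 := by ring
    rw [e, matrix_exp_add_smul, exp_fieldOp, mul_assoc, mul_assoc,
      ← mul_assoc (NormedSpace.exp ((Complex.I * t * Mo.alpha) • Mo.fieldOp L)) (siteOp 0 x),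
      exp_fieldOp_mul_siteOp hx, smul_mul_assoc, mul_assoc (siteOp 0 x), ← matrix_exp_add_smul, e',
      zero_smul, NormedSpace.exp_zero, mul_one, mul_smul_comm]
  have hnum : Matrix.trace (Mo.trotterRho n L (1 / T + Complex.I * t) *
      NormedSpace.exp (((1 / T + Complex.I * t) * Mo.alpha) • Mo.fieldOp L) * siteOp 0 x *
      NormedSpace.exp (-(Complex.I * t * Mo.alpha) • Mo.fieldOp L) *
      Mo.trotterRho n L (-(Complex.I * t)) * siteOp (LatticeModel.farSite l m) y) =
      Complex.exp (Complex.I * t * Mo.alpha * s) *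
        Matrix.trace (siteOp (midSite n) x * (Mo.dynQtm T t n 0 0 ^ m * Mo.dynEntry T t n 0 y 0 *
          Mo.dynQtm T t n 0 0 ^ l)) := by
    -- By cyclicity `y` goes to the top of the lattice, and `hcG` brings the twists there, so both
    -- dress the last row, while `x` stays behind the middle one.
    have key := trace_dressed_trotterRho hMo T t n
      (fun j : Fin L => if j = LatticeModel.farSite l m then y * Mo.twist (Mo.alpha / T)
        else Mo.twist (Mo.alpha / T)) (Pi.mulSingle 0 x)
    have e1 : (productOp fun j : Fin L => if j = LatticeModel.farSite l m then
        y * Mo.twist (Mo.alpha / T) else Mo.twist (Mo.alpha / T)) =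
        siteOp (LatticeModel.farSite l m) y * G := by
      rw [siteOp_eq_productOp, hG, ← productOp_mul]
      refine congrArg productOp (funext fun j => ?_)
      by_cases h : j = LatticeModel.farSite l m
      · subst h; simp
      · simp [h]
    have e2 : (fun j : Fin L => siteOp (midSite n)
          ((Pi.mulSingle 0 x : Fin L → Matrix (Fin d) (Fin d) ℂ) j) *
        twistTrace (if j = LatticeModel.farSite l m then
          y * Mo.twist (Mo.alpha / T) else Mo.twist (Mo.alpha / T))
          (Mo.colOp (Mo.inhomogeneity T t n 0) 0) (List.finRange (2 * (2 * n) + 2)).reverse) =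
        fun j => (if j = 0 then siteOp (midSite n) x else 1) *
          (if j = LatticeModel.farSite l m then Mo.dynEntry T t n 0 y 0
            else Mo.dynQtm T t n 0 0) := by
      funext j
      refine congrArg₂ (· * ·) ?_ ?_
      · by_cases h : j = 0
        · subst h; simp
        · simp [h, siteOp_one]
      · split_ifs
        · exact twistTrace_colOp_eq_dynEntry T t n y 0 0
        · exact twistTrace_colOp_eq_dynQtm T t n 0 0
    rw [e1, e2, list_ofFn_prod_eq, ← siteOp_eq_productOp] at key
    rw [← key, Matrix.trace_mul_comm, ← smul_eq_mul (Complex.exp _), ← Matrix.trace_smul]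
    refine congrArg Matrix.trace ?_
    calc _ = siteOp (LatticeModel.farSite l m) y * (Mo.trotterRho n L (1 / T + Complex.I * t) *
          (NormedSpace.exp (((1 / T + Complex.I * t) * Mo.alpha) • Mo.fieldOp L) *
            siteOp 0 x * NormedSpace.exp (-(Complex.I * t * Mo.alpha) • Mo.fieldOp L)) *
          Mo.trotterRho n L (-(Complex.I * t))) := by simp only [mul_assoc]
      _ = Complex.exp (Complex.I * t * Mo.alpha * s) • (siteOp (LatticeModel.farSite l m) y *
          ((Mo.trotterRho n L (1 / T + Complex.I * t) * G) * siteOp 0 x *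
          Mo.trotterRho n L (-(Complex.I * t)))) := by
        rw [hfield]
        simp only [mul_smul_comm, smul_mul_assoc, mul_assoc]
      _ = _ := by
        rw [← hcG]
        simp only [mul_assoc]
  rw [LatticeModel.trotterCorrelator, hnum, trace_trotterRho_eq hMo]

end Vertical

/-! ### Eigenprojections of matrices -/

section Eigenprojection

variable {ι κ : Type} [Fintype ι] [DecidableEq ι] [Fintype κ] [DecidableEq κ]

theorem continuous_scalar : Continuous fun z : ℂ => Matrix.scalar ι z :=
  (continuous_pi fun _ => continuous_id).matrix_diagonal

theorem tendsto_charMatrix_eval {α : Type*} {F : Filter α} {f : α → ℂ} {B : α → Matrix ι ι ℂ} {z : ℂ}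
    {A : Matrix ι ι ℂ} (hf : Tendsto f F (𝓝 z)) (hB : Tendsto B F (𝓝 A)) :
    Tendsto (fun a => Matrix.scalar ι (f a) - B a) F (𝓝 (Matrix.scalar ι z - A)) :=
  ((continuous_scalar.tendsto z).comp hf).sub hB

theorem adjugate_mul_charMatrix_eval (A : Matrix ι ι ℂ) (z : ℂ) :
    (Matrix.scalar ι z - A).adjugate * (Matrix.scalar ι z - A) = A.charpoly.eval z • 1 := by
  rw [Matrix.adjugate_mul, Matrix.eval_charpoly]

theorem charMatrix_eval_mulVec {A : Matrix ι ι ℂ} {v : ι → ℂ} {μ : ℂ} (h : A *ᵥ v = μ • v) (z : ℂ) :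
    (Matrix.scalar ι z - A) *ᵥ v = (z - μ) • v := by
  rw [Matrix.sub_mulVec, h, sub_smul]
  congr 1
  ext i
  simp [Matrix.mulVec_diagonal]

theorem smul_adjugate_mulVec {A : Matrix ι ι ℂ} {v : ι → ℂ} {μ : ℂ} (h : A *ᵥ v = μ • v) (z : ℂ) :
    (z - μ) • ((Matrix.scalar ι z - A).adjugate *ᵥ v) = A.charpoly.eval z • v := by
  rw [← Matrix.mulVec_smul, ← charMatrix_eval_mulVec h, Matrix.mulVec_mulVec,
    adjugate_mul_charMatrix_eval, Matrix.smul_mulVec, Matrix.one_mulVec]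

theorem isRoot_charpoly_of_mulVec {A : Matrix ι ι ℂ} {v : ι → ℂ} {μ : ℂ} (hv : v ≠ 0)
    (h : A *ᵥ v = μ • v) : A.charpoly.IsRoot μ := by
  have := smul_adjugate_mulVec h μ
  rw [sub_self, zero_smul] at this
  exact (smul_eq_zero.1 this.symm).resolve_right hv

theorem exists_mulVec_of_isRoot_charpoly {A : Matrix ι ι ℂ} {μ : ℂ} (h : A.charpoly.IsRoot μ) :
    ∃ v : ι → ℂ, v ≠ 0 ∧ A *ᵥ v = μ • v := by
  rw [Polynomial.IsRoot, Matrix.eval_charpoly] at h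
  obtain ⟨v, hv, h⟩ := Matrix.exists_mulVec_eq_zero_iff.2 h
  refine ⟨v, hv, ?_⟩
  rw [Matrix.sub_mulVec, sub_eq_zero] at h
  rw [← h]
  ext i
  simp [Matrix.mulVec_diagonal]

/-- The adjugate of the characteristic matrix acts on eigenvectors as multiplication by the
derivative of the characteristic polynomial. -/
theorem adjugate_mulVec_eigenvector {A : Matrix ι ι ℂ} {v : ι → ℂ} {μ : ℂ} (h : A *ᵥ v = μ • v) :
    (Matrix.scalar ι μ - A).adjugate *ᵥ v = A.charpoly.derivative.eval μ • v := by
  ext i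
  have hc : Continuous fun z : ℂ => ((Matrix.scalar ι z - A).adjugate *ᵥ v) i :=
    (continuous_apply i).comp ((continuous_scalar.sub
      continuous_const).matrix_adjugate.matrix_mulVec continuous_const)
  -- Away from `μ` the adjugate applied to `v` is a difference quotient of the characteristic
  -- polynomial times `v`; continuity gives its value at `μ`.
  have e : ∀ z, A.charpoly.eval z * v i =
      (z - μ) * ((Matrix.scalar ι z - A).adjugate *ᵥ v) i := fun z =>
    (congrFun (smul_adjugate_mulVec h z) i).symm
  have h1 : HasDerivAt (fun z => A.charpoly.eval z * v i)
      (A.charpoly.derivative.eval μ * v i) μ := (A.charpoly.hasDerivAt μ).mul_const _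
  have h2 : HasDerivAt (fun z => A.charpoly.eval z * v i)
      (((Matrix.scalar ι μ - A).adjugate *ᵥ v) i) μ := by
    rw [hasDerivAt_iff_tendsto_slope]
    refine ((hc.tendsto μ).mono_left nhdsWithin_le_nhds).congr' ?_
    filter_upwards [self_mem_nhdsWithin] with z hz
    rw [slope_def_field, e z, e μ, sub_self, zero_mul, sub_zero,
      mul_div_cancel_left₀ _ (sub_ne_zero.2 hz)]
  exact h2.unique h1

theorem adjugate_mulVec_eq_zero {A : Matrix ι ι ℂ} {v : ι → ℂ} {μ z : ℂ} (h : A *ᵥ v = μ • v)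
    (hz : A.charpoly.IsRoot z) (hμ : μ ≠ z) : (Matrix.scalar ι z - A).adjugate *ᵥ v = 0 := by
  have := smul_adjugate_mulVec h z
  rw [hz.eq_zero, zero_smul] at this
  exact (smul_eq_zero.1 this).resolve_left (sub_ne_zero.2 hμ.symm)

theorem mul_adjugate_of_isRoot {A : Matrix ι ι ℂ} {z : ℂ} (hz : A.charpoly.IsRoot z) :
    A * (Matrix.scalar ι z - A).adjugate = z • (Matrix.scalar ι z - A).adjugate := by
  have := Matrix.mul_adjugate (Matrix.scalar ι z - A)
  rw [← Matrix.eval_charpoly, hz.eq_zero, zero_smul, sub_mul, sub_eq_zero] at this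
  rw [← this, Matrix.scalar_apply, ← Matrix.smul_one_eq_diagonal, smul_mul_assoc, one_mul]

theorem adjugate_mul_of_isRoot {A : Matrix ι ι ℂ} {z : ℂ} (hz : A.charpoly.IsRoot z) :
    (Matrix.scalar ι z - A).adjugate * A = z • (Matrix.scalar ι z - A).adjugate := by
  have := adjugate_mul_charMatrix_eval A z
  rw [hz.eq_zero, zero_smul, mul_sub, sub_eq_zero] at this
  rw [← this, Matrix.scalar_apply, ← Matrix.smul_one_eq_diagonal, mul_smul_comm, mul_one]

theorem matrix_ext_basis {η : Type*} (b : Module.Basis κ ℂ (ι → ℂ)) {M N : Matrix η ι ℂ}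
    (h : ∀ k, M *ᵥ b k = N *ᵥ b k) : M = N :=
  Matrix.toLin'.injective (b.ext fun k => by simpa using h k)

theorem vector_ext_basis (b : Module.Basis κ ℂ (ι → ℂ)) {v w : ι → ℂ}
    (h : ∀ k, v ⬝ᵥ b k = w ⬝ᵥ b k) : v = w := by
  have := matrix_ext_basis b (M := Matrix.of fun _ : Unit => v) (N := Matrix.of fun _ => w)
    fun k => funext fun _ => h k
  exact congrFun this ()

variable {b : Module.Basis κ ℂ (ι → ℂ)} {w : κ → ι → ℂ}

/-- The bras are only assumed dual to the kets. Testing on the basis of kets shows that they are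
left eigenvectors. -/
theorem vecMul_of_dual (hw : ∀ j k, w j ⬝ᵥ b k = 0 ↔ j ≠ k) {A : Matrix ι ι ℂ} {ev : κ → ℂ}
    (hA : ∀ k, A *ᵥ b k = ev k • b k) (j : κ) : w j ᵥ* A = ev j • w j := by
  refine vector_ext_basis b fun k => ?_
  rw [← Matrix.dotProduct_mulVec, hA, dotProduct_smul, smul_dotProduct]
  by_cases h : j = k
  · rw [h]
  · rw [(hw j k).2 h, smul_zero, smul_zero]

theorem dual_self_ne_zero (hw : ∀ j k, w j ⬝ᵥ b k = 0 ↔ j ≠ k) (k : κ) : w k ⬝ᵥ b k ≠ 0 :=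
  fun h => (hw k k).1 h rfl

/-- The projection onto a vector of a basis along the other ones. -/
def rankOne (b : Module.Basis κ ℂ (ι → ℂ)) (w : κ → ι → ℂ) (k : κ) : Matrix ι ι ℂ :=
  (w k ⬝ᵥ b k)⁻¹ • Matrix.vecMulVec (b k) (w k)

theorem rankOne_mulVec (k : κ) (v : ι → ℂ) :
    rankOne b w k *ᵥ v = ((w k ⬝ᵥ b k)⁻¹ * (w k ⬝ᵥ v)) • b k := by
  rw [rankOne, Matrix.smul_mulVec, Matrix.vecMulVec_mulVec]
  ext i
  simp
  ring

theorem rankOne_mulVec_basis (hw : ∀ j k, w j ⬝ᵥ b k = 0 ↔ j ≠ k) (j k : κ) :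
    rankOne b w j *ᵥ b k = if j = k then b k else 0 := by
  rw [rankOne_mulVec]
  split_ifs with h
  · subst h
    rw [inv_mul_cancel₀ (dual_self_ne_zero hw j), one_smul]
  · rw [(hw j k).2 h, mul_zero, zero_smul]

theorem sum_rankOne (hw : ∀ j k, w j ⬝ᵥ b k = 0 ↔ j ≠ k) : ∑ k, rankOne b w k = 1 := by
  refine matrix_ext_basis b fun k => ?_
  rw [Matrix.sum_mulVec, Matrix.one_mulVec]
  simp [rankOne_mulVec_basis hw]

theorem rankOne_mul_self (hw : ∀ j k, w j ⬝ᵥ b k = 0 ↔ j ≠ k) (k : κ) :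
    rankOne b w k * rankOne b w k = rankOne b w k := by
  refine matrix_ext_basis b fun j => ?_
  rw [← Matrix.mulVec_mulVec, rankOne_mulVec_basis hw]
  split_ifs with h
  · subst h
    rw [rankOne_mulVec_basis hw, if_pos rfl]
  · rw [Matrix.mulVec_zero]

theorem trace_mul_rankOne (k : κ) (B : Matrix ι ι ℂ) :
    Matrix.trace (B * rankOne b w k) = (w k ⬝ᵥ b k)⁻¹ * (w k ⬝ᵥ (B *ᵥ b k)) := by
  rw [rankOne, mul_smul_comm, Matrix.trace_smul, Matrix.mul_vecMulVec, Matrix.trace_vecMulVec,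
    smul_eq_mul, dotProduct_comm (B *ᵥ b k)]

theorem trace_rankOne (hw : ∀ j k, w j ⬝ᵥ b k = 0 ↔ j ≠ k) (k : κ) :
    Matrix.trace (rankOne b w k) = 1 := by
  have := trace_mul_rankOne (b := b) (w := w) k 1
  rwa [one_mul, Matrix.one_mulVec, inv_mul_cancel₀ (dual_self_ne_zero hw k)] at this

/-- This expresses the eigenprojection through quantities polynomial in the entries of `A` and in
the eigenvalue, so that it can pass to limits although the eigenvectors cannot. -/
theorem adjugate_eq_smul_rankOne (hw : ∀ j k, w j ⬝ᵥ b k = 0 ↔ j ≠ k) {A : Matrix ι ι ℂ}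
    {ev : κ → ℂ} (hA : ∀ k, A *ᵥ b k = ev k • b k) {k₀ : κ} (h₀ : ∀ k, k ≠ k₀ → ev k ≠ ev k₀) :
    (Matrix.scalar ι (ev k₀) - A).adjugate =
      A.charpoly.derivative.eval (ev k₀) • rankOne b w k₀ := by
  refine matrix_ext_basis b fun k => ?_
  rw [Matrix.smul_mulVec, rankOne_mulVec_basis hw]
  split_ifs with h
  · subst h
    exact adjugate_mulVec_eigenvector (hA _)
  · rw [smul_zero]
    exact adjugate_mulVec_eq_zero (hA k) (isRoot_charpoly_of_mulVec (b.ne_zero k₀) (hA k₀))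
      (h₀ k (Ne.symm h))

theorem exists_eq_ev_of_isRoot (hw : ∀ j k, w j ⬝ᵥ b k = 0 ↔ j ≠ k) {A : Matrix ι ι ℂ}
    {ev : κ → ℂ} (hA : ∀ k, A *ᵥ b k = ev k • b k) {z : ℂ} (hz : A.charpoly.IsRoot z) :
    ∃ k, z = ev k := by
  obtain ⟨v, hv, h⟩ := exists_mulVec_of_isRoot_charpoly hz
  by_contra! hne
  refine hv ?_
  rw [← Matrix.one_mulVec v, ← sum_rankOne hw, Matrix.sum_mulVec]
  refine Finset.sum_eq_zero fun k _ => ?_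
  have h1 : z * (w k ⬝ᵥ v) = ev k * (w k ⬝ᵥ v) := by
    rw [← smul_eq_mul, ← dotProduct_smul, ← h, Matrix.dotProduct_mulVec, vecMul_of_dual hw hA,
      smul_dotProduct, smul_eq_mul]
  have h2 : w k ⬝ᵥ v = 0 := by
    by_contra h3
    exact hne k (mul_right_cancel₀ h3 h1)
  rw [rankOne_mulVec, h2, mul_zero, zero_smul]

end Eigenprojection

/-! ### Continuity of the dominant eigenvalue -/

section Continuity

variable {ι : Type} [Fintype ι] [DecidableEq ι]

theorem norm_le_of_isRoot_charpoly {A : Matrix ι ι ℂ} {μ : ℂ} (h : A.charpoly.IsRoot μ) :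
    ‖μ‖ ≤ ∑ i, ∑ j, ‖A i j‖ := by
  obtain ⟨v, hv, h⟩ := exists_mulVec_of_isRoot_charpoly h
  have h1 : ‖μ • v‖ ≤ (∑ i, ∑ j, ‖A i j‖) * ‖v‖ := by
    rw [← h]
    refine (pi_norm_le_iff_of_nonneg (by positivity)).2 fun i => ?_
    calc ‖(A *ᵥ v) i‖ ≤ ∑ j, ‖A i j * v j‖ := norm_sum_le _ _
      _ ≤ ∑ j, ‖A i j‖ * ‖v‖ := by
        refine Finset.sum_le_sum fun j _ => ?_
        rw [norm_mul]
        exact mul_le_mul_of_nonneg_left (norm_le_pi_norm v j) (norm_nonneg _)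
      _ = (∑ j, ‖A i j‖) * ‖v‖ := (Finset.sum_mul _ _ _).symm
      _ ≤ _ := mul_le_mul_of_nonneg_right (Finset.single_le_sum (f := fun i => ∑ j, ‖A i j‖)
        (fun i _ => by positivity) (Finset.mem_univ i)) (norm_nonneg _)
  rw [norm_smul] at h1
  exact le_of_mul_le_mul_right h1 (norm_pos_iff.2 hv)

/-- Used in contraposition: a small value of the characteristic polynomial at `z` forces an
eigenvalue near `z`. -/
theorem pow_card_le_norm_charpoly {A : Matrix ι ι ℂ} {z : ℂ} {δ : ℝ} (hδ : 0 ≤ δ)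
    (h : ∀ μ ∈ A.charpoly.roots, δ ≤ ‖z - μ‖) : δ ^ Fintype.card ι ≤ ‖A.charpoly.eval z‖ := by
  have hs := IsAlgClosed.splits A.charpoly
  have hc : A.charpoly.roots.card = Fintype.card ι := by
    rw [IsAlgClosed.card_roots_eq_natDegree, Matrix.charpoly_natDegree_eq_dim]
  rw [hs.eval_eq_prod_roots_of_monic A.charpoly_monic, ← hc]
  generalize A.charpoly.roots = s at h
  induction s using Multiset.induction_on with
  | empty => simp
  | cons a s ih =>
    rw [Multiset.card_cons, pow_succ', Multiset.map_cons, Multiset.prod_cons, norm_mul]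
    exact mul_le_mul (h a (Multiset.mem_cons_self a s))
      (ih fun μ hμ => h μ (Multiset.mem_cons_of_mem hμ)) (pow_nonneg hδ _) (norm_nonneg _)

theorem mem_roots_charpoly {A : Matrix ι ι ℂ} {z : ℂ} :
    z ∈ A.charpoly.roots ↔ A.charpoly.IsRoot z := by
  rw [Polynomial.mem_roots A.charpoly_monic.ne_zero]

/-- The `μ a` are bounded, and any cluster point is an eigenvalue of `A`. As `B a` has eigenvalues
near `Λ`, none larger in modulus than `μ a`, the cluster point has modulus at least `‖Λ‖`, hence
equals `Λ`. Ultrafilters supply the cluster points along an arbitrary filter. -/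
theorem tendsto_dominant_eigenvalue {α : Type*} {F : Filter α} {A : Matrix ι ι ℂ}
    {B : α → Matrix ι ι ℂ} (hB : Tendsto B F (𝓝 A)) {Λ : ℂ} (hΛ : A.charpoly.IsRoot Λ)
    (hdom : ∀ μ ∈ A.charpoly.roots, μ ≠ Λ → ‖μ‖ < ‖Λ‖) {μ : α → ℂ}
    (hμ : ∀ᶠ a in F, (B a).charpoly.IsRoot (μ a))
    (hμdom : ∀ᶠ a in F, ∀ z ∈ (B a).charpoly.roots, ‖z‖ ≤ ‖μ a‖) : Tendsto μ F (𝓝 Λ) := by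
  rw [tendsto_iff_ultrafilter]
  intro V hV
  have hB' := hB.mono_left hV
  have hdet : ∀ {f : α → ℂ} {z : ℂ}, Tendsto f V (𝓝 z) →
      Tendsto (fun a => (B a).charpoly.eval (f a)) V (𝓝 (A.charpoly.eval z)) := by
    intro f z hf
    simp only [Matrix.eval_charpoly]
    exact Tendsto.comp (g := Matrix.det) (continuous_id.matrix_det.tendsto _)
      (tendsto_charMatrix_eval hf hB')
  have hsum : Tendsto (fun a => ∑ i, ∑ j, ‖B a i j‖) V (𝓝 (∑ i, ∑ j, ‖A i j‖)) :=
    tendsto_finsetSum _ fun i _ => tendsto_finsetSum _ fun j _ =>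
      (((continuous_id.matrix_elem i j).tendsto A).comp hB').norm
  have hbd : ∀ᶠ a in V, μ a ∈ Metric.closedBall (0 : ℂ) ((∑ i, ∑ j, ‖A i j‖) + 1) := by
    filter_upwards [hV hμ, hsum.eventually_le_const (lt_add_one _)] with a h1 h2
    rw [mem_closedBall_zero_iff]
    exact (norm_le_of_isRoot_charpoly h1).trans h2
  obtain ⟨z, -, hz⟩ := (isCompact_closedBall (0 : ℂ) _).ultrafilter_le_nhds' (V.map μ) hbd
  have hz' : Tendsto μ V (𝓝 z) := hz
  have hroot : A.charpoly.IsRoot z := by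
    refine tendsto_nhds_unique (hdet hz') ?_
    refine (tendsto_const_nhds (x := (0 : ℂ))).congr' ?_
    filter_upwards [hV hμ] with a ha
    exact ha.symm
  have hle : ‖Λ‖ ≤ ‖z‖ := by
    refine le_of_forall_pos_sub_le fun δ hδ => ?_
    refine ge_of_tendsto hz'.norm ?_
    have h0 := (hdet (tendsto_const_nhds (x := Λ))).norm
    rw [hΛ.eq_zero, norm_zero] at h0
    filter_upwards [hV hμdom, h0.eventually_lt_const (pow_pos hδ (Fintype.card ι))] with a h1 h2
    obtain ⟨r, hr, hr'⟩ : ∃ r ∈ (B a).charpoly.roots, ‖Λ - r‖ < δ := by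
      by_contra! h3
      exact absurd (pow_card_le_norm_charpoly hδ.le h3) (not_le.2 h2)
    have h4 := h1 r hr
    have h5 := norm_sub_norm_le Λ r
    linarith
  have : z = Λ := by
    by_contra h
    exact absurd (hdom z (mem_roots_charpoly.2 hroot) h) (not_lt.2 hle)
  rwa [← this]

end Continuity

/-! ### Powers of a matrix with a dominant eigenvalue -/

section Powers

variable {ι : Type} [Fintype ι] [DecidableEq ι]

/-- By Gelfand's formula the norms of the powers are eventually below a geometric sequence with
ratio less than 1. -/
theorem tendsto_pow_zero_of_spectrum {R : Type*} [NormedRing R] [NormedAlgebra ℂ R]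
    [CompleteSpace R] [Nontrivial R] {a : R} (h : ∀ μ ∈ spectrum ℂ a, ‖μ‖ < 1) :
    Tendsto (fun l : ℕ => a ^ l) atTop (𝓝 0) := by
  have hr : spectralRadius ℂ a < ((1 : NNReal) : ENNReal) :=
    spectrum.spectralRadius_lt_of_forall_lt a fun μ hμ => by
      rw [← NNReal.coe_lt_coe]; simpa using h μ hμ
  obtain ⟨r, hr1, hr2⟩ := ENNReal.lt_iff_exists_nnreal_btwn.1 hr
  have hr3 : (r : ℝ) < 1 := by exact_mod_cast hr2
  have hg := (spectrum.pow_nnnorm_pow_one_div_tendsto_nhds_spectralRadius a).eventually_lt_const hr1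
  refine squeeze_zero_norm' (a := fun l => (r : ℝ) ^ l) ?_
    (tendsto_pow_atTop_nhds_zero_of_lt_one r.2 hr3)
  filter_upwards [hg, eventually_gt_atTop 0] with l hl hl0
  have h1 : (‖a ^ l‖₊ : ENNReal) < (r : ENNReal) ^ l := by
    have := ENNReal.rpow_lt_rpow hl (by positivity : (0 : ℝ) < l)
    rwa [← ENNReal.rpow_mul, one_div, inv_mul_cancel₀ (by positivity), ENNReal.rpow_one,
      ENNReal.rpow_natCast] at this
  have h2 : ‖a ^ l‖₊ < r ^ l := by exact_mod_cast h1
  exact_mod_cast h2.le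

theorem matrix_tendsto_pow_zero_of_spectrum {B : Matrix ι ι ℂ}
    (h : ∀ (μ : ℂ) (v : ι → ℂ), v ≠ 0 → B *ᵥ v = μ • v → ‖μ‖ < 1) :
    Tendsto (fun l : ℕ => B ^ l) atTop (𝓝 0) := by
  rcases isEmpty_or_nonempty ι with hι | hι
  · exact tendsto_const_nhds.congr fun _ => Subsingleton.elim _ _
  let := Matrix.linftyOpNormedRing (n := ι) (α := ℂ)
  let := Matrix.linftyOpNormedAlgebra (R := ℂ) (n := ι) (α := ℂ)
  refine tendsto_pow_zero_of_spectrum (a := B) fun μ hμ => ?_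
  obtain ⟨v, hv, hB⟩ := exists_mulVec_of_isRoot_charpoly
    (Matrix.mem_spectrum_iff_isRoot_charpoly.1 hμ)
  exact h μ v hv hB

theorem tendsto_smul_pow_projection {A P : Matrix ι ι ℂ} {Λ : ℂ} (hΛ : Λ ≠ 0) (hP : P * P = P)
    (hAP : A * P = Λ • P) (hPA : P * A = Λ • P) (hfix : ∀ v, A *ᵥ v = Λ • v → P *ᵥ v = v)
    (hdom : ∀ μ ∈ A.charpoly.roots, μ ≠ Λ → ‖μ‖ < ‖Λ‖) :
    Tendsto (fun l : ℕ => Λ⁻¹ ^ l • A ^ l) atTop (𝓝 P) := by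
  set B := Λ⁻¹ • A with hB
  have hBP : B * P = P := by rw [hB, smul_mul_assoc, hAP, inv_smul_smul₀ hΛ]
  have hPB : P * B = P := by rw [hB, mul_smul_comm, hPA, inv_smul_smul₀ hΛ]
  -- The decomposition starts at the first power; at exponent 0 it would force `P = 0`.
  have hpow : ∀ l : ℕ, B ^ (l + 1) = P + (B - P) ^ (l + 1) := by
    intro l
    induction l with
    | zero => simp
    | succ l ih =>
      have e1 : P * (B - P) ^ (l + 1) = 0 := by
        rw [pow_succ', ← mul_assoc, mul_sub, hPB, hP, sub_self, zero_mul]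
      rw [pow_succ', ih, pow_succ' _ (l + 1), sub_mul, e1, sub_zero, mul_add, hBP]
  -- An eigenvector of `B - P` with nonzero eigenvalue is killed by `P`, hence is an eigenvector of
  -- `A`; by `hfix` its eigenvalue is not `Λ`, so dominance applies.
  have hz : Tendsto (fun l : ℕ => (B - P) ^ l) atTop (𝓝 0) := by
    refine matrix_tendsto_pow_zero_of_spectrum fun μ v hv h => ?_
    rcases eq_or_ne μ 0 with rfl | hμ
    · simp
    have h0 : P *ᵥ v = 0 := by
      have : μ • (P *ᵥ v) = 0 := by
        rw [← Matrix.mulVec_smul, ← h, Matrix.mulVec_mulVec, mul_sub, hPB, hP, sub_self,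
          Matrix.zero_mulVec]
      exact (smul_eq_zero.1 this).resolve_left hμ
    have hA : A *ᵥ v = (Λ * μ) • v := by
      rw [Matrix.sub_mulVec, h0, sub_zero, hB, Matrix.smul_mulVec] at h
      rw [mul_smul, ← h, smul_inv_smul₀ hΛ]
    have hne : Λ * μ ≠ Λ := by
      intro he
      rw [he] at hA
      exact hv ((hfix v hA).symm.trans h0)
    have := hdom _ (mem_roots_charpoly.2 (isRoot_charpoly_of_mulVec hv hA)) hne
    rw [norm_mul] at this
    exact (mul_lt_iff_lt_one_right (norm_pos_iff.2 hΛ)).1 this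
  refine (tendsto_add_atTop_iff_nat 1).1 ?_
  have := (((tendsto_add_atTop_iff_nat 1).2 hz).const_add P)
  rw [add_zero] at this
  refine this.congr fun l => ?_
  rw [← hpow, hB, smul_pow]

/-- The ratio of traces that belongs to an infinite chain. -/
theorem tendsto_trace_mul_pow_div {A P : Matrix ι ι ℂ} {Λ : ℂ} (hΛ : Λ ≠ 0)
    (h : Tendsto (fun l : ℕ => Λ⁻¹ ^ l • A ^ l) atTop (𝓝 P)) (hP : Matrix.trace P = 1)
    (B : Matrix ι ι ℂ) (m : ℕ) :
    Tendsto (fun l : ℕ => Matrix.trace (B * A ^ l) / Matrix.trace (A ^ (l + m + 1))) atTop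
      (𝓝 (Matrix.trace (B * P) / Λ ^ (m + 1))) := by
  have htr : Continuous fun M : Matrix ι ι ℂ => Matrix.trace M := continuous_id.matrix_trace
  have h1 := (htr.tendsto _).comp (h.const_mul B)
  have h2 := (htr.tendsto _).comp ((tendsto_add_atTop_iff_nat (m + 1)).2 h)
  rw [hP] at h2
  have h3 := (h1.div h2 one_ne_zero).div_const (Λ ^ (m + 1))
  rw [div_one] at h3
  refine h3.congr fun l => ?_
  have e : (Λ⁻¹ ^ l) ≠ 0 := pow_ne_zero _ (inv_ne_zero hΛ)
  simp only [Pi.div_apply, Function.comp_apply, mul_smul_comm, Matrix.trace_smul, smul_eq_mul]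
  rw [pow_add Λ⁻¹, mul_assoc, mul_div_mul_left _ _ e, div_div, mul_comm (Λ⁻¹ ^ (m + 1)), mul_assoc,
    ← mul_pow, inv_mul_cancel₀ hΛ, one_pow, mul_one, add_assoc]

end Powers

/-! ### Convergence of the dominant eigenprojections -/

section Projections

variable {ι κ : Type} [Fintype ι] [DecidableEq ι] [Fintype κ] [DecidableEq κ]

/-- Properties of the limit of the projections onto the dominant eigenvectors of a convergent
family of diagonalizable matrices. -/
theorem exists_tendsto_rankOne {α : Type*} {F : Filter α} [F.NeBot] {A : Matrix ι ι ℂ}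
    {B : α → Matrix ι ι ℂ} (hB : Tendsto B F (𝓝 A)) {Λ : ℂ}
    (hmult : A.charpoly.rootMultiplicity Λ = 1)
    (hdom : ∀ μ ∈ A.charpoly.roots, μ ≠ Λ → ‖μ‖ < ‖Λ‖)
    {b : α → Module.Basis κ ℂ (ι → ℂ)} {w : α → κ → ι → ℂ} {ev : α → κ → ℂ} {k : α → κ}
    (hE : ∀ᶠ a in F, (∀ i j, w a i ⬝ᵥ b a j = 0 ↔ i ≠ j) ∧
      (∀ j, B a *ᵥ b a j = ev a j • b a j) ∧ ∀ j, j ≠ k a → ‖ev a j‖ < ‖ev a (k a)‖) :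
    Tendsto (fun a => ev a (k a)) F (𝓝 Λ) ∧ ∃ P : Matrix ι ι ℂ,
      Tendsto (fun a => rankOne (b a) (w a) (k a)) F (𝓝 P) ∧ Matrix.trace P = 1 ∧ P * P = P ∧
      A * P = Λ • P ∧ P * A = Λ • P ∧ ∀ v, A *ᵥ v = Λ • v → P *ᵥ v = v := by
  have hroot : A.charpoly.IsRoot Λ := by
    rw [← Polynomial.rootMultiplicity_pos A.charpoly_monic.ne_zero, hmult]
    exact one_pos
  have hder : A.charpoly.derivative.eval Λ ≠ 0 := by
    intro h
    have := (Polynomial.one_lt_rootMultiplicity_iff_isRoot A.charpoly_monic.ne_zero).2 ⟨hroot, h⟩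
    omega
  have hlim : Tendsto (fun a => ev a (k a)) F (𝓝 Λ) := by
    refine tendsto_dominant_eigenvalue hB hroot hdom ?_ ?_
    · filter_upwards [hE] with a ha
      exact isRoot_charpoly_of_mulVec ((b a).ne_zero _) (ha.2.1 _)
    · filter_upwards [hE] with a ha z hz
      obtain ⟨j, rfl⟩ := exists_eq_ev_of_isRoot ha.1 ha.2.1 (mem_roots_charpoly.1 hz)
      by_cases h : j = k a
      · rw [h]
      · exact (ha.2.2 j h).le
  -- `A` may fail to be diagonalizable, so the limit is constructed from adjugates. The unknown
  -- coefficient is recovered as a trace, since the projections have trace 1.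
  set J := (Matrix.scalar ι Λ - A).adjugate with hJ
  have hadj : Tendsto (fun a => (Matrix.scalar ι (ev a (k a)) - B a).adjugate) F (𝓝 J) :=
    Tendsto.comp (g := Matrix.adjugate) (continuous_id.matrix_adjugate.tendsto _)
      (tendsto_charMatrix_eval hlim hB)
  have heq : ∀ᶠ a in F, (Matrix.scalar ι (ev a (k a)) - B a).adjugate =
      (B a).charpoly.derivative.eval (ev a (k a)) • rankOne (b a) (w a) (k a) := by
    filter_upwards [hE] with a ha
    exact adjugate_eq_smul_rankOne ha.1 ha.2.1 fun j hj h => (ha.2.2 j hj).ne (by rw [h])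
  set c := Matrix.trace J with hc
  have htr : Continuous fun M : Matrix ι ι ℂ => Matrix.trace M := continuous_id.matrix_trace
  have hcoef : Tendsto (fun a => (B a).charpoly.derivative.eval (ev a (k a))) F (𝓝 c) := by
    refine ((htr.tendsto J).comp hadj).congr' ?_
    filter_upwards [hE, heq] with a ha h
    rw [Function.comp_apply, h, Matrix.trace_smul, trace_rankOne ha.1, smul_eq_mul, mul_one]
  have hJJ : J * J = c • J := by
    refine tendsto_nhds_unique (hadj.mul hadj) ((hcoef.smul hadj).congr' ?_)
    filter_upwards [hE, heq] with a ha h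
    rw [h, smul_mul_smul_comm, rankOne_mul_self ha.1, mul_smul]
  -- `J * J = c • J` applied to an eigenvector identifies `c` with the derivative of the
  -- characteristic polynomial, nonzero because the root is simple; this permits dividing by `c`.
  obtain ⟨v, hv, hAv⟩ := exists_mulVec_of_isRoot_charpoly hroot
  have hfix : ∀ v, A *ᵥ v = Λ • v → J *ᵥ v = A.charpoly.derivative.eval Λ • v :=
    fun v h => adjugate_mulVec_eigenvector h
  have hcd : c = A.charpoly.derivative.eval Λ := by
    have h1 := congrArg (· *ᵥ v) hJJ
    simp only [← Matrix.mulVec_mulVec, Matrix.smul_mulVec, hfix v hAv, Matrix.mulVec_smul] at h1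
    have h2 := smul_left_injective ℂ hv (by simpa only [smul_smul] using h1)
    exact (mul_right_cancel₀ hder h2).symm
  have hc0 : c ≠ 0 := hcd ▸ hder
  refine ⟨hlim, c⁻¹ • J, ?_, ?_, ?_, ?_, ?_, ?_⟩
  · refine ((hcoef.inv₀ hc0).smul hadj).congr' ?_
    filter_upwards [heq, hcoef.eventually_ne hc0] with a h h0
    rw [h, inv_smul_smul₀ h0]
  · rw [Matrix.trace_smul, smul_eq_mul, ← hc, inv_mul_cancel₀ hc0]
  · rw [smul_mul_smul_comm, hJJ, smul_smul, mul_assoc, inv_mul_cancel₀ hc0, mul_one]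
  · rw [mul_smul_comm, mul_adjugate_of_isRoot hroot, smul_comm]
  · rw [smul_mul_assoc, adjugate_mul_of_isRoot hroot, smul_comm]
  · intro v h
    rw [Matrix.smul_mulVec, hfix v h, ← hcd, inv_smul_smul₀ hc0]

end Projections

/-! ### Removing the regularization -/

section Regularization

variable {d : ℕ} {Mo : LatticeModel d} {U : Set ℂ} {α : Type*} {F : Filter α}

theorem matrix_tendsto {ι κ : Type*} {R : Type*} [TopologicalSpace R] {A : α → Matrix ι κ R}
    {B : Matrix ι κ R} (h : ∀ i j, Tendsto (fun a => A a i j) F (𝓝 (B i j))) :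
    Tendsto A F (𝓝 B) :=
  tendsto_pi_nhds.2 fun i => tendsto_pi_nhds.2 fun j => h i j

theorem matrix_tendsto_apply {ι κ : Type*} {R : Type*} [TopologicalSpace R]
    {A : α → Matrix ι κ R} {B : Matrix ι κ R} (h : Tendsto A F (𝓝 B)) (i : ι) (j : κ) :
    Tendsto (fun a => A a i j) F (𝓝 (B i j)) :=
  tendsto_pi_nhds.1 (tendsto_pi_nhds.1 h i) j

theorem tendsto_auxSite {S : Type} [Fintype S] [DecidableEq S] {A : α → TwoOp d} {B : TwoOp d}
    (h : Tendsto A F (𝓝 B)) (j : S) : Tendsto (fun a => auxSite (A a) j) F (𝓝 (auxSite B j)) := by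
  refine matrix_tendsto fun p q => matrix_tendsto fun σ τ => ?_
  simp only [auxSite, siteOp, Matrix.of_apply]
  split_ifs
  · exact matrix_tendsto_apply h _ _
  · exact tendsto_const_nhds

theorem tendsto_twistTrace {S : Type} [Fintype S] [DecidableEq S] (z : Matrix (Fin d) (Fin d) ℂ)
    {A : α → S → TwoOp d} {B : S → TwoOp d} (h : ∀ k, Tendsto (fun a => A a k) F (𝓝 (B k)))
    (l : List S) : Tendsto (fun a => twistTrace z (A a) l) F (𝓝 (twistTrace z B l)) := by
  have h1 : Tendsto (fun a => colProd (A a) l) F (𝓝 (colProd B l)) :=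
    tendsto_list_prod l fun k _ => tendsto_auxSite (h k) k
  have htr : Continuous fun M : AuxOp d S => Matrix.trace M := continuous_id.matrix_trace
  exact (htr.tendsto _).comp (h1.const_mul _)

theorem tendsto_R (hMo : Mo.IsFundamental U) {f g : α → ℂ} {u v : ℂ} (hf : Tendsto f F (𝓝 u))
    (hg : Tendsto g F (𝓝 v)) (hu : u ∈ U) (hv : v ∈ U) :
    Tendsto (fun a => Mo.R (f a) (g a)) F (𝓝 (Mo.R u v)) :=
  matrix_tendsto fun p q => Tendsto.comp (g := fun z : ℂ × ℂ => Mo.R z.1 z.2 p q)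
    (differentiableAt_R hMo (z := (u, v)) hu hv p q).continuousAt.tendsto (hf.prodMk_nhds hg)

theorem tendsto_colOp (hMo : Mo.IsFundamental U) {M : ℕ} {f : α → ℂ} {ν : α → Fin M → ℂ} {u : ℂ}
    {ν₀ : Fin M → ℂ} (hf : Tendsto f F (𝓝 u)) (hu : u ∈ U)
    (hν : ∀ k, Tendsto (fun a => ν a k) F (𝓝 (ν₀ k))) (hν₀ : ∀ k, ν₀ k ∈ U) (k : Fin M) :
    Tendsto (fun a => Mo.colOp (ν a) (f a) k) F (𝓝 (Mo.colOp ν₀ u k)) := by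
  unfold LatticeModel.colOp
  split_ifs
  · exact tendsto_R hMo hf (hν k) hu (hν₀ k)
  · exact matrix_tendsto fun p q => matrix_tendsto_apply (tendsto_R hMo (hν k) hf (hν₀ k) hu) _ _

theorem tendsto_inhomogeneity (T t : ℝ) (n : ℕ) (k : Fin (2 * (2 * n) + 2)) :
    Tendsto (fun ε => Mo.inhomogeneity T t n ε k) (𝓝 0) (𝓝 (Mo.inhomogeneity T t n 0 k)) := by
  refine Continuous.tendsto (f := fun ε => Mo.inhomogeneity T t n ε k) ?_ 0
  simp only [LatticeModel.inhomogeneity]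
  split_ifs <;> fun_prop

theorem tendsto_dynEntry (hMo : Mo.IsFundamental U) (T t : ℝ) (n : ℕ)
    (hν : ∀ k, Mo.inhomogeneity T t n 0 k ∈ U) (z : Matrix (Fin d) (Fin d) ℂ) {f : ℂ → ℂ}
    (hf : Tendsto f (𝓝 0) (𝓝 0)) :
    Tendsto (fun ε => Mo.dynEntry T t n ε z (f ε)) (𝓝 0) (𝓝 (Mo.dynEntry T t n 0 z 0)) := by
  simp only [← twistTrace_colOp_eq_dynEntry]
  exact tendsto_twistTrace _
    (tendsto_colOp hMo hf hMo.zero_mem (tendsto_inhomogeneity T t n) hν) _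

theorem tendsto_dynQtm (hMo : Mo.IsFundamental U) (T t : ℝ) (n : ℕ)
    (hν : ∀ k, Mo.inhomogeneity T t n 0 k ∈ U) {f : ℂ → ℂ} (hf : Tendsto f (𝓝 0) (𝓝 0)) :
    Tendsto (fun ε => Mo.dynQtm T t n ε (f ε)) (𝓝 0) (𝓝 (Mo.dynQtm T t n 0 0)) := by
  simp only [← twistTrace_colOp_eq_dynQtm]
  exact tendsto_twistTrace _
    (tendsto_colOp hMo hf hMo.zero_mem (tendsto_inhomogeneity T t n) hν) _

end Regularization

/-! ### The form-factor series -/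

section FormFactors

variable {d : ℕ} {Mo : LatticeModel d} {U : Set ℂ}

theorem inv_mulVec_of_mulVec {ι : Type*} [Fintype ι] [DecidableEq ι] {A : Matrix ι ι ℂ}
    (hA : IsUnit A) {v : ι → ℂ} {μ : ℂ} (hμ : μ ≠ 0) (h : A *ᵥ v = μ • v) : A⁻¹ *ᵥ v = μ⁻¹ • v := by
  have hd := (Matrix.isUnit_iff_isUnit_det _).1 hA
  have h1 : A⁻¹ *ᵥ (A *ᵥ v) = v := by
    rw [Matrix.mulVec_mulVec, Matrix.nonsing_inv_mul _ hd, Matrix.one_mulVec]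
  rw [h, Matrix.mulVec_smul] at h1
  rw [eq_inv_smul_iff₀ hμ, h1]

theorem pow_mulVec_of_mulVec {ι : Type*} [Fintype ι] [DecidableEq ι] {A : Matrix ι ι ℂ}
    {v : ι → ℂ} {μ : ℂ} (h : A *ᵥ v = μ • v) (n : ℕ) : (A ^ n) *ᵥ v = μ ^ n • v := by
  induction n with
  | zero => simp
  | succ n ih => rw [pow_succ, ← Matrix.mulVec_mulVec, h, Matrix.mulVec_smul, ih, smul_smul, pow_succ']

theorem ne_zero_of_isUnit_of_mulVec {ι : Type*} [Fintype ι] [DecidableEq ι] {A : Matrix ι ι ℂ}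
    (hA : IsUnit A) {v : ι → ℂ} {μ : ℂ} (hv : v ≠ 0) (h : A *ᵥ v = μ • v) : μ ≠ 0 := by
  rintro rfl
  have hd := (Matrix.isUnit_iff_isUnit_det _).1 hA
  refine hv ?_
  rw [← Matrix.one_mulVec v, ← Matrix.nonsing_inv_mul _ hd, ← Matrix.mulVec_mulVec, h, zero_smul,
    Matrix.mulVec_zero]

/-- The form-factor series in terms of the projection onto the dominant state. -/
theorem formFactorSeries_eq (hMo : Mo.IsFundamental U) (T t : ℝ) (n : ℕ) {ε : ℂ}
    (hν : ∀ k, Mo.inhomogeneity T t n ε k ∈ U) (hε : ε ∈ U) (hτ : Mo.tR t / (2 * n : ℕ) ∈ U)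
    (hτ' : -(Mo.tR t / (2 * n : ℕ)) ∈ U) (x y : Matrix (Fin d) (Fin d) ℂ) (s : ℂ) (m : ℕ)
    (h₀ : IsUnit (Mo.dynQtm T t n ε ε)) (h₁ : IsUnit (Mo.dynQtm T t n ε (Mo.tR t / (2 * n : ℕ))))
    (h₂ : IsUnit (Mo.dynQtm T t n ε (-(Mo.tR t / (2 * n : ℕ)))))
    {E : StateData d (2 * (2 * n) + 2)} (hE : E.IsEigenbasis U (Mo.dynQtm T t n ε)) :
    Mo.formFactorSeries T t x y s m n ε E = Complex.exp (Complex.I * t * Mo.alpha * s) *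
      (Matrix.trace (siteOp (midSite n) x * Mo.dynQtm T t n ε 0 ^ m * Mo.dynEntry T t n ε y ε *
        rankOne E.ket E.bra E.dom) / (E.ev E.dom ε * E.ev E.dom 0 ^ m)) := by
  set τ := Mo.tR t / (2 * n : ℕ) with hτdef
  set D := (Mo.dynQtm T t n ε τ)⁻¹ * Mo.dynQtm T t n ε (-τ) with hD
  have hne : ∀ {u : ℂ}, u ∈ U → IsUnit (Mo.dynQtm T t n ε u) → ∀ k, E.ev k u ≠ 0 :=
    fun hu h k => ne_zero_of_isUnit_of_mulVec h (E.ket.ne_zero k) (hE.eigen k _ hu)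
  have e₀ := hne hε h₀
  have e₁ := hne hτ h₁
  have e₂ := hne hτ' h₂
  have hself := dual_self_ne_zero hE.dual
  have hDk : ∀ k, D *ᵥ E.ket k = (E.ev k (-τ) / E.ev k τ) • E.ket k := by
    intro k
    rw [hD, ← Matrix.mulVec_mulVec, hE.eigen k _ hτ', Matrix.mulVec_smul,
      inv_mulVec_of_mulVec h₁ (e₁ k) (hE.eigen k _ hτ), smul_smul, div_eq_mul_inv]
  have hDn : ∀ k, (D ^ n) *ᵥ E.ket k = (E.ev k (-τ) / E.ev k τ) ^ n • E.ket k :=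
    fun k => pow_mulVec_of_mulVec (hDk k) n
  have hbra := vecMul_of_dual hE.dual hDn
  have hinv := siteOp_midSite_mul_pow hMo T t n hν hε hτ hτ' x h₀ h₁
  rw [← hτdef, ← hD] at hinv
  -- In the inverse problem taken between `Ψ_0` and `Ψ_k`, the power of `D` acts on the bra on one
  -- side and on the ket on the other.
  have helem : ∀ k, (E.ev E.dom (-τ) / E.ev E.dom τ) ^ n *
      (E.elem E.dom (Mo.dynEntry T t n ε x ε) k * (E.ev k ε)⁻¹) =
      (E.ev k (-τ) / E.ev k τ) ^ n * E.elem E.dom (siteOp (midSite n) x) k := by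
    intro k
    have h1 := congrArg (fun M => E.bra E.dom ⬝ᵥ (M *ᵥ E.ket k)) hinv
    simp only [← Matrix.mulVec_mulVec, hDn, inv_mulVec_of_mulVec h₀ (e₀ k) (hE.eigen k _ hε),
      Matrix.mulVec_smul, Matrix.dotProduct_mulVec, hbra, Matrix.smul_vecMul, dotProduct_smul,
      smul_dotProduct, smul_eq_mul] at h1
    simp only [StateData.elem, Matrix.dotProduct_mulVec]
    rw [mul_comm _ (E.ev k ε)⁻¹]
    linear_combination h1
  have hpow : ∀ k, (Mo.dynQtm T t n ε 0 ^ m) *ᵥ E.ket k = E.ev k 0 ^ m • E.ket k :=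
    fun k => pow_mulVec_of_mulVec (hE.eigen k 0 hMo.zero_mem) m
  have hsum : E.elem E.dom (siteOp (midSite n) x * Mo.dynQtm T t n ε 0 ^ m *
      Mo.dynEntry T t n ε y ε) E.dom = ∑ k, E.ev k 0 ^ m *
        E.elem E.dom (siteOp (midSite n) x) k * E.elem k (Mo.dynEntry T t n ε y ε) E.dom /
          E.elem k 1 k := by
    -- Resolution of the identity by the dual basis, placed directly in front of `Y`.
    have h1 : Mo.dynEntry T t n ε y ε *ᵥ E.ket E.dom = ∑ k, ((E.bra k ⬝ᵥ E.ket k)⁻¹ *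
        (E.bra k ⬝ᵥ (Mo.dynEntry T t n ε y ε *ᵥ E.ket E.dom))) • E.ket k := by
      simp only [← rankOne_mulVec]
      rw [← Matrix.sum_mulVec, sum_rankOne hE.dual, Matrix.one_mulVec]
    rw [StateData.elem, ← Matrix.mulVec_mulVec, h1, Matrix.mulVec_sum, dotProduct_sum]
    refine Finset.sum_congr rfl fun k _ => ?_
    rw [Matrix.mulVec_smul, ← Matrix.mulVec_mulVec, hpow, Matrix.mulVec_smul, dotProduct_smul,
      dotProduct_smul]
    simp only [StateData.elem, Matrix.one_mulVec, smul_eq_mul]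
    ring
  rw [LatticeModel.formFactorSeries, trace_mul_rankOne]
  change _ * _ = _ * (_ * E.elem E.dom _ E.dom / _)
  rw [hsum, ← hτdef]
  refine congrArg (Complex.exp (Complex.I * t * Mo.alpha * s) * ·) ?_
  rw [Finset.mul_sum, Finset.sum_div]
  refine Finset.sum_congr rfl fun k _ => ?_
  have h1 : E.ev k τ * E.ev E.dom (-τ) / (E.ev E.dom τ * E.ev k (-τ)) =
      (E.ev E.dom (-τ) / E.ev E.dom τ) / (E.ev k (-τ) / E.ev k τ) := by
    rw [div_div_div_eq, mul_comm (E.ev k τ)]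
  have h2 : E.elem E.dom (siteOp (midSite n) x) k =
      E.elem E.dom (Mo.dynEntry T t n ε x ε) k * (E.ev k ε)⁻¹ *
        ((E.ev E.dom (-τ) / E.ev E.dom τ) / (E.ev k (-τ) / E.ev k τ)) ^ n := by
    rw [div_pow, mul_div_assoc', eq_div_iff (pow_ne_zero _ (div_ne_zero (e₂ k) (e₁ k)))]
    linear_combination -(helem k)
  have h3 : E.elem E.dom 1 E.dom = E.bra E.dom ⬝ᵥ E.ket E.dom := by
    rw [StateData.elem, Matrix.one_mulVec]
  rw [h1, h2, h3]
  ring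

end FormFactors

/-! ### The limits of infinite chain length and of vanishing regularization -/

section Main

variable {d : ℕ} {Mo : LatticeModel d} {U : Set ℂ}

/-- If the dominant eigenvalue were 0, all eigenvalues would be 0; by Cayley-Hamilton the matrix
would be nilpotent, and its powers traceless. -/
theorem dominant_ne_zero {ι : Type} [Fintype ι] [DecidableEq ι] {A : Matrix ι ι ℂ} {Λ : ℂ}
    (hdom : ∀ μ ∈ A.charpoly.roots, μ ≠ Λ → ‖μ‖ < ‖Λ‖) {L : ℕ} (hL : L ≠ 0)
    (h : Matrix.trace (A ^ L) ≠ 0) : Λ ≠ 0 := by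
  rintro rfl
  have h1 : A.charpoly.roots = Multiset.replicate A.charpoly.roots.card 0 := by
    refine Multiset.eq_replicate_card.2 fun μ hμ => ?_
    by_contra h0
    have := hdom μ hμ h0
    rw [norm_zero] at this
    exact absurd this (not_lt.2 (norm_nonneg _))
  have h2 : A.charpoly = Polynomial.X ^ A.charpoly.roots.card := by
    have := (IsAlgClosed.splits A.charpoly).eq_prod_roots_of_monic A.charpoly_monic
    rw [h1, Multiset.map_replicate, Multiset.prod_replicate, Polynomial.C_0, sub_zero] at this
    exact this
  have h3 : IsNilpotent A := by
    refine ⟨A.charpoly.roots.card, ?_⟩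
    have := Matrix.aeval_self_charpoly A
    rwa [h2, map_pow, Polynomial.aeval_X] at this
  exact h (Matrix.isNilpotent_trace_of_isNilpotent (h3.pow_of_pos hL)).eq_zero

/-- At fixed Trotter number the form-factor series converges to the Trotter approximant of the
correlation function of the infinite chain. -/
theorem exists_tendsto_formFactorSeries (hMo : Mo.IsFundamental U) (T t : ℝ) (n m : ℕ)
    {x y : Matrix (Fin d) (Fin d) ℂ} {s : ℂ} (hx : Mo.phi * x - x * Mo.phi = s • x)
    (hν : ∀ k, Mo.inhomogeneity T t n 0 k ∈ U) (hτ : Mo.tR t / (2 * n : ℕ) ∈ U)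
    (hτ' : -(Mo.tR t / (2 * n : ℕ)) ∈ U)
    (h1 : -(Mo.ks * (1 / T + Complex.I * t)) / (2 * n : ℕ) ∈ U)
    (h2 : Mo.ks * (1 / T + Complex.I * t) / (2 * n : ℕ) ∈ U)
    (hdom : HasDominantEigenvalue (Mo.dynQtm T t n 0 0)) {L : ℕ} (hL : L ≠ 0)
    (htr : Matrix.trace (Mo.dynQtm T t n 0 0 ^ L) ≠ 0)
    (hinv : ∀ᶠ ε : ℂ in 𝓝[≠] 0, IsUnit (Mo.dynQtm T t n ε ε) ∧
      IsUnit (Mo.dynQtm T t n ε (Mo.tR t / (2 * n : ℕ))) ∧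
      IsUnit (Mo.dynQtm T t n ε (-(Mo.tR t / (2 * n : ℕ)))))
    {E : ℂ → StateData d (2 * (2 * n) + 2)}
    (hE : ∀ᶠ ε : ℂ in 𝓝[≠] 0, (E ε).IsEigenbasis U (Mo.dynQtm T t n ε)) :
    ∃ b : ℂ, Tendsto (fun l => Mo.trotterCorrelator n (l + m + 1) T t x y 0
        (LatticeModel.farSite l m)) atTop (𝓝 b) ∧
      Tendsto (fun ε => Mo.formFactorSeries T t x y s m n ε (E ε)) (𝓝[≠] 0) (𝓝 b) := by
  obtain ⟨Λ, hmult, hdom⟩ := hdom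
  have hΛ : Λ ≠ 0 := dominant_ne_zero hdom hL htr
  have hle : 𝓝[≠] (0 : ℂ) ≤ 𝓝 0 := nhdsWithin_le_nhds
  have hA := (tendsto_dynQtm hMo T t n hν (tendsto_const_nhds (x := (0 : ℂ)))).mono_left hle
  have hA' := (tendsto_dynQtm hMo T t n hν tendsto_id).mono_left hle
  have hY := (tendsto_dynEntry hMo T t n hν y tendsto_id).mono_left hle
  set A := Mo.dynQtm T t n 0 0 with hAdef
  obtain ⟨hev, P, hP, htrP, hPP, hAP, hPA, hfix⟩ := exists_tendsto_rankOne hA hmult hdom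
    (b := fun ε => (E ε).ket) (w := fun ε => (E ε).bra) (ev := fun ε k => (E ε).ev k 0)
    (k := fun ε => (E ε).dom) (hE.mono fun ε h =>
      ⟨h.dual, fun j => h.eigen j 0 hMo.zero_mem, h.dominant⟩)
  have htrace : Continuous fun M : Op d (Fin (2 * (2 * n) + 2)) => Matrix.trace M :=
    continuous_id.matrix_trace
  refine ⟨Complex.exp (Complex.I * t * Mo.alpha * s) *
    (Matrix.trace (siteOp (midSite n) x * A ^ m * Mo.dynEntry T t n 0 y 0 * P) / Λ ^ (m + 1)),
    ?_, ?_⟩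
  · have hpow := tendsto_smul_pow_projection hΛ hPP hAP hPA hfix hdom
    refine ((tendsto_trace_mul_pow_div hΛ hpow htrP (siteOp (midSite n) x * A ^ m *
      Mo.dynEntry T t n 0 y 0) m).const_mul _).congr fun l => ?_
    rw [trotterCorrelator_eq hMo T t l m hx h1 h2, mul_div_assoc]
    simp only [mul_assoc]
    rfl
  -- Dominance is assumed for `t(0)` only, whereas this is the eigenvalue of `t(ε)` on the same
  -- state. It is the trace of `t(ε)` times the projection, and both factors converge.
  · have hevε : Tendsto (fun ε => (E ε).ev (E ε).dom ε) (𝓝[≠] 0) (𝓝 Λ) := by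
      have h3 := (htrace.tendsto _).comp (hA'.mul hP)
      rw [hAP, Matrix.trace_smul, htrP, smul_eq_mul, mul_one] at h3
      refine h3.congr' ?_
      filter_upwards [hE, hle (IsFundamental_mem_nhds hMo)] with ε h hε
      rw [Function.comp_apply, trace_mul_rankOne, id, h.eigen _ _ hε, dotProduct_smul, smul_eq_mul,
        mul_comm, mul_assoc, mul_inv_cancel₀ (dual_self_ne_zero h.dual _), mul_one]
    have hnum := (htrace.tendsto _).comp (((hA.pow m).const_mul (siteOp (midSite n) x)).mul hY
      |>.mul hP)
    have hden := hevε.mul (hev.pow m)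
    rw [← pow_succ'] at hden
    refine ((hnum.div hden (pow_ne_zero _ hΛ)).const_mul _).congr' ?_
    have hνε : ∀ᶠ ε in 𝓝[≠] (0 : ℂ), ∀ k, Mo.inhomogeneity T t n ε k ∈ U :=
      eventually_all.2 fun k => ((tendsto_inhomogeneity T t n k).mono_left hle).eventually_mem
        (hMo.isOpen.mem_nhds (hν k))
    filter_upwards [hE, hinv, hνε, hle (IsFundamental_mem_nhds hMo)] with ε h h3 h4 hε
    rw [formFactorSeries_eq hMo T t n h4 hε hτ hτ' x y s m h3.1 h3.2.1 h3.2.2 h]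
    rfl

theorem eventually_div_mem (hMo : Mo.IsFundamental U) (c : ℂ) :
    ∀ᶠ n : ℕ in atTop, c / (2 * n : ℕ) ∈ U := by
  have h : Tendsto (fun n : ℕ => c / (2 * n : ℕ)) atTop (𝓝 0) :=
    (tendsto_const_div_atTop_nhds_zero_nat c).comp
      (tendsto_id.const_mul_atTop' (by norm_num : 0 < 2))
  exact h.eventually_mem (IsFundamental_mem_nhds hMo)

theorem eventually_inhomogeneity_mem (hMo : Mo.IsFundamental U) (T t : ℝ) :
    ∀ᶠ n : ℕ in atTop, ∀ k, Mo.inhomogeneity T t n 0 k ∈ U := by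
  filter_upwards [eventually_div_mem hMo (Mo.tR t), eventually_div_mem hMo (-Mo.tR t),
    eventually_div_mem hMo (Mo.tR t + Mo.ks / T),
    eventually_div_mem hMo (-(Mo.tR t + Mo.ks / T))] with n h1 h2 h3 h4 k
  rw [neg_div] at h2 h4
  have h0 := hMo.zero_mem
  simp only [LatticeModel.inhomogeneity]
  split_ifs <;> simpa only [neg_neg, neg_zero]

end Main

end QTM

end

/-! ### Assembly of the limits. -/

theorem mainTheorem1 {d : ℕ} (Mo : QTM.LatticeModel d) (U : Set ℂ) (hMo : Mo.IsFundamental U)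
    (T t : ℝ) (hT : 0 < T) (m : ℕ)
    (x y : Matrix (Fin d) (Fin d) ℂ)
    -- `x` is an eigenvector of the adjoint action of the field operator, with eigenvalue `s(x)`
    (s : ℂ) (hx : Mo.phi * x - x * Mo.phi = s • x)
    -- the thermal averages are defined on long chains
    (hZ : ∀ᶠ l : ℕ in atTop, Mo.partitionFunction (l + m + 1) T ≠ 0)
    -- the limits of infinite chain length and of infinite Trotter number can be interchanged
    (hLN : QTM.LimitsInterchange fun n l =>
      Mo.trotterCorrelator n (l + m + 1) T t x y 0 (QTM.LatticeModel.farSite l m))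
    -- the quantum transfer matrix has a single dominant eigenvalue
    (hdom : ∀ᶠ n : ℕ in atTop, QTM.HasDominantEigenvalue (Mo.dynQtm T t n 0 0))
    -- invertibility of the quantum transfer matrix where its inverse occurs
    (hinv : ∀ᶠ n : ℕ in atTop, ∀ᶠ ε : ℂ in 𝓝[≠] 0,
      IsUnit (Mo.dynQtm T t n ε ε) ∧
      IsUnit (Mo.dynQtm T t n ε (Mo.tR t / (2 * n : ℕ))) ∧
      IsUnit (Mo.dynQtm T t n ε (-(Mo.tR t / (2 * n : ℕ)))))
    -- complete sets of eigenstates, for large Trotter number and small regularization parameter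
    (E : ∀ (n : ℕ), ℂ → QTM.StateData d (2 * (2 * n) + 2))
    (hE : ∀ᶠ n : ℕ in atTop, ∀ᶠ ε : ℂ in 𝓝[≠] 0,
      (E n ε).IsEigenbasis U (Mo.dynQtm T t n ε)) :
    ∃ G : ℂ, Mo.IsDynamicalCorrelator T t x y m G ∧
      ∃ F : ℕ → ℂ,
        (∀ᶠ n : ℕ in atTop,
          Tendsto (fun ε : ℂ => Mo.formFactorSeries T t x y s m n ε (E n ε)) (𝓝[≠] 0)
            (𝓝 (F n))) ∧
        Tendsto F atTop (𝓝 G) := by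
  -- For `d = 0` there would be no label for the dominant state.
  have : NeZero d := ⟨by
    rintro rfl
    exact (Fin.cast (zero_pow (by norm_num)) (E 0 0).dom).elim0⟩
  have hfin : ∀ᶠ l : ℕ in atTop, Tendsto (fun n => Mo.trotterCorrelator n (l + m + 1) T t x y 0
      (QTM.LatticeModel.farSite l m)) atTop
      (𝓝 (Mo.finiteCorrelator (l + m + 1) T t x y 0 (QTM.LatticeModel.farSite l m))) := by
    filter_upwards [hZ, eventually_ge_atTop 1] with l h1 h2
    exact QTM.tendsto_trotterCorrelator hMo (by omega) T t x y _ _ h1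
  -- One chain length with nonzero partition function suffices: there the trace of a power of the
  -- quantum transfer matrix tends to it as `N → ∞`, which keeps the dominant eigenvalue nonzero for
  -- large `N`. The bound `1 ≤ l₀` ensures a chain of at least two sites.
  obtain ⟨l₀, hZ₀, hl₀⟩ := (hZ.and (eventually_ge_atTop 1)).exists
  have htr : ∀ᶠ n : ℕ in atTop, Matrix.trace (Mo.dynQtm T t n 0 0 ^ (l₀ + m + 1)) ≠ 0 := by
    refine ((QTM.tendsto_trotter_partitionFunction hMo (by omega) T t).eventually_ne hZ₀).mono
      fun n hn => ?_
    rwa [QTM.trace_trotterRho_eq hMo] at hn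
  have hex : ∀ᶠ n : ℕ in atTop, ∃ b : ℂ,
      Tendsto (fun l => Mo.trotterCorrelator n (l + m + 1) T t x y 0
        (QTM.LatticeModel.farSite l m)) atTop (𝓝 b) ∧
      Tendsto (fun ε => Mo.formFactorSeries T t x y s m n ε (E n ε)) (𝓝[≠] 0) (𝓝 b) := by
    filter_upwards [hdom, hinv, hE, htr, QTM.eventually_inhomogeneity_mem hMo T t,
      QTM.eventually_div_mem hMo (Mo.tR t), QTM.eventually_div_mem hMo (-Mo.tR t),
      QTM.eventually_div_mem hMo (-(Mo.ks * (1 / T + Complex.I * t))),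
      QTM.eventually_div_mem hMo (Mo.ks * (1 / T + Complex.I * t))]
      with n h1 h2 h3 h4 h5 h6 h7 h8 h9
    rw [neg_div] at h7
    exact QTM.exists_tendsto_formFactorSeries hMo T t n m hx h5 h6 h7 h8 h9 h1 (by omega) h4 h2 h3
  obtain ⟨b, hb⟩ := hex.choice
  -- Both inner limits are now known: the thermal averages for `N → ∞`, and `b n`, which is also the
  -- limit of the series in `ε`, for `L → ∞`.
  obtain ⟨G, hG, hbG⟩ := hLN _ b hfin (hb.mono fun n h => h.1)
  exact ⟨G, hG, b, hb.mono fun n h => h.2, hbG⟩
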